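/- Let $(M_1,g_1,J)$ be a Kähler manifold, i.e. a smooth Riemannian manifold with Levi-Civita connection $\nabla$ and a smooth $(1,1)$-tensor field $J$ such that $J^2=-I$, $g_1(JX,JY)=g_1(X,Y)$ and $\nabla J=0$, and let $(M_2,g_2)$ be a smooth Riemannian manifold with $\dim M_2<\dim M_1$. Let $F:M_1\to M_2$ be a slant submersion with slant angle $\theta\neq 0$. That is, $F$ is a smooth surjective map of maximal rank, $F_*$ preserves the lengths of vectors in the horizontal distribution $(\ker F_*)^\perp$, and for every $p\in M_1$ and every nonzero $v\in\ker F_{*p}$ the angle between $Jv$ and the subspace $\ker F_{*p}$ equals the constant $\theta$. Let $\mathcal V$ and $\mathcal H$ be the orthogonal projections onto $\ker F_*$ and $(\ker F_*)^\perp$. For vertical $X$ write $\phi X=\mathcal V(JX)$ and $\omega X=\mathcal H(JX)$; for horizontal $Z$ write $\mathcal BZ=\mathcal V(JZ)$ and $\mathcal CZ=\mathcal H(JZ)$. For vector fields $E,G$ on $M_1$ let $$\mathcal T_EG=\mathcal H\nabla_{\mathcal VE}\mathcal VG+\mathcal V\nabla_{\mathcal VE}\mathcal HG,\qquad \mathcal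 A_EG=\mathcal H\nabla_{\mathcal HE}\mathcal VG+\mathcal V\nabla_{\mathcal HE}\mathcal HG .$$ Then the following are equivalent: (1) $M_1$ is locally a product Riemannian manifold with respect to $\ker F_*$ and $(\ker F_*)^\perp$: every point of $M_1$ has an open neighbourhood that is isometric to a Riemannian product $U\times V$ in such a way that $\ker F_*$ corresponds to the distribution tangent to the slices $U\times\{v\}$ and $(\ker F_*)^\perp$ to the distribution tangent to the slices $\{u\}\times V$. (2) For all $X,Y\in\Gamma(\ker F_*)$ and $Z_1,Z_2\in\Gamma((\ker F_*)^\perp)$, $$g_1(\mathcal H\nabla_{Z_1}Z_2,\omega\phi X)=g_1(\mathcal A_{Z_1}\mathcal BZ_2+\mathcal H\nabla_{Z_1}\mathcal CZ_2,\omega X)$$ and $$g_1(\mathcal H\nabla_X\omega\phi Y,Z_1)=g_1(\mathcal H\nabla_X\omega Y,\mathcal CZ_1)+g_1(\mathcal T_X\omega Y,\mathcal BZ_1).$$ (3) Both distributions $\ker F_*$ and $(\ker F_*)^\perp$ define totally geodesic foliations on $M_1$, i.e. $\nabla_XY\in\Gamma(D)$ for all $X,Y\in\Gamma(D)$, where $D$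 is either of the two distributions. -/

import Mathlib

open Bundle
open scoped Manifold ContDiff InnerProductSpace

noncomputable section

namespace SlantSubmersion

section TotalSpace

variable {m : ℕ} {M : Type*} [TopologicalSpace M] [ChartedSpace (EuclideanSpace ℝ (Fin m)) M]

/-- (Not necessarily smooth) vector fields on `M`. -/
abbrev VField (m : ℕ) (M : Type*) [TopologicalSpace M]
    [ChartedSpace (EuclideanSpace ℝ (Fin m)) M] : Type _ :=
  ∀ x : M, TangentSpace (𝓡 m) x

/-- A distribution on `M`: a subspace of each tangent space. -/
abbrev Distr (m : ℕ) (M : Type*) [TopologicalSpace M]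
    [ChartedSpace (EuclideanSpace ℝ (Fin m)) M] : Type _ :=
  ∀ x : M, Submodule ℝ (TangentSpace (𝓡 m) x)

/-- `X` is a smooth section of the distribution `D`, i.e. `X ∈ Γ(D)`. -/
def IsSection [IsManifold (𝓡 m) ∞ M] (D : Distr m M) (X : VField m M) : Prop :=
  ContMDiff (𝓡 m) (𝓡 m).tangent ∞ (fun x ↦ (⟨x, X x⟩ : TangentBundle (𝓡 m) M)) ∧
    ∀ x, X x ∈ D x

variable [RiemannianBundle (fun x : M ↦ TangentSpace (𝓡 m) x)]

/-! ### The Levi-Civita connection -/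

/-- The right-hand side of Koszul's formula
`2 g(∇_X Y, Z) = X g(Y, Z) + Y g(Z, X) - Z g(X, Y) + g([X, Y], Z) - g([Y, Z], X) + g([Z, X], Y)`. -/
def koszul (X Y Z : VField m M) (p : M) : ℝ :=
  mvfderiv (𝓡 m) (fun x ↦ ⟪Y x, Z x⟫_ℝ) p (X p)
    + mvfderiv (𝓡 m) (fun x ↦ ⟪Z x, X x⟫_ℝ) p (Y p)
    - mvfderiv (𝓡 m) (fun x ↦ ⟪X x, Y x⟫_ℝ) p (Z p)
    + ⟪VectorField.mlieBracket (𝓡 m) X Y p, Z p⟫_ℝ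
    - ⟪VectorField.mlieBracket (𝓡 m) Y Z p, X p⟫_ℝ
    + ⟪VectorField.mlieBracket (𝓡 m) Z X p, Y p⟫_ℝ

instance finiteDimensional_tangentSpace (p : M) :
    FiniteDimensional ℝ (TangentSpace (𝓡 m) p) :=
  inferInstanceAs (FiniteDimensional ℝ (EuclideanSpace ℝ (Fin m)))

/-- The Levi-Civita connection: `nabla X Y` is the vector field `∇_X Y`. Its value at `p` is the
vector whose inner product with each member `e i` of an orthonormal basis of `T_p M` is given by
Koszul's formula, where `e i` is extended to a vector field that is smooth near `p`
(see `two_mul_inner_nabla` for the independence of these choices). -/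
def nabla [IsManifold (𝓡 m) ∞ M] (X Y : VField m M) : VField m M := fun p ↦
  let e := stdOrthonormalBasis ℝ (TangentSpace (𝓡 m) p)
  ∑ i, (koszul X Y (FiberBundle.extend (EuclideanSpace ℝ (Fin m)) (e i)) p / 2) • e i

section Koszul

variable [IsManifold (𝓡 m) ∞ M]
  [IsContMDiffRiemannianBundle (𝓡 m) ∞ (EuclideanSpace ℝ (Fin m))
    (fun x : M ↦ TangentSpace (𝓡 m) x)]

/-- `X` is differentiable at `p`. -/
def IsDiffAt (X : VField m M) (p : M) : Prop :=
  MDifferentiableAt (𝓡 m) (𝓡 m).tangent (fun x ↦ (⟨x, X x⟩ : TangentBundle (𝓡 m) M)) p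

theorem IsDiffAt.inner {X Y : VField m M} {p : M} (hX : IsDiffAt X p) (hY : IsDiffAt Y p) :
    MDifferentiableAt (𝓡 m) 𝓘(ℝ) (fun x ↦ ⟪X x, Y x⟫_ℝ) p :=
  have : IsContMDiffRiemannianBundle (𝓡 m) 1 (EuclideanSpace ℝ (Fin m))
    (fun x : M ↦ TangentSpace (𝓡 m) x) := IsContMDiffRiemannianBundle.of_le (n := ∞) (by norm_cast)
  MDifferentiableAt.inner_bundle (b := fun x : M ↦ x) (E := fun x : M ↦ TangentSpace (𝓡 m) x) hX hY

theorem koszul_tensorial {X Y : VField m M} {p : M} (hX : IsDiffAt X p) (hY : IsDiffAt Y p) :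
    TensorialAt (𝓡 m) (EuclideanSpace ℝ (Fin m)) (fun Z : VField m M ↦ koszul X Y Z p) p where
  smul {f Z} hf hZ := by
    have h1 : MDifferentiableAt (𝓡 m) 𝓘(ℝ) (fun x ↦ ⟪Y x, Z x⟫_ℝ) p := hY.inner hZ
    have h2 : MDifferentiableAt (𝓡 m) 𝓘(ℝ) (fun x ↦ ⟪Z x, X x⟫_ℝ) p := IsDiffAt.inner hZ hX
    simp only [koszul, Pi.smul_apply', real_inner_smul_left, real_inner_smul_right]
    rw [VectorField.mlieBracket_smul_right hf hZ, VectorField.mlieBracket_smul_left hf hZ,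
      mvfderiv_fun_mul hf h1, mvfderiv_fun_mul hf h2]
    simp [inner_add_left, real_inner_smul_left]
    rw [real_inner_comm (Z p) (Y p)]
    ring
  add {Z Z'} hZ hZ' := by
    have h1 : MDifferentiableAt (𝓡 m) 𝓘(ℝ) (fun x ↦ ⟪Y x, Z x⟫_ℝ) p := hY.inner hZ
    have h2 : MDifferentiableAt (𝓡 m) 𝓘(ℝ) (fun x ↦ ⟪Z x, X x⟫_ℝ) p := IsDiffAt.inner hZ hX
    have h1' : MDifferentiableAt (𝓡 m) 𝓘(ℝ) (fun x ↦ ⟪Y x, Z' x⟫_ℝ) p := hY.inner hZ'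
    have h2' : MDifferentiableAt (𝓡 m) 𝓘(ℝ) (fun x ↦ ⟪Z' x, X x⟫_ℝ) p := IsDiffAt.inner hZ' hX
    simp only [koszul, Pi.add_apply, inner_add_left, inner_add_right]
    rw [VectorField.mlieBracket_add_right hZ hZ', VectorField.mlieBracket_add_left hZ hZ',
      mvfderiv_fun_add h1 h1', mvfderiv_fun_add h2 h2']
    simp [inner_add_left]
    ring

/-- Koszul's formula, for all fields that are differentiable at `p`. -/
theorem two_mul_inner_nabla {X Y Z : VField m M} {p : M} (hX : IsDiffAt X p) (hY : IsDiffAt Y p)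
    (hZ : IsDiffAt Z p) : 2 * ⟪nabla X Y p, Z p⟫_ℝ = koszul X Y Z p := by
  have ht := koszul_tensorial hX hY
  set L := TensorialAt.mkHom _ p ht with hL
  have h1 : L (Z p) = koszul X Y Z p := TensorialAt.mkHom_apply ht hZ
  let e := stdOrthonormalBasis ℝ (TangentSpace (𝓡 m) p)
  have h2 : nabla X Y p = ∑ i, (L (e i) / 2) • e i := rfl
  rw [← h1, h2, sum_inner]
  conv_rhs => rw [← e.sum_repr (Z p)]
  rw [map_sum, Finset.mul_sum]
  refine Finset.sum_congr rfl fun i _ ↦ ?_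
  rw [map_smul, real_inner_smul_left, e.repr_apply_apply, smul_eq_mul]
  ring

/-- The Levi-Civita connection is compatible with the metric. -/
theorem inner_nabla_add_inner_nabla {X Y Z : VField m M} {p : M} (hX : IsDiffAt X p)
    (hY : IsDiffAt Y p) (hZ : IsDiffAt Z p) :
    ⟪nabla X Y p, Z p⟫_ℝ + ⟪Y p, nabla X Z p⟫_ℝ
      = mvfderiv (𝓡 m) (fun x ↦ ⟪Y x, Z x⟫_ℝ) p (X p) := by
  have h1 := two_mul_inner_nabla hX hY hZ
  have h2 := two_mul_inner_nabla hX hZ hY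
  have hc (U V : VField m M) : (fun x ↦ ⟪U x, V x⟫_ℝ) = fun x ↦ ⟪V x, U x⟫_ℝ :=
    funext fun x ↦ real_inner_comm _ _
  have hs (U V : VField m M) := VectorField.mlieBracket_swap_apply (I := 𝓡 m) (V := U) (W := V)
    (x := p)
  rw [real_inner_comm (nabla X Z p)]
  simp only [koszul] at h1 h2
  rw [hc Z Y, hc Y X, hc X Z, hs X Z, hs Z Y, hs Y X] at h2
  simp only [inner_neg_left] at h2
  linarith

/-- The Levi-Civita connection is torsion free. -/
theorem nabla_sub_nabla {X Y : VField m M} {p : M} (hX : IsDiffAt X p) (hY : IsDiffAt Y p) :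
    nabla X Y p - nabla Y X p = VectorField.mlieBracket (𝓡 m) X Y p := by
  refine ext_inner_right ℝ fun v ↦ ?_
  have hv : IsDiffAt (FiberBundle.extend (EuclideanSpace ℝ (Fin m)) v : VField m M) p :=
    FiberBundle.mdifferentiableAt_extend ..
  have hv' : (FiberBundle.extend (EuclideanSpace ℝ (Fin m)) v : VField m M) p = v := by simp
  have h1 := two_mul_inner_nabla hX hY hv
  have h2 := two_mul_inner_nabla hY hX hv
  generalize (FiberBundle.extend (EuclideanSpace ℝ (Fin m)) v : VField m M) = Z at *
  have hc (U V : VField m M) : (fun x ↦ ⟪U x, V x⟫_ℝ) = fun x ↦ ⟪V x, U x⟫_ℝ :=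
    funext fun x ↦ real_inner_comm _ _
  have hs (U V : VField m M) := VectorField.mlieBracket_swap_apply (I := 𝓡 m) (V := U) (W := V)
    (x := p)
  simp only [koszul] at h1 h2
  rw [hc X Z, hc Z Y, hc Y X, hs Y X, hs X Z, hs Z Y] at h2
  simp only [inner_neg_left] at h2
  rw [inner_sub_left, ← hv']
  linarith

end Koszul

/-! ### Locally product Riemannian manifolds -/

/-- `g` is a smooth Riemannian metric on the open subset `U` of the Euclidean space `ℝ^k`. -/
structure IsMetricOn {k : ℕ} (U : Set (EuclideanSpace ℝ (Fin k)))
    (g : EuclideanSpace ℝ (Fin k) →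
      EuclideanSpace ℝ (Fin k) →L[ℝ] EuclideanSpace ℝ (Fin k) →L[ℝ] ℝ) : Prop where
  isOpen : IsOpen U
  smooth : ContDiffOn ℝ ∞ g U
  symm : ∀ x ∈ U, ∀ v w, g x v w = g x w v
  pos : ∀ x ∈ U, ∀ v, v ≠ 0 → 0 < g x v v

/-- `M` is locally a product Riemannian manifold with respect to the pair of distributions
`(D₁, D₂)`: every point has an open neighbourhood `Φ.source` that a diffeomorphism `Φ` identifies
isometrically with a product `(U, g₁) × (V, g₂)` of two Riemannian manifolds (which may be taken to
be open subsets of Euclidean spaces), in such a way that `D₁` is the tangent distribution of the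
slices `U × {v}` and `D₂` that of the slices `{u} × V`. -/
def IsLocallyProduct (D₁ D₂ : Distr m M) : Prop :=
  ∀ p : M, ∃ (k l : ℕ)
    (Φ : OpenPartialHomeomorph M (EuclideanSpace ℝ (Fin k) × EuclideanSpace ℝ (Fin l)))
    (U : Set (EuclideanSpace ℝ (Fin k))) (V : Set (EuclideanSpace ℝ (Fin l)))
    (g₁ : EuclideanSpace ℝ (Fin k) →
      EuclideanSpace ℝ (Fin k) →L[ℝ] EuclideanSpace ℝ (Fin k) →L[ℝ] ℝ)
    (g₂ : EuclideanSpace ℝ (Fin l) →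
      EuclideanSpace ℝ (Fin l) →L[ℝ] EuclideanSpace ℝ (Fin l) →L[ℝ] ℝ),
    p ∈ Φ.source ∧ Φ.target = U ×ˢ V ∧
    ContMDiffOn (𝓡 m) 𝓘(ℝ, EuclideanSpace ℝ (Fin k) × EuclideanSpace ℝ (Fin l)) ∞ Φ Φ.source ∧
    ContMDiffOn 𝓘(ℝ, EuclideanSpace ℝ (Fin k) × EuclideanSpace ℝ (Fin l)) (𝓡 m) ∞
      Φ.symm Φ.target ∧
    IsMetricOn U g₁ ∧ IsMetricOn V g₂ ∧
    (∀ x ∈ Φ.source, ∀ v w : TangentSpace (𝓡 m) x,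
      ⟪v, w⟫_ℝ = g₁ (Φ x).1 (mvfderiv (𝓡 m) Φ x v).1 (mvfderiv (𝓡 m) Φ x w).1
        + g₂ (Φ x).2 (mvfderiv (𝓡 m) Φ x v).2 (mvfderiv (𝓡 m) Φ x w).2) ∧
    ∀ x ∈ Φ.source, ∀ v : TangentSpace (𝓡 m) x,
      (v ∈ D₁ x ↔ (mvfderiv (𝓡 m) Φ x v).2 = 0) ∧ (v ∈ D₂ x ↔ (mvfderiv (𝓡 m) Φ x v).1 = 0)

/-- The distribution `D` defines a totally geodesic foliation: `∇_X Y ∈ Γ(D)` for all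
`X, Y ∈ Γ(D)`. (As `∇` is torsion free, `D` is then integrable, and its leaves are totally
geodesic.) -/
def IsTotallyGeodesic [IsManifold (𝓡 m) ∞ M] (D : Distr m M) : Prop :=
  ∀ X Y : VField m M, IsSection D X → IsSection D Y → ∀ p, nabla X Y p ∈ D p

/-! ### Kähler manifolds -/

/-- `J X` for a field `J` of endomorphisms of the tangent spaces and a vector field `X`. -/
def applyField (J : ∀ x : M, TangentSpace (𝓡 m) x →L[ℝ] TangentSpace (𝓡 m) x) (X : VField m M) :
    VField m M := fun x ↦ J x (X x)

/-- `J` is a smooth `(1,1)`-tensor field with `J² = -I` and `g(JX, JY) = g(X, Y)`. -/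
structure IsAlmostHermitian [IsManifold (𝓡 m) ∞ M]
    (J : ∀ x : M, TangentSpace (𝓡 m) x →L[ℝ] TangentSpace (𝓡 m) x) : Prop where
  smooth : ContMDiff (𝓡 m)
    ((𝓡 m).prod 𝓘(ℝ, EuclideanSpace ℝ (Fin m) →L[ℝ] EuclideanSpace ℝ (Fin m))) ∞
    (fun x ↦ TotalSpace.mk' (EuclideanSpace ℝ (Fin m) →L[ℝ] EuclideanSpace ℝ (Fin m))
      (E := fun x : M ↦ TangentSpace (𝓡 m) x →L[ℝ] TangentSpace (𝓡 m) x) x (J x))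
  sq : ∀ (x : M) (v : TangentSpace (𝓡 m) x), J x (J x v) = -v
  isometry : ∀ (x : M) (v w : TangentSpace (𝓡 m) x), ⟪J x v, J x w⟫_ℝ = ⟪v, w⟫_ℝ

/-- `J` is an almost Hermitian structure with `(∇_X J) Y = ∇_X (J Y) - J ∇_X Y = 0`. -/
structure IsKaehler [IsManifold (𝓡 m) ∞ M]
    (J : ∀ x : M, TangentSpace (𝓡 m) x →L[ℝ] TangentSpace (𝓡 m) x) : Prop
    extends IsAlmostHermitian J where
  parallel : ∀ X Y : VField m M, IsSection (fun _ ↦ ⊤) X → IsSection (fun _ ↦ ⊤) Y →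
    nabla X (applyField J Y) = applyField J (nabla X Y)

/-! ### Slant submersions -/

section Submersion

variable {n : ℕ} {N : Type*} [TopologicalSpace N] [ChartedSpace (EuclideanSpace ℝ (Fin n)) N]

variable (n) in
/-- The vertical distribution `ker F_*`. -/
def vertical (F : M → N) : Distr m M := fun x ↦ (mfderiv (𝓡 m) (𝓡 n) F x).ker

variable (n) in
/-- The horizontal distribution `(ker F_*)^⊥`. -/
def horizontal (F : M → N) : Distr m M := fun x ↦ (vertical n F x)ᗮ

variable (n) in
/-- The orthogonal projection `𝒱` onto `ker F_*`, applied to a vector field. -/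
def vert (F : M → N) (X : VField m M) : VField m M :=
  fun x ↦ (vertical n F x).starProjection (X x)

variable (n) in
/-- The orthogonal projection `ℋ` onto `(ker F_*)^⊥`, applied to a vector field. -/
def hor (F : M → N) (X : VField m M) : VField m M :=
  fun x ↦ (horizontal n F x).starProjection (X x)

variable (n) in
/-- O'Neill's tensor `𝒯_E G = ℋ ∇_{𝒱E} 𝒱G + 𝒱 ∇_{𝒱E} ℋG`. -/
def tensorT [IsManifold (𝓡 m) ∞ M] (F : M → N) (E G : VField m M) : VField m M :=
  hor n F (nabla (vert n F E) (vert n F G)) + vert n F (nabla (vert n F E) (hor n F G))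

variable (n) in
/-- O'Neill's tensor `𝒜_E G = ℋ ∇_{ℋE} 𝒱G + 𝒱 ∇_{ℋE} ℋG`. -/
def tensorA [IsManifold (𝓡 m) ∞ M] (F : M → N) (E G : VField m M) : VField m M :=
  hor n F (nabla (hor n F E) (vert n F G)) + vert n F (nabla (hor n F E) (hor n F G))

/-- `F` is a Riemannian submersion of `M` onto `N`. -/
structure IsRiemannianSubmersion [RiemannianBundle (fun y : N ↦ TangentSpace (𝓡 n) y)]
    (F : M → N) : Prop where
  dim_lt : n < m
  smooth : ContMDiff (𝓡 m) (𝓡 n) ∞ F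
  surjective : Function.Surjective F
  surjective_mfderiv : ∀ x, Function.Surjective (mfderiv (𝓡 m) (𝓡 n) F x)
  norm_mfderiv : ∀ x, ∀ v ∈ horizontal n F x, ‖mfderiv (𝓡 m) (𝓡 n) F x v‖ = ‖v‖

/-- `F` is a slant submersion with slant angle `θ`: it is a Riemannian submersion, and for every
nonzero vertical vector `v` the angle between `J v` and the space `ker F_*`, that is, the angle
between `J v` and its orthogonal projection to `ker F_*` (understood to be `π / 2` if this
projection is `0`), equals `θ`. -/
structure IsSlantSubmersion [RiemannianBundle (fun y : N ↦ TangentSpace (𝓡 n) y)]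
    (J : ∀ x : M, TangentSpace (𝓡 m) x →L[ℝ] TangentSpace (𝓡 m) x) (F : M → N) (θ : ℝ) : Prop
    extends IsRiemannianSubmersion (m := m) (n := n) F where
  angle_eq : ∀ x, ∀ v ∈ vertical n F x, v ≠ 0 →
    InnerProductGeometry.angle (J x v) ((vertical n F x).starProjection (J x v)) = θ

variable (J : ∀ x : M, TangentSpace (𝓡 m) x →L[ℝ] TangentSpace (𝓡 m) x) (F : M → N)

variable (n) in
/-- `φX = 𝒱(JX)`, for vertical `X`. -/
def phi (X : VField m M) : VField m M := vert n F (applyField J X)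

variable (n) in
/-- `ωX = ℋ(JX)`, for vertical `X`. -/
def omega (X : VField m M) : VField m M := hor n F (applyField J X)

variable (n) in
/-- `ℬZ = 𝒱(JZ)`, for horizontal `Z`. -/
def tensorB (Z : VField m M) : VField m M := vert n F (applyField J Z)

variable (n) in
/-- `𝒞Z = ℋ(JZ)`, for horizontal `Z`. -/
def tensorC (Z : VField m M) : VField m M := hor n F (applyField J Z)

end Submersion

end TotalSpace

end SlantSubmersion
end

/-! The equations in (2) measure the failure of (3). Since `φ` scales inner products of vertical
vectors by `cos² θ` and is skew-adjoint, `φ² = -cos² θ`, hence `J ω X = -sin² θ X - ω φ X`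
(`applyField_omega`). As `J` is parallel and skew, pairing `∇_{Z₁} J Z₂` with `ωX`, or `∇_X ωY` with
`J Z₁`, gives the other side of the respective equation plus `sin² θ ⟪∇_{Z₁} Z₂, X⟫` or `sin² θ ⟪∇_X
Y, Z₁⟫` (`horizontal_equation`, `vertical_equation`). The angle lies in `[0, π/2]` and is not `0`,
so `sin² θ ≠ 0`, and each equation says that one of the two distributions is totally geodesic.

The equivalence of (1) and (3) holds for any Riemannian submersion. In a product chart Koszul's
formula shows that both factors are totally geodesic (`IsLocallyProduct.isTotallyGeodesic`).
Conversely, torsion-freeness makes a totally geodesic horizontal distribution involutive. Horizontal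
lifts of coordinate fields of the base then commute: their brackets are vertical because the lifts
are `F`-related to commuting fields, and horizontal by involutivity. Frobenius
(`exists_firstIntegrals`) yields a submersion `u` with kernel the horizontal distribution, while a
chart `ψ` of the base gives `ψ ∘ F` with kernel the vertical one. The pair `(u, ψ ∘ F)` is a chart
adapted to both (`isLocallyProduct`). There Koszul's formula reads `2 ⟪∇_a b, c⟫ = -∂_c ⟪a, b⟫` for
`a, b` tangent to one factor and `c` to the other, so each diagonal block of the metric depends on
its own factor only (`exists_productMetric`).

Frobenius for a commuting frame `A(·) w` rests on smooth dependence of the solutions of `γ' = A(γ)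
w`, `γ(0) = u`, on `(u, w)`. This comes from the inverse function theorem for the integral equation
on the Banach space `C([0,1], E) × W`. Commutation gives `∂_h Ψ = A(Ψ) h` for the time-one map `Ψ(u,
w)`. -/

noncomputable section

namespace SlantSubmersion

universe u

open Filter Topology VectorField

/-! ### Smoothness of `γ ↦ f ∘ γ` on spaces of continuous functions. -/

section Superposition

variable {K : Type*} [TopologicalSpace K] [CompactSpace K]
  {E F G : Type u} [NormedAddCommGroup E] [NormedSpace ℝ E]
  [NormedAddCommGroup F] [NormedSpace ℝ F] [NormedAddCommGroup G] [NormedSpace ℝ G]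

variable (K) in
/-- The pointwise application of a continuous bilinear map to continuous functions. -/
def bilinCompLM (b : G →L[ℝ] E →L[ℝ] F) : C(K, G) →L[ℝ] C(K, E) →L[ℝ] C(K, F) :=
  LinearMap.mkContinuous₂
    (LinearMap.mk₂ ℝ (fun (L : C(K, G)) (h : C(K, E)) ↦
        (⟨fun t ↦ b (L t) (h t), by fun_prop⟩ : C(K, F)))
      (fun _ _ _ ↦ by ext; simp) (fun _ _ _ ↦ by ext; simp)
      (fun _ _ _ ↦ by ext; simp) (fun _ _ _ ↦ by ext; simp)) ‖b‖
    (fun L h ↦ by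
      rw [ContinuousMap.norm_le _ (by positivity)]
      intro t
      refine (b.le_opNorm₂ (L t) (h t)).trans ?_
      gcongr
      · exact L.norm_coe_le_norm t
      · exact h.norm_coe_le_norm t)

@[simp]
theorem bilinCompLM_apply (b : G →L[ℝ] E →L[ℝ] F) (L : C(K, G)) (h : C(K, E)) (t : K) :
    bilinCompLM K b L h t = b (L t) (h t) := rfl

/-- The mean value inequality is applied at each `t` separately; the bound is uniform in `t` because
`η ↦ f' ∘ η` is continuous for the sup norm. Writing the derivative of `f` as `b (f' x)` exhibits
the new derivative as a fixed continuous linear map applied to the superposition by `f'`. -/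
theorem hasFDerivAt_superposition (b : G →L[ℝ] E →L[ℝ] F)
    {f : C(E, F)} {f' : C(E, G)} (hf : ∀ x, HasFDerivAt f (b (f' x)) x) (γ : C(K, E)) :
    HasFDerivAt (fun γ : C(K, E) ↦ f.comp γ) (bilinCompLM K b (f'.comp γ)) γ := by
  rw [hasFDerivAt_iff_isLittleO_nhds_zero, Asymptotics.isLittleO_iff]
  intro ε hε
  have hc : Continuous fun η : C(K, E) ↦ f'.comp η := f'.continuous_postcomp
  obtain ⟨δ, hδ, H⟩ := Metric.continuousAt_iff.1 hc.continuousAt (ε / (‖b‖ + 1)) (by positivity)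
  filter_upwards [Metric.ball_mem_nhds (0 : C(K, E)) hδ] with h hh
  rw [mem_ball_zero_iff] at hh
  rw [ContinuousMap.norm_le _ (by positivity)]
  intro t
  -- A point of the segment is the value at `t` of the function `γ + s • h`, which is sup-close to
  -- `γ`.
  have key : ∀ x ∈ segment ℝ (γ t) (γ t + h t), ‖b (f' x) - b (f' (γ t))‖ ≤ ε := by
    intro x hx
    rw [segment_eq_image'] at hx
    obtain ⟨s, hs, rfl⟩ := hx
    have h1 : dist (γ + s • h) γ < δ := by
      rw [dist_eq_norm, add_sub_cancel_left, norm_smul, Real.norm_of_nonneg hs.1]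
      exact (mul_le_of_le_one_left (norm_nonneg _) hs.2).trans_lt hh
    have h2 := (ContinuousMap.dist_apply_le_dist
      (f := f'.comp (γ + s • h)) (g := f'.comp γ) t).trans
      (H h1).le
    rw [dist_eq_norm] at h2
    rw [← map_sub]
    calc _ ≤ ‖b‖ * (ε / (‖b‖ + 1)) := (b.le_opNorm _).trans
          (mul_le_mul_of_nonneg_left (by simpa using h2) (norm_nonneg _))
      _ ≤ (‖b‖ + 1) * (ε / (‖b‖ + 1)) := by gcongr; linarith
      _ = ε := by field_simp
  have := (convex_segment (γ t) (γ t + h t)).norm_image_sub_le_of_norm_hasFDerivWithin_le'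
    (φ := b (f' (γ t))) (fun x _ ↦ (hf x).hasFDerivWithinAt) key (left_mem_segment ..)
    (right_mem_segment ..)
  rw [add_sub_cancel_left] at this
  exact this.trans (mul_le_mul_of_nonneg_left (h.norm_coe_le_norm t) hε.le)

/-- The derivative is again a superposition, by a map into `E →L[ℝ] F`, so the induction runs over
all targets at once; a common universe keeps this target in range. -/
theorem contDiff_superposition_nat (n : ℕ) : ∀ {F : Type u} [NormedAddCommGroup F] [NormedSpace ℝ F]
    {f : C(E, F)}, ContDiff ℝ n f → ContDiff ℝ n (fun γ : C(K, E) ↦ f.comp γ) := by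
  induction n with
  | zero => exact fun _ ↦ contDiff_zero.2 (ContinuousMap.continuous_postcomp _)
  | succ n ih =>
    intro F _ _ f hf
    obtain ⟨f', hf', h⟩ := contDiff_succ_iff_hasFDerivAt.1 (by exact_mod_cast hf)
    obtain ⟨G, i1, i2, b, g, hg, hb⟩ : ∃ (G : Type u) (_ : NormedAddCommGroup G)
        (_ : NormedSpace ℝ G) (b : G →L[ℝ] E →L[ℝ] F) (g : C(E, G)), ContDiff ℝ n g ∧
        ∀ x, HasFDerivAt f (b (g x)) x :=
      ⟨E →L[ℝ] F, inferInstance, inferInstance, .id ℝ _, ⟨f', hf'.continuous⟩, hf', h⟩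
    exact_mod_cast contDiff_succ_iff_hasFDerivAt.2 ⟨fun γ ↦ bilinCompLM K b (g.comp γ),
      (bilinCompLM K b).contDiff.comp (ih hg), hasFDerivAt_superposition b hb⟩

theorem contDiff_superposition {f : C(E, F)} (hf : ContDiff ℝ ∞ f) :
    ContDiff ℝ ∞ (fun γ : C(K, E) ↦ f.comp γ) :=
  contDiff_infty.2 fun n ↦ contDiff_superposition_nat n (hf.of_le (by exact_mod_cast le_top))

end Superposition

/-- The inverse is smooth wherever the derivative is invertible. Invertibility is an open condition
on a complete space, so it suffices to shrink the source of the local inverse to the set where it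
holds. -/
theorem exists_openPartialHomeomorph_of_contDiffOn {X Y : Type*} [NormedAddCommGroup X]
    [NormedSpace ℝ X] [CompleteSpace X] [NormedAddCommGroup Y] [NormedSpace ℝ Y]
    {f : X → Y} {O : Set X} (hO : IsOpen O) (hf : ContDiffOn ℝ ∞ f O) {x : X} (hx : x ∈ O)
    (e : X ≃L[ℝ] Y) (he : HasFDerivAt f (e : X →L[ℝ] Y) x) :
    ∃ φ : OpenPartialHomeomorph X Y, x ∈ φ.source ∧ φ.source ⊆ O ∧ (φ : X → Y) = f ∧
      ContDiffOn ℝ ∞ φ φ.source ∧ ContDiffOn ℝ ∞ φ.symm φ.target := by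
  have hfx : ContDiffAt ℝ ∞ f x := hf.contDiffAt (hO.mem_nhds hx)
  let φ₀ := hfx.toOpenPartialHomeomorph f he (by simp)
  have hc : ContinuousOn (fderiv ℝ f) O := hf.continuousOn_fderiv_of_isOpen hO (by simp)
  let S := O ∩ fderiv ℝ f ⁻¹' (Set.range ((↑) : (X ≃L[ℝ] Y) → X →L[ℝ] Y))
  have hS : IsOpen S := hc.isOpen_inter_preimage hO ContinuousLinearEquiv.isOpen
  have hxS : x ∈ S := ⟨hx, by rw [Set.mem_preimage, he.fderiv]; exact ⟨e, rfl⟩⟩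
  have hco : (φ₀.restr S : X → Y) = f := by
    simp [φ₀, ContDiffAt.toOpenPartialHomeomorph_coe]
  have hsrc : (φ₀.restr S).source ⊆ S := by
    rw [φ₀.restr_source' _ hS]; exact Set.inter_subset_right
  refine ⟨φ₀.restr S, ?_, fun y hy ↦ (hsrc hy).1, hco, ?_, ?_⟩
  · rw [φ₀.restr_source' _ hS]
    exact ⟨hfx.mem_toOpenPartialHomeomorph_source he (by simp), hxS⟩
  · rw [hco]
    exact hf.mono fun y hy ↦ (hsrc hy).1
  · intro y hy
    have hy' := hsrc ((φ₀.restr S).map_target hy)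
    obtain ⟨e', he'⟩ := hy'.2
    have h1 : ContDiffAt ℝ ∞ f ((φ₀.restr S).symm y) := hf.contDiffAt (hO.mem_nhds hy'.1)
    refine ((φ₀.restr S).contDiffAt_symm (f₀' := e') hy ?_ ?_).contDiffWithinAt
    · rw [hco, he']
      exact (h1.differentiableAt (by simp)).hasFDerivAt
    · rwa [hco]

/-- Integration from `0`, as an operator on continuous functions on the unit interval. -/
def volterra (E : Type u) [NormedAddCommGroup E] [NormedSpace ℝ E] :
    C(unitInterval, E) →L[ℝ] C(unitInterval, E) :=
  LinearMap.mkContinuous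
    { toFun := fun γ ↦ ⟨fun t ↦ ∫ s in (0:ℝ)..t, γ (Set.projIcc 0 1 zero_le_one s), by
        have : Continuous fun t : ℝ ↦ ∫ s in (0:ℝ)..t, γ (Set.projIcc 0 1 zero_le_one s) :=
          intervalIntegral.continuous_primitive (fun a b ↦ Continuous.intervalIntegrable
            (γ.continuous.comp continuous_projIcc) a b) 0
        exact this.comp continuous_subtype_val⟩
      map_add' := fun γ η ↦ by
        ext t
        exact intervalIntegral.integral_add
          (Continuous.intervalIntegrable (γ.continuous.comp continuous_projIcc) _ _)
          (Continuous.intervalIntegrable (η.continuous.comp continuous_projIcc) _ _)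
      map_smul' := fun c γ ↦ by
        ext t
        exact intervalIntegral.integral_smul _ _ } 1
    (fun γ ↦ by
      rw [one_mul, ContinuousMap.norm_le _ (norm_nonneg _)]
      intro t
      refine (intervalIntegral.norm_integral_le_of_norm_le_const
        (C := ‖γ‖) fun s _ ↦ γ.norm_coe_le_norm _).trans ?_
      rw [sub_zero, abs_of_nonneg t.2.1]
      exact mul_le_of_le_one_right (norm_nonneg _) t.2.2)

/-! ### Smooth dependence for `γ' = A(γ) w`, and integral manifolds of commuting frames. -/

section Frobenius

variable {E G W : Type u} [NormedAddCommGroup E] [NormedSpace ℝ E]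
  [NormedAddCommGroup G] [NormedSpace ℝ G] [NormedAddCommGroup W] [NormedSpace ℝ W]

theorem volterra_apply (γ : C(unitInterval, E)) (t : unitInterval) :
    volterra E γ t = ∫ s in (0:ℝ)..t, γ (Set.projIcc 0 1 zero_le_one s) := rfl

theorem hasDerivAt_volterra [CompleteSpace E] (γ : C(unitInterval, E)) {s : ℝ}
    (hs : s ∈ Set.Ioo (0 : ℝ) 1) :
    HasDerivAt (fun s ↦ volterra E γ (Set.projIcc 0 1 zero_le_one s))
      (γ (Set.projIcc 0 1 zero_le_one s)) s := by
  have hc : Continuous fun s : ℝ ↦ γ (Set.projIcc 0 1 zero_le_one s) :=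
    γ.continuous.comp continuous_projIcc
  have := intervalIntegral.integral_hasDerivAt_right (hc.intervalIntegrable 0 s)
    hc.aestronglyMeasurable.stronglyMeasurableAtFilter hc.continuousAt
  refine this.congr_of_eventuallyEq ?_
  filter_upwards [isOpen_Ioo.mem_nhds hs] with r hr
  rw [volterra_apply, Set.projIcc_of_mem zero_le_one ⟨hr.1.le, hr.2.le⟩]

theorem eq_volterra_of_hasDerivAt [CompleteSpace E] {β δ : C(unitInterval, E)} (h0 : β 0 = 0)
    (h : ∀ s ∈ Set.Ioo (0 : ℝ) 1, HasDerivAt (fun s ↦ β (Set.projIcc 0 1 zero_le_one s))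
      (δ (Set.projIcc 0 1 zero_le_one s)) s) : β = volterra E δ := by
  ext t
  have hc : Continuous fun s : ℝ ↦ β (Set.projIcc 0 1 zero_le_one s) :=
    β.continuous.comp continuous_projIcc
  have hc' : Continuous fun s : ℝ ↦ δ (Set.projIcc 0 1 zero_le_one s) :=
    δ.continuous.comp continuous_projIcc
  rw [volterra_apply, intervalIntegral.integral_eq_sub_of_hasDerivAt_of_le t.2.1 hc.continuousOn
    (fun s hs ↦ h s ⟨hs.1, hs.2.trans_le t.2.2⟩) (hc'.intervalIntegrable _ _)]
  rw [Set.projIcc_val, Set.projIcc_left]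
  exact (sub_eq_self.2 h0).symm

/-- Both sides are derivatives of `γ ↦ A (γ t)`, factored through evaluation at `t` in two ways. -/
theorem fderiv_superposition_apply {A : C(E, G)} (hA : ContDiff ℝ ∞ A) (γ β : C(unitInterval, E))
    (t : unitInterval) :
    fderiv ℝ (fun γ : C(unitInterval, E) ↦ A.comp γ) γ β t = fderiv ℝ A (γ t) (β t) := by
  have h1 := ((contDiff_superposition (K := unitInterval) hA).differentiable (by simp)
    γ).hasFDerivAt
  have h2 := (ContinuousMap.evalCLM ℝ t : C(unitInterval, G) →L[ℝ] G).hasFDerivAt.comp γ h1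
  have h3 := (hA.differentiable (by simp) (γ t)).hasFDerivAt.comp γ
    (ContinuousMap.evalCLM ℝ t : C(unitInterval, E) →L[ℝ] E).hasFDerivAt
  exact DFunLike.congr_fun (h2.unique h3) β

variable (b : G →L[ℝ] W →L[ℝ] E)

/-- The map whose local inverse solves `γ t = u + ∫₀ᵗ A (γ s) w ds` for `(γ, w)`. -/
def integralOperator (A : C(E, G)) (x : C(unitInterval, E) × W) : C(unitInterval, E) × W :=
  (x.1 - volterra E (bilinCompLM unitInterval b (A.comp x.1) (.const _ x.2)), x.2)

variable (W) in
/-- The inclusion of constant functions as a continuous linear map. -/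
def constLM : W →L[ℝ] C(unitInterval, W) :=
  LinearMap.mkContinuous ⟨⟨fun w ↦ .const _ w, fun _ _ ↦ rfl⟩, fun _ _ ↦ rfl⟩ 1 (fun w ↦ by
    rw [one_mul, ContinuousMap.norm_le _ (norm_nonneg _)]
    exact fun _ ↦ le_rfl)

theorem hasFDerivAt_integralOperator {A : C(E, G)} (hA : ContDiff ℝ ∞ A)
    (x : C(unitInterval, E) × W) :
    ∃ L : C(unitInterval, E) × W →L[ℝ] C(unitInterval, E) × W,
      HasFDerivAt (integralOperator b A) L x ∧ ∀ β h, L (β, h) =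
      (β - volterra E (bilinCompLM unitInterval b (fderiv ℝ (fun γ ↦ A.comp γ) x.1 β)
        (.const _ x.2) + bilinCompLM unitInterval b (A.comp x.1) (.const _ h)), h) := by
  have h1 := (((contDiff_superposition (K := unitInterval) hA).differentiable (by simp)
    x.1).hasFDerivAt).comp x (hasFDerivAt_fst (𝕜 := ℝ) (p := x))
  have h2 := (constLM W).hasFDerivAt.comp x (hasFDerivAt_snd (𝕜 := ℝ) (p := x))
  have h3 := (bilinCompLM unitInterval b).hasFDerivAt_of_bilinear h1 h2
  have h4 := ((hasFDerivAt_fst (𝕜 := ℝ) (p := x)).sub ((volterra E).hasFDerivAt.comp x h3)).prodMk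
    (hasFDerivAt_snd (𝕜 := ℝ) (p := x))
  refine ⟨_, h4, fun β h ↦ ?_⟩
  rw [add_comm]
  rfl

set_option synthInstance.maxHeartbeats 200000 in
theorem contDiff_integralOperator {A : C(E, G)} (hA : ContDiff ℝ ∞ A) :
    ContDiff ℝ ∞ (integralOperator b A) := by
  have h1 : ContDiff ℝ ∞ fun x : C(unitInterval, E) × W ↦ A.comp x.1 :=
    (contDiff_superposition hA).comp contDiff_fst
  have h2 : ContDiff ℝ ∞ fun x : C(unitInterval, E) × W ↦ constLM W x.2 :=
    (constLM W).contDiff.comp contDiff_snd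
  have h3 : ContDiff ℝ ∞ fun x : C(unitInterval, E) × W ↦
      bilinCompLM unitInterval b (A.comp x.1) (constLM W x.2) :=
    (bilinCompLM unitInterval b).isBoundedBilinearMap.contDiff.comp (h1.prodMk h2)
  exact (contDiff_fst.sub ((volterra E).contDiff.comp h3)).prodMk contDiff_snd

/-- The derivative of `integralOperator b A` at `(const p, 0)`. -/
def integralOperatorEquiv (A : C(E, G)) (p : E) :
    (C(unitInterval, E) × W) ≃L[ℝ] (C(unitInterval, E) × W) :=
  let S : W →L[ℝ] C(unitInterval, E) := volterra E ∘L constLM E ∘L b (A p)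
  ContinuousLinearEquiv.equivOfInverse
    ((ContinuousLinearMap.fst ℝ _ _ - S ∘L ContinuousLinearMap.snd ℝ _ _).prod
      (ContinuousLinearMap.snd ℝ _ _))
    ((ContinuousLinearMap.fst ℝ _ _ + S ∘L ContinuousLinearMap.snd ℝ _ _).prod
      (ContinuousLinearMap.snd ℝ _ _))
    (fun x ↦ by ext <;> simp) (fun x ↦ by ext <;> simp)

/-- At `w = 0` the term containing the derivative of `A` drops out. What remains is unipotent in
block form, hence invertible without any smallness condition. -/
theorem hasFDerivAt_integralOperator_const {A : C(E, G)} (hA : ContDiff ℝ ∞ A) (p : E) :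
    HasFDerivAt (integralOperator b A) ((integralOperatorEquiv b A p :
      (C(unitInterval, E) × W) ≃L[ℝ] (C(unitInterval, E) × W)) :
        C(unitInterval, E) × W →L[ℝ] C(unitInterval, E) × W) (.const _ p, 0) := by
  obtain ⟨L, hL, h⟩ := hasFDerivAt_integralOperator b hA (.const _ p, 0)
  convert hL using 1
  refine ContinuousLinearMap.ext fun ⟨β, h'⟩ ↦ ?_
  rw [h]
  refine Prod.ext ?_ rfl
  show β - volterra E (constLM E (b (A p) h')) = β - _
  congr 2
  ext t
  simp only [ContinuousMap.add_apply, bilinCompLM_apply, ContinuousMap.const_apply, map_zero,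
    zero_add, ContinuousMap.comp_apply]
  rfl

/-- The variation of a solution `γ` of `γ' = A(γ) w` in the direction `h` of `w`, provided that the
fields `A(·) w` commute near the values of `γ`. -/
theorem fderiv_integralOperator_variation [CompleteSpace E] {A : C(E, G)} (hA : ContDiff ℝ ∞ A)
    {u : E} {w : W} {γ : C(unitInterval, E)} (hγ : integralOperator b A (γ, w) = (.const _ u, w))
    (hcomm : ∀ t w h, b (fderiv ℝ A (γ t) (b (A (γ t)) w)) h
      = b (fderiv ℝ A (γ t) (b (A (γ t)) h)) w) (h : W) :
    ∃ β : C(unitInterval, E), fderiv ℝ (integralOperator b A) (γ, w) (β, h) = (0, h) ∧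
      β 1 = b (A (γ 1)) h := by
  have hγ' : γ = .const _ u + volterra E (bilinCompLM unitInterval b (A.comp γ) (.const _ w)) :=
    sub_eq_iff_eq_add.1 (congrArg Prod.fst hγ)
  -- The variation must solve `β' = DA(γ)(β) w + A(γ) h`, `β 0 = 0`. Differentiating `t A(γ) h`
  -- gives `A(γ) h + t DA(γ)(A(γ) w) h`, and commutation exchanges `w` and `h` in the last term.
  let β : C(unitInterval, E) := ⟨fun t ↦ (t : ℝ) • b (A (γ t)) h, by fun_prop⟩
  refine ⟨β, ?_, by simp [β]⟩
  obtain ⟨L, hL, hL'⟩ := hasFDerivAt_integralOperator b hA (γ, w)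
  rw [hL.fderiv, hL']
  refine Prod.ext (sub_eq_zero.2 (eq_volterra_of_hasDerivAt (by simp [β]) fun s hs ↦ ?_)) rfl
  have h1 : HasDerivAt (fun s ↦ γ (Set.projIcc 0 1 zero_le_one s))
      (b (A (γ (Set.projIcc 0 1 zero_le_one s))) w) s := by
    have := (hasDerivAt_volterra
      (bilinCompLM unitInterval b (A.comp γ) (.const _ w)) hs).const_add u
    refine this.congr_of_eventuallyEq (.of_forall fun r ↦ ?_)
    exact DFunLike.congr_fun hγ' _
  have h2 := ((hA.differentiable (by simp)
    (γ (Set.projIcc 0 1 zero_le_one s))).hasFDerivAt.comp_hasDerivAt s h1)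
  have h3 := ((b.flip h).hasFDerivAt.comp_hasDerivAt s h2)
  have h4 := (hasDerivAt_id s).smul h3
  have h5 : HasDerivAt (fun s ↦ β (Set.projIcc 0 1 zero_le_one s)) _ s :=
    h4.congr_of_eventuallyEq (by
      filter_upwards [isOpen_Ioo.mem_nhds hs] with r hr
      simp [β, Set.projIcc_of_mem zero_le_one ⟨hr.1.le, hr.2.le⟩])
  convert h5 using 1
  simp only [ContinuousMap.add_apply, bilinCompLM_apply, fderiv_superposition_apply hA,
    ContinuousMap.const_apply, ContinuousMap.comp_apply]
  have h6 := hcomm (Set.projIcc 0 1 zero_le_one s) w h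
  have h7 : (Set.projIcc 0 1 zero_le_one s : ℝ) = s := by
    rw [Set.projIcc_of_mem zero_le_one ⟨hs.1.le, hs.2.le⟩]
  simp [β, h6, h7]

/-- `Ψ (u, w)` is the endpoint at time `1` of the solution starting at `u`. Its smoothness is that
of the local inverse of `integralOperator`, and its derivative in `w` is the endpoint of the
variation. -/
theorem exists_integralManifolds [CompleteSpace E] [CompleteSpace W] {A : C(E, G)}
    (hA : ContDiff ℝ ∞ A) {p : E}
    (hcomm : ∀ᶠ q in 𝓝 p, ∀ w h, b (fderiv ℝ A q (b (A q) w)) h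
      = b (fderiv ℝ A q (b (A q) h)) w) :
    ∃ (Ψ : E × W → E) (O : Set (E × W)), IsOpen O ∧ (p, 0) ∈ O ∧ ContDiffOn ℝ ∞ Ψ O ∧
      (∀ z ∈ O, ∀ h, fderiv ℝ Ψ z (0, h) = b (A (Ψ z)) h) ∧ ∀ u, (u, 0) ∈ O → Ψ (u, 0) = u := by
  obtain ⟨φ, hφ, -, hco, hsm, hsm'⟩ := exists_openPartialHomeomorph_of_contDiffOn isOpen_univ
    (contDiff_integralOperator b hA).contDiffOn (Set.mem_univ (.const _ p, 0))
    (integralOperatorEquiv b A p) (hasFDerivAt_integralOperator_const b hA p)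
  obtain ⟨ε, hε, H⟩ := Metric.eventually_nhds_iff_ball.1 hcomm
  have hconst (u : E) : integralOperator b A (.const _ u, (0 : W)) = (.const _ u, 0) := by
    refine Prod.ext ?_ rfl
    simp [integralOperator]
  let ι : E × W →L[ℝ] C(unitInterval, E) × W := (constLM E).prodMap (.id ℝ W)
  have hι (u : E) (w : W) : ι (u, w) = (.const _ u, w) := rfl
  -- A sup-norm ball about the constant path keeps every value of the solution where the frame
  -- commutes.
  let S : Set (C(unitInterval, E) × W) := φ.source ∩ Metric.ball (.const _ p) ε ×ˢ Set.univ
  have hS : IsOpen (φ.target ∩ φ.symm ⁻¹' S) := φ.isOpen_inter_preimage_symm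
    (φ.open_source.inter (Metric.isOpen_ball.prod isOpen_univ))
  have hφp : φ (.const _ p, 0) = (.const _ p, 0) := by rw [hco, hconst]
  let ev : C(unitInterval, E) × W →L[ℝ] E :=
    (ContinuousMap.evalCLM ℝ 1 : C(unitInterval, E) →L[ℝ] E) ∘L ContinuousLinearMap.fst ℝ _ _
  have hsmat {z} (hz : z ∈ φ.target) : ContDiffAt ℝ ∞ φ.symm z :=
    hsm'.contDiffAt (φ.open_target.mem_nhds hz)
  -- Membership in `φ.source` as well makes the constant path at `u` the solution that the local
  -- inverse selects for `w = 0`, so that `Ψ (u, 0) = u`.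
  refine ⟨fun z ↦ ev (φ.symm (ι z)), ι ⁻¹' (φ.target ∩ φ.symm ⁻¹' S ∩ φ.source),
    (hS.inter φ.open_source).preimage ι.continuous, ?_, ?_, ?_, ?_⟩
  · have h1 := φ.left_inv hφ
    have h2 := φ.map_source hφ
    rw [hφp] at h1 h2
    refine ⟨⟨h2, ?_⟩, hφ⟩
    show φ.symm (.const _ p, 0) ∈ S
    rw [h1]
    exact ⟨hφ, Metric.mem_ball_self hε, trivial⟩
  · intro z hz
    exact (ev.contDiff.contDiffAt.comp z ((hsmat hz.1.1).comp z
      ι.contDiff.contDiffAt)).contDiffWithinAt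
  · rintro ⟨u, w⟩ hz h
    obtain ⟨γ, w', hx⟩ : ∃ γ w', φ.symm (ι (u, w)) = (γ, w') := ⟨_, _, rfl⟩
    have hr := φ.right_inv hz.1.1
    rw [hx, hco, hι] at hr
    obtain rfl : w' = w := congrArg Prod.snd hr
    have hmem : (γ, w') ∈ S := by rw [← hx]; exact hz.1.2
    have hγ : dist γ (.const _ p) < ε := hmem.2.1
    obtain ⟨β, hβ, hβ1⟩ := fderiv_integralOperator_variation b hA hr (fun t ↦ H _
      ((ContinuousMap.dist_apply_le_dist (f := γ) (g := .const _ p) t).trans_lt hγ)) h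
    have hd := (hsmat hz.1.1).differentiableAt (by simp)
    have hd1 : HasFDerivAt (integralOperator b A)
        (fderiv ℝ (integralOperator b A) (γ, w')) (γ, w') :=
      ((contDiff_integralOperator b hA).differentiable (by simp) _).hasFDerivAt
    have hd2 : HasFDerivAt φ.symm (fderiv ℝ φ.symm (ι (u, w'))) (integralOperator b A (γ, w')) := by
      rw [hr, ← hι]; exact hd.hasFDerivAt
    -- The chain rule for `φ.symm ∘ φ = id`: the operator's derivative sends `(β, h)` to `(0, h)`,
    -- so that of the inverse sends `(0, h)` back to `(β, h)`.
    have hd3 := (hd2.comp _ hd1).unique ((hasFDerivAt_id (𝕜 := ℝ) (γ, w')).congr_of_eventuallyEq (by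
      filter_upwards [φ.open_source.mem_nhds hmem.1] with x hx
      have := φ.left_inv hx
      rwa [hco] at this))
    have hd4 : fderiv ℝ φ.symm (ι (u, w')) (0, h) = (β, h) := by
      rw [← hβ]; exact DFunLike.congr_fun hd3 (β, h)
    have hd5 : HasFDerivAt (fun z ↦ ev (φ.symm (ι z)))
        (ev ∘L fderiv ℝ φ.symm (ι (u, w')) ∘L ι) (u, w') :=
      ev.hasFDerivAt.comp _ (hd.hasFDerivAt.comp _ ι.hasFDerivAt)
    rw [hd5.fderiv]
    show ev (fderiv ℝ φ.symm (ι (u, w')) (constLM E 0, h)) = _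
    rw [map_zero, hd4]
    simp only [hx]
    exact hβ1
  · intro u hu
    have h1 := φ.left_inv hu.2
    rw [hco, hι, hconst] at h1
    show ev (φ.symm (ι (u, 0))) = u
    rw [hι, h1]
    rfl

end Frobenius

/-! ### The Frobenius theorem for commuting frames. -/

section FirstIntegrals

variable {E W : Type u} [NormedAddCommGroup E] [NormedSpace ℝ E] [FiniteDimensional ℝ E]
  [NormedAddCommGroup W] [NormedSpace ℝ W] [FiniteDimensional ℝ W]

/-- The superposition operator needs a globally smooth map. Cutting off destroys commutation away
from `p`, which is why the integral manifolds ask for it only near `p`. -/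
theorem exists_contDiff_eventuallyEq {G : Type*} [NormedAddCommGroup G] [NormedSpace ℝ G]
    {A : E → G} {O : Set E} (hO : IsOpen O) (hA : ContDiffOn ℝ ∞ A O) {p : E} (hp : p ∈ O) :
    ∃ A' : E → G, ContDiff ℝ ∞ A' ∧ A' =ᶠ[𝓝 p] A := by
  obtain ⟨ε, hε, hεO⟩ := Metric.isOpen_iff.1 hO p hp
  let χ : ContDiffBump p := ⟨ε / 4, ε / 2, by positivity, by linarith⟩
  refine ⟨fun q ↦ χ q • A q, contDiff_iff_contDiffAt.2 fun q ↦ ?_, ?_⟩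
  · by_cases hq : q ∈ O
    · exact χ.contDiff.contDiffAt.smul (hA.contDiffAt (hO.mem_nhds hq))
    · have hq' : q ∉ tsupport χ := fun h ↦ hq (hεO (by
        rw [χ.tsupport_eq] at h
        exact Metric.closedBall_subset_ball (by simp [χ]; linarith) h))
      refine (contDiffAt_const (c := (0 : G))).congr_of_eventuallyEq ?_
      filter_upwards [notMem_tsupport_iff_eventuallyEq.1 hq'] with x hx
      simp [hx]
  · filter_upwards [χ.eventuallyEq_one] with x hx
    simp [hx]

/-- **Frobenius theorem**: commuting, linearly independent vector fields `A(·) w` have, locally, a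
submersion that is constant along them. -/
theorem exists_firstIntegrals {A : E → W →L[ℝ] E} {O : Set E} (hO : IsOpen O)
    (hA : ContDiffOn ℝ ∞ A O) {p : E} (hp : p ∈ O) (hinj : Function.Injective (A p))
    (hcomm : ∀ q ∈ O, ∀ w h, fderiv ℝ A q (A q w) h = fderiv ℝ A q (A q h) w) {k : ℕ}
    (hk : k + Module.finrank ℝ W = Module.finrank ℝ E) :
    ∃ (f : E → EuclideanSpace ℝ (Fin k)) (O' : Set E), IsOpen O' ∧ p ∈ O' ∧ O' ⊆ O ∧
      ContDiffOn ℝ ∞ f O' ∧ ∀ q ∈ O', Function.Surjective (fderiv ℝ f q) ∧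
        ∀ w, fderiv ℝ f q (A q w) = 0 := by
  have := FiniteDimensional.complete ℝ E
  have := FiniteDimensional.complete ℝ W
  obtain ⟨A', hA', hAA'⟩ := exists_contDiff_eventuallyEq hO hA hp
  have hev : ∀ᶠ q in 𝓝 p, q ∈ O ∧ A' =ᶠ[𝓝 q] A :=
    (hO.eventually_mem hp).and (eventually_eventually_nhds.2 hAA')
  have hcomm' : ∀ᶠ q in 𝓝 p, ∀ w h, fderiv ℝ A' q (A' q w) h = fderiv ℝ A' q (A' q h) w := by
    filter_upwards [hev] with q hq
    rw [hq.2.fderiv_eq, hq.2.eq_of_nhds]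
    exact hcomm q hq.1
  obtain ⟨Ψ, U, hU, hpU, hΨ, hΨ', hΨ0⟩ := exists_integralManifolds (.id ℝ (W →L[ℝ] E))
    (A := ⟨A', hA'.continuous⟩) hA' hcomm'
  simp only [ContinuousLinearMap.id_apply, ContinuousMap.coe_mk] at hΨ'
  -- The map `(s, w) ↦ Ψ (p + s, w)` starts from a slice through `p` transverse to the frame. Its
  -- derivative at `0` is `(s, w) ↦ s + A p w`, an isomorphism since `S` complements the range of
  -- the injective `A p`.
  obtain ⟨S, hS⟩ := Submodule.exists_isCompl (LinearMap.range (A p).toLinearMap)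
  have hrank : Module.finrank ℝ S = k := by
    have h1 := Submodule.finrank_add_eq_of_isCompl hS
    rw [LinearMap.finrank_range_of_inj hinj] at h1
    omega
  let j : S × W →L[ℝ] E × W := S.subtypeL.prodMap (.id ℝ W)
  let f : S × W → E := fun z ↦ Ψ ((p, 0) + j z)
  let Oz : Set (S × W) := (fun z ↦ (p, 0) + j z) ⁻¹' U
  have hOz : IsOpen Oz := hU.preimage (by fun_prop)
  have h0 : (0 : S × W) ∈ Oz := by simpa [Oz] using hpU
  have hf : ContDiffOn ℝ ∞ f Oz := hΨ.comp (by fun_prop) (fun z hz ↦ hz)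
  have hdf {z} (hz : z ∈ Oz) : HasFDerivAt f (fderiv ℝ Ψ ((p, 0) + j z) ∘L j) z := by
    have h1 : HasFDerivAt (fun z ↦ (p, 0) + j z) j z := j.hasFDerivAt.const_add _
    exact ((hΨ.contDiffAt (hU.mem_nhds hz)).differentiableAt (by simp)).hasFDerivAt.comp z h1
  have hdf2 {z} (hz : z ∈ Oz) (h : W) : fderiv ℝ f z (0, h) = A' (f z) h := by
    rw [(hdf hz).fderiv, ← hΨ' _ hz h]
    simp [j]
  have hf0 : f 0 = p := by
    simp only [f, map_zero, add_zero]
    exact hΨ0 p hpU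
  have hd1 (s : S) : fderiv ℝ f 0 (s, 0) = s := by
    have h1 : HasFDerivAt (fun s : S ↦ f (s, 0)) (fderiv ℝ f 0 ∘L .inl ℝ S W) 0 :=
      HasFDerivAt.comp (f := fun s : S ↦ ((s, 0) : S × W)) (0 : S)
        (hdf h0).differentiableAt.hasFDerivAt (ContinuousLinearMap.inl ℝ S W).hasFDerivAt
    have h2 : HasFDerivAt (fun s : S ↦ p + (s : E)) S.subtypeL 0 :=
      S.subtypeL.hasFDerivAt.const_add p
    have h3 := h1.unique (h2.congr_of_eventuallyEq (by
      have : Tendsto (fun s : S ↦ ((s, 0) : S × W)) (𝓝 0) (𝓝 0) :=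
        (ContinuousLinearMap.inl ℝ S W).continuous.tendsto' _ _ (by simp)
      filter_upwards [this (hOz.mem_nhds h0)] with s hs
      have := hΨ0 (p + s) (by simpa [Oz, j] using hs)
      simpa [f, j] using this))
    exact DFunLike.congr_fun h3 s
  have hd (z : S × W) : fderiv ℝ f 0 z = z.1 + A p z.2 := by
    have : z = (z.1, 0) + (0, z.2) := by simp
    conv_lhs => rw [this, map_add, hd1, hdf2 h0, hf0, hAA'.eq_of_nhds]
  have hinj' : Function.Injective (fderiv ℝ f 0) := by
    rw [injective_iff_map_eq_zero]
    intro z hz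
    rw [hd] at hz
    have h1 : (z.1 : E) ∈ LinearMap.range (A p).toLinearMap ⊓ S :=
      ⟨⟨-z.2, by simp [eq_neg_of_add_eq_zero_left hz]⟩, z.1.2⟩
    rw [hS.inf_eq_bot, Submodule.mem_bot] at h1
    rw [h1, zero_add] at hz
    exact Prod.ext (Subtype.ext h1) (hinj (by simpa using hz))
  let e : (S × W) ≃L[ℝ] E := (LinearEquiv.ofInjectiveOfFinrankEq (fderiv ℝ f 0).toLinearMap hinj'
    (by rw [Module.finrank_prod, hrank, hk])).toContinuousLinearEquiv
  have he : HasFDerivAt f (e : S × W →L[ℝ] E) 0 := by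
    convert (hdf h0).differentiableAt.hasFDerivAt using 1
    exact ContinuousLinearMap.ext fun z ↦ rfl
  obtain ⟨φ, hφ0, hφO, hco, hsm, hsm'⟩ := exists_openPartialHomeomorph_of_contDiffOn hOz hf h0 e he
  let c : S ≃L[ℝ] EuclideanSpace ℝ (Fin k) := ContinuousLinearEquiv.ofFinrankEq (by simp [hrank])
  obtain ⟨N, hN, hNo, hpN⟩ := eventually_nhds_iff.1 hev
  have hpφ : p ∈ φ.target := by
    have := φ.map_source hφ0
    rwa [hco, hf0] at this
  -- The slice coordinate `s` is the first integral, because the fields `A(·) w` are the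
  -- `w`-derivatives of the parametrization; `N` is where the cut-off frame agrees with the
  -- original.
  refine ⟨fun q ↦ c (φ.symm q).1, φ.target ∩ N, φ.open_target.inter hNo, ⟨hpφ, hpN⟩,
    fun q hq ↦ (hN q hq.2).1, ?_, fun q hq ↦ ?_⟩
  · exact c.contDiff.comp_contDiffOn (contDiff_fst.comp_contDiffOn
      (hsm'.mono Set.inter_subset_left))
  · have h1 := φ.map_target hq.1
    have h2 := φ.right_inv hq.1
    have h3 : DifferentiableAt ℝ φ.symm q :=
      (hsm'.contDiffAt (φ.open_target.mem_nhds hq.1)).differentiableAt (by simp)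
    have h4 : HasFDerivAt φ.symm (fderiv ℝ φ.symm q) (f (φ.symm q)) := by
      rw [← hco, h2]; exact h3.hasFDerivAt
    have h5 := (h4.comp _ (hdf (hφO h1)).differentiableAt.hasFDerivAt).unique
      ((hasFDerivAt_id (𝕜 := ℝ) (φ.symm q)).congr_of_eventuallyEq (by
        filter_upwards [φ.open_source.mem_nhds h1] with x hx
        have := φ.left_inv hx
        rwa [hco] at this))
    have h6 (z : S × W) : fderiv ℝ φ.symm q (fderiv ℝ f (φ.symm q) z) = z :=
      DFunLike.congr_fun h5 z
    have h7 : HasFDerivAt (fun q ↦ c (φ.symm q).1)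
        ((c : S →L[ℝ] EuclideanSpace ℝ (Fin k)) ∘L .fst ℝ S W ∘L fderiv ℝ φ.symm q) q :=
      c.hasFDerivAt.comp q (hasFDerivAt_fst.comp q h3.hasFDerivAt)
    rw [h7.fderiv]
    refine ⟨fun y ↦ ⟨fderiv ℝ f (φ.symm q) (c.symm y, 0), by simp [h6]⟩, fun w ↦ ?_⟩
    have h8 := hdf2 (hφO h1) w
    rw [← hco, h2, (hN q hq.2).2.eq_of_nhds] at h8
    rw [← h8, hco]
    simp [h6]

end FirstIntegrals

/-! ### Vector fields and Lie brackets in coordinates. -/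

section Charts

variable {m : ℕ} {M : Type*} [TopologicalSpace M] [ChartedSpace (EuclideanSpace ℝ (Fin m)) M]
  {E : Type*} [NormedAddCommGroup E] [NormedSpace ℝ E]

/-- `X` is smooth at `p`. -/
def IsSmoothAt [IsManifold (𝓡 m) ∞ M] (X : VField m M) (p : M) : Prop :=
  ContMDiffAt (𝓡 m) (𝓡 m).tangent ∞ (fun x ↦ (⟨x, X x⟩ : TangentBundle (𝓡 m) M)) p

/-- `Φ` is a diffeomorphism between open subsets of `M` and of the normed space `E`. -/
structure IsSmoothChart (Φ : OpenPartialHomeomorph M E) : Prop where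
  contMDiffOn : ContMDiffOn (𝓡 m) 𝓘(ℝ, E) ∞ Φ Φ.source
  contMDiffOn_symm : ContMDiffOn 𝓘(ℝ, E) (𝓡 m) ∞ Φ.symm Φ.target

/-- The vector field on `M` with coordinate expression `V`. -/
def coordField (m : ℕ) [ChartedSpace (EuclideanSpace ℝ (Fin m)) M] (Φ : OpenPartialHomeomorph M E)
    (V : E → E) : VField m M :=
  mpullback (𝓡 m) 𝓘(ℝ, E) Φ V

/-- The coordinate expression of the vector field `X`. -/
def coordRep (Φ : OpenPartialHomeomorph M E) (X : VField m M) : E → E :=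
  fun q ↦ mfderiv (𝓡 m) 𝓘(ℝ, E) Φ (Φ.symm q) (X (Φ.symm q))

namespace IsSmoothChart

variable {Φ : OpenPartialHomeomorph M E}

theorem contMDiffAt (hΦ : IsSmoothChart (m := m) Φ) {x : M} (hx : x ∈ Φ.source) :
    ContMDiffAt (𝓡 m) 𝓘(ℝ, E) ∞ Φ x :=
  hΦ.contMDiffOn.contMDiffAt (Φ.open_source.mem_nhds hx)

theorem contMDiffAt_symm (hΦ : IsSmoothChart (m := m) Φ) {q : E} (hq : q ∈ Φ.target) :
    ContMDiffAt 𝓘(ℝ, E) (𝓡 m) ∞ Φ.symm q :=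
  hΦ.contMDiffOn_symm.contMDiffAt (Φ.open_target.mem_nhds hq)

theorem mdifferentiable (hΦ : IsSmoothChart (m := m) Φ) : Φ.MDifferentiable (𝓡 m) 𝓘(ℝ, E) :=
  ⟨hΦ.contMDiffOn.mdifferentiableOn (by simp), hΦ.contMDiffOn_symm.mdifferentiableOn (by simp)⟩

theorem isInvertible (hΦ : IsSmoothChart (m := m) Φ) {x : M} (hx : x ∈ Φ.source) :
    (mfderiv (𝓡 m) 𝓘(ℝ, E) Φ x).IsInvertible :=
  ⟨hΦ.mdifferentiable.mfderiv hx, rfl⟩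

theorem isInvertible_symm (hΦ : IsSmoothChart (m := m) Φ) {q : E} (hq : q ∈ Φ.target) :
    (mfderiv 𝓘(ℝ, E) (𝓡 m) Φ.symm q).IsInvertible :=
  ⟨hΦ.mdifferentiable.symm.mfderiv (x := q) hq, rfl⟩

theorem mfderiv_coordField (hΦ : IsSmoothChart (m := m) Φ) {x : M} (hx : x ∈ Φ.source)
    (V : E → E) : mfderiv (𝓡 m) 𝓘(ℝ, E) Φ x (coordField m Φ V x) = V (Φ x) :=
  (hΦ.isInvertible hx).self_apply_inverse _

theorem mfderiv_injective (hΦ : IsSmoothChart (m := m) Φ) {x : M} (hx : x ∈ Φ.source) :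
    Function.Injective (mfderiv (𝓡 m) 𝓘(ℝ, E) Φ x) :=
  (hΦ.isInvertible hx).injective

theorem coordField_coordRep (hΦ : IsSmoothChart (m := m) Φ) {x : M} (hx : x ∈ Φ.source)
    (X : VField m M) : coordField m Φ (coordRep Φ X) x = X x := by
  apply hΦ.mfderiv_injective hx
  rw [hΦ.mfderiv_coordField hx, coordRep, Φ.left_inv hx]

theorem coordRep_coordField (hΦ : IsSmoothChart (m := m) Φ) {q : E} (hq : q ∈ Φ.target)
    (V : E → E) : coordRep Φ (coordField m Φ V) q = V q := by
  rw [coordRep, hΦ.mfderiv_coordField (Φ.map_target hq), Φ.right_inv hq]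

variable [IsManifold (𝓡 m) ∞ M]

theorem isSmoothAt_coordField (hΦ : IsSmoothChart (m := m) Φ) {x : M} (hx : x ∈ Φ.source)
    {V : E → E} (hV : ContDiffAt ℝ ∞ V (Φ x)) : IsSmoothAt (coordField m Φ V) x :=
  ContMDiffAt.mpullback_vectorField_preimage (contMDiffAt_vectorSpace_iff_contDiffAt.2 hV)
    (hΦ.contMDiffAt hx) (hΦ.isInvertible hx) (by simp)

theorem mlieBracket_coordField (hΦ : IsSmoothChart (m := m) Φ) {x : M} (hx : x ∈ Φ.source)
    {V W : E → E} (hV : ContDiffAt ℝ ∞ V (Φ x)) (hW : ContDiffAt ℝ ∞ W (Φ x)) :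
    mlieBracket (𝓡 m) (coordField m Φ V) (coordField m Φ W) x
      = coordField m Φ (lieBracket ℝ V W) x := by
  have : IsManifold (𝓡 m) (minSmoothness ℝ 2) M :=
    IsManifold.of_le (n := ∞) (by simpa using by norm_cast)
  have h1 := mpullback_mlieBracket (I := 𝓡 m) (I' := 𝓘(ℝ, E)) (f := Φ) (x₀ := x) (V := V) (W := W)
    (n := ∞)
    ((contMDiffAt_vectorSpace_iff_contDiffAt.2 hV).mdifferentiableAt (by simp))
    ((contMDiffAt_vectorSpace_iff_contDiffAt.2 hW).mdifferentiableAt (by simp))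
    (hΦ.contMDiffAt hx) (by simpa using by norm_cast)
  have h2 : mlieBracket 𝓘(ℝ, E) V W (Φ x) = lieBracket ℝ V W (Φ x) :=
    (congrFun (mlieBracketWithin_univ (I := 𝓘(ℝ, E)) (V := V) (W := W)).symm (Φ x)).trans
      ((congrFun mlieBracketWithin_eq_lieBracketWithin (Φ x)).trans
        (congrFun lieBracketWithin_univ (Φ x)))
  exact h1.symm.trans (congrArg (mfderiv (𝓡 m) 𝓘(ℝ, E) Φ x).inverse h2)

variable [CompleteSpace E]

/-- Near `q` the representative is the pullback of `X` along `Φ.symm`, because the differentials of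
`Φ` and `Φ.symm` are mutually inverse. -/
theorem contDiffAt_coordRep (hΦ : IsSmoothChart (m := m) Φ) {X : VField m M} {q : E}
    (hq : q ∈ Φ.target) (hX : IsSmoothAt X (Φ.symm q)) : ContDiffAt ℝ ∞ (coordRep Φ X) q := by
  have h1 := ContMDiffAt.mpullback_vectorField_preimage (I := 𝓘(ℝ, E)) (I' := 𝓡 m) hX
    (hΦ.contMDiffAt_symm hq) (hΦ.isInvertible_symm hq) (by simp)
  refine (contMDiffAt_vectorSpace_iff_contDiffAt.1 h1).congr_of_eventuallyEq ?_
  filter_upwards [Φ.open_target.mem_nhds hq] with r hr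
  have h2 := DFunLike.congr_fun (hΦ.mdifferentiable.comp_symm_deriv hr)
    (mpullback 𝓘(ℝ, E) (𝓡 m) Φ.symm X r)
  have h3 : mfderiv 𝓘(ℝ, E) (𝓡 m) Φ.symm r (mpullback 𝓘(ℝ, E) (𝓡 m) Φ.symm X r)
      = X (Φ.symm r) := (hΦ.isInvertible_symm hr).self_apply_inverse _
  refine Eq.trans ?_ h2
  exact (congrArg (mfderiv (𝓡 m) 𝓘(ℝ, E) Φ (Φ.symm r)) h3).symm

end IsSmoothChart

end Charts

theorem contDiffAt_clm_apply_iff {D E F : Type*} [NormedAddCommGroup D] [NormedSpace ℝ D]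
    [NormedAddCommGroup E] [NormedSpace ℝ E] [FiniteDimensional ℝ E] [NormedAddCommGroup F]
    [NormedSpace ℝ F] {n : WithTop ℕ∞} {f : D → E →L[ℝ] F} {x : D} :
    ContDiffAt ℝ n f x ↔ ∀ v, ContDiffAt ℝ n (fun y ↦ f y v) x := by
  refine ⟨fun h v ↦ h.clm_apply contDiffAt_const, fun h ↦ ?_⟩
  have hd : Module.finrank ℝ E = Module.finrank ℝ (Fin (Module.finrank ℝ E) → ℝ) := by simp
  let e₁ := ContinuousLinearEquiv.ofFinrankEq hd
  let e₂ := (e₁.arrowCongr (1 : F ≃L[ℝ] F)).trans (ContinuousLinearEquiv.piRing _)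
  rw [← Function.id_comp f, ← e₂.symm_comp_self]
  exact e₂.symm.contDiff.contDiffAt.comp x (contDiffAt_pi.2 fun i ↦ h _)

/-! ### The metric in coordinates. -/

section Gram

variable {m : ℕ} {M : Type*} [TopologicalSpace M] [ChartedSpace (EuclideanSpace ℝ (Fin m)) M]
  {E : Type*} [NormedAddCommGroup E] [NormedSpace ℝ E]

theorem isSmoothChart_chartAt [IsManifold (𝓡 m) ∞ M] (p : M) :
    IsSmoothChart (m := m) (chartAt (EuclideanSpace ℝ (Fin m)) p) :=
  ⟨contMDiffOn_chart, contMDiffOn_chart_symm⟩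

variable [RiemannianBundle (fun x : M ↦ TangentSpace (𝓡 m) x)]

/-- The metric of `M` in the coordinates `Φ`. -/
def gram (m : ℕ) [ChartedSpace (EuclideanSpace ℝ (Fin m)) M]
    [RiemannianBundle (fun x : M ↦ TangentSpace (𝓡 m) x)] (Φ : OpenPartialHomeomorph M E) (q : E) :
    E →L[ℝ] E →L[ℝ] ℝ :=
  let D : E →L[ℝ] TangentSpace (𝓡 m) (Φ.symm q) :=
    (mfderiv (𝓡 m) 𝓘(ℝ, E) Φ (Φ.symm q)).inverse
  (innerSL ℝ : TangentSpace (𝓡 m) (Φ.symm q) →L[ℝ] _).bilinearComp D D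

variable {Φ : OpenPartialHomeomorph M E}

theorem gram_apply {q : E} (v w : E) :
    gram m Φ q v w = ⟪coordField m Φ (fun _ ↦ v) (Φ.symm q),
      coordField m Φ (fun _ ↦ w) (Φ.symm q)⟫_ℝ := rfl

theorem gram_comm {q : E} (v w : E) : gram m Φ q v w = gram m Φ q w v := by
  rw [gram_apply, gram_apply, real_inner_comm]

theorem gram_coordRep (hΦ : IsSmoothChart (m := m) Φ) {q : E} (hq : q ∈ Φ.target)
    (X Y : VField m M) :
    gram m Φ q (coordRep Φ X q) (coordRep Φ Y q) = ⟪X (Φ.symm q), Y (Φ.symm q)⟫_ℝ := by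
  have h (X : VField m M) : coordField m Φ (fun _ ↦ coordRep Φ X q) (Φ.symm q) = X (Φ.symm q) := by
    apply hΦ.mfderiv_injective (Φ.map_target hq)
    rw [hΦ.mfderiv_coordField (Φ.map_target hq)]
    rfl
  rw [gram_apply, h, h]

theorem gram_self_pos (hΦ : IsSmoothChart (m := m) Φ) {q : E} (hq : q ∈ Φ.target) {v : E}
    (hv : v ≠ 0) : 0 < gram m Φ q v v := by
  rw [gram_apply, real_inner_self_pos]
  intro h
  apply hv
  rw [← hΦ.mfderiv_coordField (Φ.map_target hq) (fun _ ↦ v), h, map_zero]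
  rfl

variable [IsManifold (𝓡 m) ∞ M]
  [IsContMDiffRiemannianBundle (𝓡 m) ∞ (EuclideanSpace ℝ (Fin m))
    (fun x : M ↦ TangentSpace (𝓡 m) x)]

theorem IsSmoothAt.inner {X Y : VField m M} {p : M} (hX : IsSmoothAt X p) (hY : IsSmoothAt Y p) :
    ContMDiffAt (𝓡 m) 𝓘(ℝ) ∞ (fun x ↦ ⟪X x, Y x⟫_ℝ) p :=
  ContMDiffAt.inner_bundle (b := fun x : M ↦ x) (E := fun x : M ↦ TangentSpace (𝓡 m) x) hX hY

theorem contDiffAt_gram [FiniteDimensional ℝ E] (hΦ : IsSmoothChart (m := m) Φ) {q : E}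
    (hq : q ∈ Φ.target) : ContDiffAt ℝ ∞ (gram m Φ) q := by
  refine contDiffAt_clm_apply_iff.2 fun v ↦ contDiffAt_clm_apply_iff.2 fun w ↦ ?_
  have h1 := (hΦ.isSmoothAt_coordField (Φ.map_target hq) (contDiffAt_const (c := v))).inner
    (hΦ.isSmoothAt_coordField (Φ.map_target hq) (contDiffAt_const (c := w)))
  exact contMDiffAt_iff_contDiffAt.1 (h1.comp q (hΦ.contMDiffAt_symm hq))

/-- The Gram matrix is invertible by positivity and depends smoothly on the point, and the
coordinates of `X` are its inverse applied to the given inner products. The criterion serves for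
fields defined only pointwise: horizontal projections and horizontal lifts. -/
theorem isSmoothAt_of_inner [FiniteDimensional ℝ E] (hΦ : IsSmoothChart (m := m) Φ) {p : M}
    (hp : p ∈ Φ.source) {X : VField m M} (hX : ∀ w : E,
      ContMDiffAt (𝓡 m) 𝓘(ℝ) ∞ (fun x ↦ ⟪X x, coordField m Φ (fun _ ↦ w) x⟫_ℝ) p) :
    IsSmoothAt X p := by
  have : CompleteSpace E := FiniteDimensional.complete ℝ E
  have hq := Φ.map_source hp
  have hinv : ∀ q ∈ Φ.target, (gram m Φ q).IsInvertible := fun q hq ↦ by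
    have hinj : Function.Injective (gram m Φ q) := by
      rw [injective_iff_map_eq_zero]
      intro v hv
      by_contra h
      have := gram_self_pos hΦ hq h
      simp [hv] at this
    have hr : Module.finrank ℝ E = Module.finrank ℝ (E →L[ℝ] ℝ) := by
      rw [← LinearMap.toContinuousLinearMap.finrank_eq, ← Subspace.dual_finrank_eq]
    exact ⟨(LinearEquiv.ofInjectiveOfFinrankEq (gram m Φ q).toLinearMap hinj
      hr).toContinuousLinearEquiv, ContinuousLinearMap.ext fun _ ↦ rfl⟩
  have h1 : ContDiffAt ℝ ∞ (fun q ↦ gram m Φ q (coordRep Φ X q)) (Φ p) := by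
    refine contDiffAt_clm_apply_iff.2 fun w ↦ ?_
    have h2 := hX w
    rw [← Φ.left_inv hp] at h2
    refine (contMDiffAt_iff_contDiffAt.1
      (h2.comp (Φ p) (hΦ.contMDiffAt_symm hq))).congr_of_eventuallyEq ?_
    filter_upwards [Φ.open_target.mem_nhds hq] with r hr
    rw [Function.comp_apply, ← gram_coordRep hΦ hr, hΦ.coordRep_coordField hr]
  have h2 : ContDiffAt ℝ ∞ (coordRep Φ X) (Φ p) := by
    obtain ⟨e, he⟩ := hinv _ hq
    have h3 : ContDiffAt ℝ ∞ ContinuousLinearMap.inverse (gram m Φ (Φ p)) := by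
      rw [← he]; exact contDiffAt_map_inverse e
    refine ((h3.comp (Φ p) (contDiffAt_gram hΦ hq)).clm_apply h1).congr_of_eventuallyEq ?_
    filter_upwards [Φ.open_target.mem_nhds hq] with r hr
    exact ((hinv r hr).inverse_apply_self _).symm
  refine (hΦ.isSmoothAt_coordField hp h2).congr_of_eventuallyEq ?_
  filter_upwards [Φ.open_source.mem_nhds hp] with x hx
  rw [hΦ.coordField_coordRep hx]

end Gram

/-! ### Smooth sections and cut-offs. -/

section Sections

variable {m : ℕ} {M : Type*} [TopologicalSpace M] [ChartedSpace (EuclideanSpace ℝ (Fin m)) M]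
  [IsManifold (𝓡 m) ∞ M]

theorem IsSmoothAt.isDiffAt {X : VField m M} {p : M} (hX : IsSmoothAt X p) : IsDiffAt X p :=
  ContMDiffAt.mdifferentiableAt hX (by simp)

theorem IsSmoothAt.sub {X Y : VField m M} {p : M} (hX : IsSmoothAt X p) (hY : IsSmoothAt Y p) :
    IsSmoothAt (X - Y) p := ContMDiffAt.sub_section hX hY

theorem IsSmoothAt.smul {f : M → ℝ} {X : VField m M} {p : M}
    (hf : ContMDiffAt (𝓡 m) 𝓘(ℝ) ∞ f p) (hX : IsSmoothAt X p) :
    IsSmoothAt (f • X) p := ContMDiffAt.smul_section hf hX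

theorem IsSmoothAt.const_smul {c : ℝ} {X : VField m M} {p : M} (hX : IsSmoothAt X p) :
    IsSmoothAt (c • X) p := ContMDiffAt.const_smul_section hX

theorem IsSmoothAt.congr {X Y : VField m M} {p : M} (hX : IsSmoothAt X p) (h : Y =ᶠ[𝓝 p] X) :
    IsSmoothAt Y p :=
  ContMDiffAt.congr_of_eventuallyEq hX (h.mono fun x hx ↦ by simp only [hx])

theorem isSmoothAt_zero (p : M) : IsSmoothAt (0 : VField m M) p :=
  Bundle.contMDiff_zeroSection ℝ (fun x : M ↦ TangentSpace (𝓡 m) x) |>.contMDiffAt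

theorem isSection_iff {D : Distr m M} {X : VField m M} :
    IsSection D X ↔ (∀ p, IsSmoothAt X p) ∧ ∀ p, X p ∈ D p := Iff.rfl

/-- A vector field that is smooth near `p` can be cut off to a smooth one with the same germ. -/
theorem exists_isSection_eventuallyEq [T2Space M] {D : Distr m M} {X : VField m M} {O : Set M}
    (hO : IsOpen O) {p : M} (hp : p ∈ O) (hX : ∀ x ∈ O, IsSmoothAt X x) (hD : ∀ x ∈ O, X x ∈ D x) :
    ∃ X' : VField m M, IsSection D X' ∧ X' =ᶠ[𝓝 p] X := by
  obtain ⟨χ, -, hχ⟩ := (SmoothBumpFunction.nhds_basis_tsupport (I := 𝓡 m) p).mem_iff.1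
    (hO.mem_nhds hp)
  refine ⟨fun x ↦ χ x • X x, isSection_iff.2 ⟨fun x ↦ ?_, fun x ↦ ?_⟩, ?_⟩
  · by_cases hx : x ∈ tsupport χ
    · exact IsSmoothAt.smul χ.contMDiffAt (hX x (hχ hx))
    · refine (isSmoothAt_zero x).congr ?_
      filter_upwards [notMem_tsupport_iff_eventuallyEq.1 hx] with y hy
      exact (congrArg (· • X y) hy).trans (zero_smul ℝ _)
  · by_cases hx : x ∈ tsupport χ
    · exact (D x).smul_mem _ (hD x (hχ hx))
    · simp [image_eq_zero_of_notMem_tsupport hx]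
  · filter_upwards [χ.eventuallyEq_one] with x hx
    exact (congrArg (· • X x) hx).trans (one_smul ℝ _)

theorem exists_isSection_top_apply_eq [T2Space M] {p : M} (v : TangentSpace (𝓡 m) p) :
    ∃ X : VField m M, IsSection (fun _ ↦ ⊤) X ∧ X p = v := by
  let φ := chartAt (EuclideanSpace ℝ (Fin m)) p
  have hp : p ∈ φ.source := mem_chart_source _ p
  have hΦ : IsSmoothChart (m := m) φ := isSmoothChart_chartAt p
  let c : EuclideanSpace ℝ (Fin m) := mfderiv (𝓡 m) 𝓘(ℝ, EuclideanSpace ℝ (Fin m)) φ p v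
  obtain ⟨X, hX, h⟩ := exists_isSection_eventuallyEq (D := fun _ ↦ ⊤) φ.open_source hp
    (fun x hx ↦ hΦ.isSmoothAt_coordField (V := fun _ ↦ c) hx contDiffAt_const)
    (fun _ _ ↦ Submodule.mem_top)
  refine ⟨X, hX, ?_⟩
  rw [h.eq_of_nhds]
  apply hΦ.mfderiv_injective hp
  exact hΦ.mfderiv_coordField hp _

end Sections

theorem mvfderiv_congr {m : ℕ} {M : Type*} [TopologicalSpace M]
    [ChartedSpace (EuclideanSpace ℝ (Fin m)) M] {G : Type*} [NormedAddCommGroup G] [NormedSpace ℝ G]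
    {f g : M → G} {p : M} (h : f =ᶠ[𝓝 p] g) : mvfderiv (𝓡 m) f p = mvfderiv (𝓡 m) g p := by
  have := h.mfderiv_eq (I := 𝓡 m) (I' := 𝓘(ℝ, G))
  ext v
  exact DFunLike.congr_fun this v

/-! ### Locality and tensoriality of the connection. -/

section Nabla

variable {m : ℕ} {M : Type*} [TopologicalSpace M] [ChartedSpace (EuclideanSpace ℝ (Fin m)) M]
  [RiemannianBundle (fun x : M ↦ TangentSpace (𝓡 m) x)]

theorem koszul_congr {X X' Y Y' Z : VField m M} {p : M} (hX : X' =ᶠ[𝓝 p] X) (hY : Y' =ᶠ[𝓝 p] Y) :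
    koszul X' Y' Z p = koszul X Y Z p := by
  have h1 : (fun x ↦ ⟪Y' x, Z x⟫_ℝ) =ᶠ[𝓝 p] fun x ↦ ⟪Y x, Z x⟫_ℝ := hY.mono fun x hx ↦ by simp [hx]
  have h2 : (fun x ↦ ⟪Z x, X' x⟫_ℝ) =ᶠ[𝓝 p] fun x ↦ ⟪Z x, X x⟫_ℝ := hX.mono fun x hx ↦ by simp [hx]
  have h3 : (fun x ↦ ⟪X' x, Y' x⟫_ℝ) =ᶠ[𝓝 p] fun x ↦ ⟪X x, Y x⟫_ℝ := by
    filter_upwards [hX, hY] with x hx hy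
    simp [hx, hy]
  have h4 : mlieBracket (𝓡 m) Y' Z p = mlieBracket (𝓡 m) Y Z p :=
    hY.mlieBracket_vectorField_eq EventuallyEq.rfl
  have h5 : mlieBracket (𝓡 m) Z X' p = mlieBracket (𝓡 m) Z X p :=
    EventuallyEq.mlieBracket_vectorField_eq EventuallyEq.rfl hX
  rw [koszul, mvfderiv_congr h1, mvfderiv_congr h2, mvfderiv_congr h3,
    hX.mlieBracket_vectorField_eq hY, h4, h5, hX.eq_of_nhds, hY.eq_of_nhds, koszul]

variable [IsManifold (𝓡 m) ∞ M]

theorem nabla_congr {X X' Y Y' : VField m M} {p : M} (hX : X' =ᶠ[𝓝 p] X) (hY : Y' =ᶠ[𝓝 p] Y) :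
    nabla X' Y' p = nabla X Y p := by
  simp only [nabla, koszul_congr hX hY]

variable [IsContMDiffRiemannianBundle (𝓡 m) ∞ (EuclideanSpace ℝ (Fin m))
    (fun x : M ↦ TangentSpace (𝓡 m) x)]

/-- For `f X` the extra terms `Y(f) ⟪Z, X⟫ - Z(f) ⟪X, Y⟫` are cancelled by those of `[f X, Y]` and
`[Z, f X]`. -/
theorem koszul_tensorial_left {Y Z : VField m M} {p : M} (hY : IsDiffAt Y p) (hZ : IsDiffAt Z p) :
    TensorialAt (𝓡 m) (EuclideanSpace ℝ (Fin m)) (fun X : VField m M ↦ koszul X Y Z p) p where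
  smul {f X} hf hX := by
    have h1 : MDifferentiableAt (𝓡 m) 𝓘(ℝ) (fun x ↦ ⟪Z x, X x⟫_ℝ) p := hZ.inner hX
    have h2 : MDifferentiableAt (𝓡 m) 𝓘(ℝ) (fun x ↦ ⟪X x, Y x⟫_ℝ) p := IsDiffAt.inner hX hY
    simp only [koszul, Pi.smul_apply', real_inner_smul_left, real_inner_smul_right]
    rw [VectorField.mlieBracket_smul_right hf hX, VectorField.mlieBracket_smul_left hf hX,
      mvfderiv_fun_mul hf h1, mvfderiv_fun_mul hf h2]
    simp [inner_add_left, real_inner_smul_left]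
    rw [real_inner_comm (Z p) (X p)]
    ring
  add {X X'} hX hX' := by
    have h1 : MDifferentiableAt (𝓡 m) 𝓘(ℝ) (fun x ↦ ⟪Z x, X x⟫_ℝ) p := hZ.inner hX
    have h2 : MDifferentiableAt (𝓡 m) 𝓘(ℝ) (fun x ↦ ⟪X x, Y x⟫_ℝ) p := IsDiffAt.inner hX hY
    have h1' : MDifferentiableAt (𝓡 m) 𝓘(ℝ) (fun x ↦ ⟪Z x, X' x⟫_ℝ) p := hZ.inner hX'
    have h2' : MDifferentiableAt (𝓡 m) 𝓘(ℝ) (fun x ↦ ⟪X' x, Y x⟫_ℝ) p := IsDiffAt.inner hX' hY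
    simp only [koszul, Pi.add_apply, inner_add_left, inner_add_right]
    rw [VectorField.mlieBracket_add_right hX hX', VectorField.mlieBracket_add_left hX hX',
      mvfderiv_fun_add h1 h1', mvfderiv_fun_add h2 h2']
    simp [inner_add_left]
    ring

theorem nabla_tensorial_left {Y : VField m M} {p : M} (hY : IsDiffAt Y p) :
    TensorialAt (𝓡 m) (EuclideanSpace ℝ (Fin m)) (fun X : VField m M ↦ nabla X Y p) p where
  smul {f X} hf hX := by
    refine ext_inner_right ℝ fun v ↦ ?_
    have hv : IsDiffAt (FiberBundle.extend (EuclideanSpace ℝ (Fin m)) v : VField m M) p :=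
      FiberBundle.mdifferentiableAt_extend ..
    have hv' : (FiberBundle.extend (EuclideanSpace ℝ (Fin m)) v : VField m M) p = v := by simp
    generalize (FiberBundle.extend (EuclideanSpace ℝ (Fin m)) v : VField m M) = Z at *
    have h1 := two_mul_inner_nabla (hf.smul_section hX) hY hv
    have h2 := two_mul_inner_nabla hX hY hv
    have h3 := (koszul_tensorial_left hY hv).smul hf hX
    rw [← hv', real_inner_smul_left]
    simp only [smul_eq_mul] at h3
    have h4 : 2 * ⟪nabla (f • X) Y p, Z p⟫_ℝ = koszul (f • X) Y Z p := h1
    rw [h3, ← h2] at h4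
    linarith
  add {X X'} hX hX' := by
    refine ext_inner_right ℝ fun v ↦ ?_
    have hv : IsDiffAt (FiberBundle.extend (EuclideanSpace ℝ (Fin m)) v : VField m M) p :=
      FiberBundle.mdifferentiableAt_extend ..
    have hv' : (FiberBundle.extend (EuclideanSpace ℝ (Fin m)) v : VField m M) p = v := by simp
    generalize (FiberBundle.extend (EuclideanSpace ℝ (Fin m)) v : VField m M) = Z at *
    have h1 := two_mul_inner_nabla (mdifferentiableAt_add_section hX hX') hY hv
    have h2 := two_mul_inner_nabla hX hY hv
    have h2' := two_mul_inner_nabla hX' hY hv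
    have h3 := (koszul_tensorial_left hY hv).add hX hX'
    rw [← hv', inner_add_left]
    have h4 : 2 * ⟪nabla (X + X') Y p, Z p⟫_ℝ = koszul (X + X') Y Z p := h1
    linarith

/-- Torsion-freeness moves the sum into the left slot, where `nabla` is tensorial; the bracket that
appears is additive. -/
theorem nabla_add_right {X Y Y' : VField m M} {p : M} (hX : IsDiffAt X p) (hY : IsDiffAt Y p)
    (hY' : IsDiffAt Y' p) : nabla X (Y + Y') p = nabla X Y p + nabla X Y' p := by
  have hs : IsDiffAt (Y + Y') p := mdifferentiableAt_add_section hY hY'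
  have h1 := nabla_sub_nabla hX hs
  have h2 := (nabla_tensorial_left hX).add hY hY'
  rw [mlieBracket_add_right hY hY', ← nabla_sub_nabla hX hY, ← nabla_sub_nabla hX hY'] at h1
  have h3 : nabla (Y + Y') X p = nabla Y X p + nabla Y' X p := h2
  rw [h3, sub_eq_iff_eq_add] at h1
  rw [h1]
  abel

theorem nabla_const_smul_right {X Y : VField m M} {p : M} (c : ℝ) (hX : IsDiffAt X p)
    (hY : IsDiffAt Y p) : nabla X (c • Y) p = c • nabla X Y p := by
  have hs : IsDiffAt (c • Y) p := mdifferentiableAt_const.smul_section hY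
  have h1 := nabla_sub_nabla hX hs
  have h2 : nabla (c • Y) X p = c • nabla Y X p :=
    (nabla_tensorial_left hX).smul (f := fun _ ↦ c) mdifferentiableAt_const hY
  rw [mlieBracket_const_smul_right hY, ← nabla_sub_nabla hX hY, h2, sub_eq_iff_eq_add] at h1
  rw [h1, smul_sub]
  abel

theorem nabla_zero_right {X : VField m M} {p : M} (hX : IsDiffAt X p) : nabla X 0 p = 0 := by
  have := nabla_const_smul_right 0 hX hX
  rwa [zero_smul, zero_smul] at this

end Nabla

section InnerProductSpace

variable {E : Type*} [NormedAddCommGroup E] [InnerProductSpace ℝ E] {K L : Submodule ℝ E}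

theorem starProjection_add_starProjection_of_eq_orthogonal [K.HasOrthogonalProjection]
    [L.HasOrthogonalProjection] (h : L = Kᗮ) (v : E) :
    K.starProjection v + L.starProjection v = v := by
  subst h
  exact K.starProjection_add_starProjection_orthogonal v

theorem mem_of_forall_inner_eq_zero [K.HasOrthogonalProjection] (h : L = Kᗮ) {v : E}
    (hv : ∀ w ∈ L, ⟪v, w⟫_ℝ = 0) : v ∈ K := by
  subst h
  rw [← K.orthogonal_orthogonal]
  exact (Submodule.mem_orthogonal' _ v).2 hv

end InnerProductSpace

/-! ### Vertical and horizontal parts for a Riemannian submersion. -/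

section Submersion

variable {m : ℕ} {M : Type*} [TopologicalSpace M] [ChartedSpace (EuclideanSpace ℝ (Fin m)) M]
  {n : ℕ} {N : Type*} [TopologicalSpace N] [ChartedSpace (EuclideanSpace ℝ (Fin n)) N]
  {F : M → N}

theorem mem_vertical {x : M} {v : TangentSpace (𝓡 m) x} :
    v ∈ vertical n F x ↔ mfderiv (𝓡 m) (𝓡 n) F x v = 0 := LinearMap.mem_ker

variable [RiemannianBundle (fun x : M ↦ TangentSpace (𝓡 m) x)]

theorem vert_apply_mem (X : VField m M) (x : M) : vert n F X x ∈ vertical n F x :=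
  Submodule.starProjection_apply_mem _ _

theorem hor_apply_mem (X : VField m M) (x : M) : hor n F X x ∈ horizontal n F x :=
  Submodule.starProjection_apply_mem _ _

theorem vert_add_hor (X : VField m M) : vert n F X + hor n F X = X :=
  funext fun x ↦ by
    exact starProjection_add_starProjection_of_eq_orthogonal (K := vertical (m := m) n F x) rfl
      (X x)

theorem vert_eq_self {X : VField m M} {x : M} (h : X x ∈ vertical n F x) : vert n F X x = X x :=
  Submodule.starProjection_eq_self_iff.2 h

theorem hor_eq_self {X : VField m M} {x : M} (h : X x ∈ horizontal n F x) : hor n F X x = X x :=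
  Submodule.starProjection_eq_self_iff.2 h

theorem vert_eq_zero {X : VField m M} {x : M} (h : X x ∈ horizontal n F x) : vert n F X x = 0 :=
  (Submodule.starProjection_apply_eq_zero_iff _).2 h

theorem hor_eq_zero {X : VField m M} {x : M} (h : X x ∈ vertical n F x) : hor n F X x = 0 :=
  (Submodule.starProjection_apply_eq_zero_iff _).2 (Submodule.le_orthogonal_orthogonal _ h)

theorem inner_vertical_horizontal {x : M} {v w : TangentSpace (𝓡 m) x} (hv : v ∈ vertical n F x)
    (hw : w ∈ horizontal n F x) : ⟪v, w⟫_ℝ = 0 :=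
  Submodule.inner_right_of_mem_orthogonal hv hw

theorem inner_horizontal_vertical {x : M} {v w : TangentSpace (𝓡 m) x} (hv : v ∈ horizontal n F x)
    (hw : w ∈ vertical n F x) : ⟪v, w⟫_ℝ = 0 :=
  Submodule.inner_left_of_mem_orthogonal hw hv

theorem mem_vertical_of_inner {x : M} {v : TangentSpace (𝓡 m) x}
    (h : ∀ w ∈ horizontal n F x, ⟪v, w⟫_ℝ = 0) : v ∈ vertical n F x := by
  exact mem_of_forall_inner_eq_zero (K := vertical (m := m) n F x) rfl h

theorem mem_horizontal_of_inner {x : M} {v : TangentSpace (𝓡 m) x}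
    (h : ∀ w ∈ vertical n F x, ⟪v, w⟫_ℝ = 0) : v ∈ horizontal n F x :=
  show v ∈ (vertical (m := m) n F x)ᗮ from
    (Submodule.mem_orthogonal' (vertical (m := m) n F x) v).2 h

theorem mfderiv_hor (X : VField m M) (x : M) :
    mfderiv (𝓡 m) (𝓡 n) F x (hor n F X x) = mfderiv (𝓡 m) (𝓡 n) F x (X x) := by
  have h := congrFun (vert_add_hor (n := n) (F := F) X) x
  conv_rhs => rw [← h, Pi.add_apply, map_add, mem_vertical.1 (vert_apply_mem X x), zero_add]

variable [RiemannianBundle (fun y : N ↦ TangentSpace (𝓡 n) y)]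

namespace IsRiemannianSubmersion

theorem inner_mfderiv (hF : IsRiemannianSubmersion (m := m) (n := n) F) {x : M}
    {v w : TangentSpace (𝓡 m) x} (hv : v ∈ horizontal n F x) (hw : w ∈ horizontal n F x) :
    ⟪mfderiv (𝓡 m) (𝓡 n) F x v, mfderiv (𝓡 m) (𝓡 n) F x w⟫_ℝ = ⟪v, w⟫_ℝ := by
  rw [real_inner_eq_norm_add_mul_self_sub_norm_mul_self_sub_norm_mul_self_div_two,
    real_inner_eq_norm_add_mul_self_sub_norm_mul_self_sub_norm_mul_self_div_two, ← map_add,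
    hF.norm_mfderiv x _ hv, hF.norm_mfderiv x _ hw, hF.norm_mfderiv x _ (Submodule.add_mem _ hv hw)]

/-- The differential kills vertical parts and is isometric on horizontal ones. The right-hand side
is visibly smooth in `x` for smooth fields, which makes the projections smooth. -/
theorem inner_hor (hF : IsRiemannianSubmersion (m := m) (n := n) F) (X Z : VField m M) (x : M) :
    ⟪hor n F X x, Z x⟫_ℝ
      = ⟪mfderiv (𝓡 m) (𝓡 n) F x (X x), mfderiv (𝓡 m) (𝓡 n) F x (Z x)⟫_ℝ := by
  rw [← mfderiv_hor X, ← mfderiv_hor Z, hF.inner_mfderiv (hor_apply_mem X x) (hor_apply_mem Z x)]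
  conv_lhs => rw [← congrFun (vert_add_hor (n := n) (F := F) Z) x, Pi.add_apply, inner_add_right,
    inner_horizontal_vertical (hor_apply_mem X x) (vert_apply_mem Z x), zero_add]

variable [IsManifold (𝓡 m) ∞ M] [IsManifold (𝓡 n) ∞ N]

theorem contMDiffAt_mfderiv (hF : IsRiemannianSubmersion (m := m) (n := n) F) {X : VField m M}
    {p : M} (hX : IsSmoothAt X p) : ContMDiffAt (𝓡 m) (𝓡 n).tangent ∞
      (fun x ↦ (⟨F x, mfderiv (𝓡 m) (𝓡 n) F x (X x)⟩ : TangentBundle (𝓡 n) N)) p :=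
  (hF.smooth.contMDiff_tangentMap (m := ∞) (by simp)).contMDiffAt.comp p hX

variable [IsContMDiffRiemannianBundle (𝓡 m) ∞ (EuclideanSpace ℝ (Fin m))
    (fun x : M ↦ TangentSpace (𝓡 m) x)]
  [IsContMDiffRiemannianBundle (𝓡 n) ∞ (EuclideanSpace ℝ (Fin n))
    (fun y : N ↦ TangentSpace (𝓡 n) y)]

theorem isSmoothAt_hor (hF : IsRiemannianSubmersion (m := m) (n := n) F) {X : VField m M}
    {p : M} (hX : IsSmoothAt X p) : IsSmoothAt (hor n F X) p := by
  refine isSmoothAt_of_inner (isSmoothChart_chartAt p) (mem_chart_source _ p) fun w ↦ ?_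
  simp only [hF.inner_hor]
  exact ContMDiffAt.inner_bundle (b := F) (E := fun y : N ↦ TangentSpace (𝓡 n) y)
    (hF.contMDiffAt_mfderiv hX) (hF.contMDiffAt_mfderiv
      ((isSmoothChart_chartAt p).isSmoothAt_coordField (mem_chart_source _ p) contDiffAt_const))

theorem isSmoothAt_vert (hF : IsRiemannianSubmersion (m := m) (n := n) F) {X : VField m M}
    {p : M} (hX : IsSmoothAt X p) : IsSmoothAt (vert n F X) p := by
  have : vert n F X = X - hor n F X := eq_sub_of_add_eq (vert_add_hor X)
  rw [this]
  exact hX.sub (hF.isSmoothAt_hor hX)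

theorem exists_isSection_vertical [T2Space M] (hF : IsRiemannianSubmersion (m := m) (n := n) F)
    {p : M} {v : TangentSpace (𝓡 m) p} (hv : v ∈ vertical n F p) :
    ∃ X : VField m M, IsSection (vertical n F) X ∧ X p = v := by
  obtain ⟨X, hX, rfl⟩ := exists_isSection_top_apply_eq v
  exact ⟨vert n F X, ⟨fun x ↦ hF.isSmoothAt_vert (hX.1 x), vert_apply_mem X⟩, vert_eq_self hv⟩

theorem exists_isSection_horizontal [T2Space M] (hF : IsRiemannianSubmersion (m := m) (n := n) F)
    {p : M} {v : TangentSpace (𝓡 m) p} (hv : v ∈ horizontal n F p) :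
    ∃ X : VField m M, IsSection (horizontal n F) X ∧ X p = v := by
  obtain ⟨X, hX, rfl⟩ := exists_isSection_top_apply_eq v
  exact ⟨hor n F X, ⟨fun x ↦ hF.isSmoothAt_hor (hX.1 x), hor_apply_mem X⟩, hor_eq_self hv⟩

end IsRiemannianSubmersion

end Submersion

/-- From `⟪u, P u⟫ = ‖P u‖²`. When `P u = 0` the angle is `π / 2` by convention and both sides
vanish. -/
theorem norm_starProjection_eq_cos_angle_mul {E : Type*} [NormedAddCommGroup E]
    [InnerProductSpace ℝ E] (K : Submodule ℝ E) [K.HasOrthogonalProjection] (u : E) :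
    ‖K.starProjection u‖ = Real.cos (InnerProductGeometry.angle u (K.starProjection u)) * ‖u‖ := by
  rcases eq_or_ne (K.starProjection u) 0 with h | h
  · rw [h]; simp
  have hu : ‖u‖ ≠ 0 := by
    rw [norm_ne_zero_iff]; rintro rfl; exact h (map_zero _)
  have hi : ⟪u, K.starProjection u⟫_ℝ = ‖K.starProjection u‖ * ‖K.starProjection u‖ := by
    rw [← real_inner_self_eq_norm_mul_norm, Submodule.inner_starProjection_left_eq_right,
      Submodule.starProjection_eq_self_iff.2 (Submodule.starProjection_apply_mem _ _)]
  have hn : ‖K.starProjection u‖ ≠ 0 := norm_ne_zero_iff.2 h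
  rw [InnerProductGeometry.cos_angle, hi]
  field_simp

/-! ### Algebra of `φ` and `ω` for a slant submersion. -/

section Slant

variable {m : ℕ} {M : Type*} [TopologicalSpace M] [ChartedSpace (EuclideanSpace ℝ (Fin m)) M]
  [RiemannianBundle (fun x : M ↦ TangentSpace (𝓡 m) x)]
  {n : ℕ} {N : Type*} [TopologicalSpace N] [ChartedSpace (EuclideanSpace ℝ (Fin n)) N]
  {F : M → N} {J : ∀ x : M, TangentSpace (𝓡 m) x →L[ℝ] TangentSpace (𝓡 m) x}

theorem inner_hor_left (X : VField m M) {x : M} {w : TangentSpace (𝓡 m) x}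
    (hw : w ∈ horizontal n F x) : ⟪hor n F X x, w⟫_ℝ = ⟪X x, w⟫_ℝ := by
  conv_rhs => rw [← congrFun (vert_add_hor (n := n) (F := F) X) x, Pi.add_apply, inner_add_left,
    inner_vertical_horizontal (vert_apply_mem X x) hw, zero_add]

theorem inner_vert_left (X : VField m M) {x : M} {w : TangentSpace (𝓡 m) x}
    (hw : w ∈ vertical n F x) : ⟪vert n F X x, w⟫_ℝ = ⟪X x, w⟫_ℝ := by
  conv_rhs => rw [← congrFun (vert_add_hor (n := n) (F := F) X) x, Pi.add_apply, inner_add_left,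
    inner_horizontal_vertical (hor_apply_mem X x) hw, add_zero]

variable [IsManifold (𝓡 m) ∞ M]

theorem IsAlmostHermitian.inner_left (hJ : IsAlmostHermitian (m := m) J) {x : M}
    (v w : TangentSpace (𝓡 m) x) : ⟪J x v, w⟫_ℝ = -⟪v, J x w⟫_ℝ := by
  rw [← hJ.isometry x v, hJ.sq, inner_neg_right, neg_neg]

theorem IsAlmostHermitian.isSmoothAt (hJ : IsAlmostHermitian (m := m) J) {X : VField m M} {p : M}
    (hX : IsSmoothAt X p) : IsSmoothAt (applyField J X) p :=
  ContMDiffAt.clm_bundle_apply (F₁ := EuclideanSpace ℝ (Fin m)) (F₂ := EuclideanSpace ℝ (Fin m))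
    (E₁ := fun x : M ↦ TangentSpace (𝓡 m) x) (E₂ := fun x : M ↦ TangentSpace (𝓡 m) x)
    (b := fun x : M ↦ x) hJ.smooth.contMDiffAt hX

theorem IsKaehler.nabla_applyField (hJ : IsKaehler (m := m) J) {X Y : VField m M}
    (hX : ∀ p, IsSmoothAt X p) (hY : ∀ p, IsSmoothAt Y p) (p : M) :
    nabla X (applyField J Y) p = J p (nabla X Y p) :=
  congrFun (hJ.parallel X Y ⟨hX, fun _ ↦ trivial⟩ ⟨hY, fun _ ↦ trivial⟩) p

section Tensors

variable [IsContMDiffRiemannianBundle (𝓡 m) ∞ (EuclideanSpace ℝ (Fin m))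
    (fun x : M ↦ TangentSpace (𝓡 m) x)]

theorem tensorA_of_horizontal_vertical {Z W : VField m M} (hZ : IsSection (horizontal n F) Z)
    (hW : IsSection (vertical n F) W) (p : M) :
    tensorA n F Z W p = hor n F (nabla Z W) p := by
  have h1 : hor n F Z = Z := funext fun x ↦ hor_eq_self (hZ.2 x)
  have h2 : vert n F W = W := funext fun x ↦ vert_eq_self (hW.2 x)
  have h3 : hor n F W = 0 := funext fun x ↦ hor_eq_zero (hW.2 x)
  have h4 : vert n F (nabla Z 0) p = 0 := by
    rw [vert, nabla_zero_right (IsSmoothAt.isDiffAt (hZ.1 p)), map_zero]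
  rw [tensorA, h1, h2, h3, Pi.add_apply, h4, add_zero]

theorem tensorT_of_vertical_horizontal {X W : VField m M} (hX : IsSection (vertical n F) X)
    (hW : IsSection (horizontal n F) W) (p : M) :
    tensorT n F X W p = vert n F (nabla X W) p := by
  have h1 : vert n F X = X := funext fun x ↦ vert_eq_self (hX.2 x)
  have h2 : hor n F W = W := funext fun x ↦ hor_eq_self (hW.2 x)
  have h3 : vert n F W = 0 := funext fun x ↦ vert_eq_zero (hW.2 x)
  have h4 : hor n F (nabla X 0) p = 0 := by
    rw [hor, nabla_zero_right (IsSmoothAt.isDiffAt (hX.1 p)), map_zero]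
  rw [tensorT, h1, h2, h3, Pi.add_apply, h4, zero_add]

end Tensors

variable [RiemannianBundle (fun y : N ↦ TangentSpace (𝓡 n) y)] {θ : ℝ}

namespace IsSlantSubmersion

theorem norm_starProjection (hF : IsSlantSubmersion (m := m) (n := n) J F θ)
    (hJ : IsAlmostHermitian (m := m) J) {x : M} {v : TangentSpace (𝓡 m) x}
    (hv : v ∈ vertical n F x) :
    ‖(vertical (m := m) n F x).starProjection (J x v)‖ = Real.cos θ * ‖v‖ := by
  have hn : ‖J x v‖ = ‖v‖ := by
    rw [norm_eq_sqrt_real_inner, hJ.isometry, ← norm_eq_sqrt_real_inner]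
  rcases eq_or_ne v 0 with rfl | h0
  · simp
  · rw [norm_starProjection_eq_cos_angle_mul, hF.angle_eq x v hv h0, hn]

/-- The dimension inequality supplies a vertical `v ≠ 0`, and `‖φ v‖ = cos θ ‖v‖` forces `cos θ ≥
0`. If the sine vanished, `cos θ` would be `1`, and `θ`, being an angle between vectors, would be
`0`. -/
theorem sin_sq_ne_zero (hF : IsSlantSubmersion (m := m) (n := n) J F θ)
    (hJ : IsAlmostHermitian (m := m) J) (hθ : θ ≠ 0) (x : M) : Real.sin θ ^ 2 ≠ 0 := by
  obtain ⟨v, hv, h0⟩ := (vertical n F x).exists_mem_ne_zero_of_ne_bot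
    (LinearMap.ker_ne_bot_of_finrank_lt (f := (mfderiv (𝓡 m) (𝓡 n) F x).toLinearMap) (by
      have h1 : Module.finrank ℝ (TangentSpace (𝓡 m) x) = m := finrank_euclideanSpace_fin
      have h2 : Module.finrank ℝ (TangentSpace (𝓡 n) (F x)) = n := finrank_euclideanSpace_fin
      rw [h1, h2]
      exact hF.dim_lt))
  have h1 : 0 ≤ Real.cos θ := by
    have := hF.norm_starProjection hJ hv
    by_contra! h
    have h2 := mul_neg_of_neg_of_pos h (norm_pos_iff.2 h0)
    exact absurd (norm_nonneg _) (by rw [this]; exact not_le.2 h2)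
  have h2 := hF.angle_eq x v hv h0
  intro h3
  have h4 : Real.cos θ = 1 := by nlinarith [Real.sin_sq_add_cos_sq θ]
  rw [← h2, InnerProductGeometry.cos_eq_one_iff_angle_eq_zero, h2] at h4
  exact hθ h4

/-- Polarizing `‖φ v‖ = cos θ ‖v‖` gives `⟪φ v, φ w⟫ = cos² θ ⟪v, w⟫`, and skewness of `J` gives `⟪φ
φ v, w⟫ = -⟪φ v, φ w⟫` on vertical vectors. -/
theorem phi_phi (hF : IsSlantSubmersion (m := m) (n := n) J F θ)
    (hJ : IsAlmostHermitian (m := m) J) {X : VField m M} {x : M} (hX : X x ∈ vertical n F x) :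
    phi n J F (phi n J F X) x = -(Real.cos θ ^ 2) • X x := by
  let P (v : TangentSpace (𝓡 m) x) := (vertical (m := m) n F x).starProjection (J x v)
  have hP (v) : P v ∈ vertical n F x := Submodule.starProjection_apply_mem _ _
  have hPi (v) {w} (hw : w ∈ vertical n F x) : ⟪P v, w⟫_ℝ = ⟪J x v, w⟫_ℝ := by
    rw [Submodule.inner_starProjection_left_eq_right, Submodule.starProjection_eq_self_iff.2 hw]
  have hPn {v} (hv : v ∈ vertical n F x) : ‖P v‖ = Real.cos θ * ‖v‖ := hF.norm_starProjection hJ hv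
  have hPadd (v w) : P (v + w) = P v + P w := by simp only [P, map_add]
  have hPP {v w} (hv : v ∈ vertical n F x) (hw : w ∈ vertical n F x) :
      ⟪P v, P w⟫_ℝ = Real.cos θ ^ 2 * ⟪v, w⟫_ℝ := by
    rw [real_inner_eq_norm_add_mul_self_sub_norm_mul_self_sub_norm_mul_self_div_two,
      real_inner_eq_norm_add_mul_self_sub_norm_mul_self_sub_norm_mul_self_div_two, ← hPadd,
      hPn hv, hPn hw, hPn (Submodule.add_mem _ hv hw)]
    ring
  have key : ∀ w ∈ vertical n F x, ⟪P (P (X x)) + (Real.cos θ ^ 2) • X x, w⟫_ℝ = 0 := by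
    intro w hw
    rw [inner_add_left, hPi _ hw, hJ.inner_left, real_inner_comm, ← hPi _ (hP _), real_inner_comm,
      hPP hX hw, real_inner_smul_left]
    ring
  have hmem : P (P (X x)) + (Real.cos θ ^ 2) • X x ∈ vertical n F x :=
    Submodule.add_mem _ (hP _) (Submodule.smul_mem _ _ hX)
  have := inner_self_eq_zero.1 (key _ hmem)
  rw [neg_smul]
  exact eq_neg_of_add_eq_zero_left this

/-- `J ω X = -sin² θ X - ω φ X` for vertical `X`. -/
theorem applyField_omega (hF : IsSlantSubmersion (m := m) (n := n) J F θ)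
    (hJ : IsAlmostHermitian (m := m) J) {X : VField m M} {x : M} (hX : X x ∈ vertical n F x) :
    J x (omega n J F X x) = -(Real.sin θ ^ 2) • X x - omega n J F (phi n J F X) x := by
  have h1 : phi n J F X x + omega n J F X x = J x (X x) :=
    congrFun (vert_add_hor (n := n) (F := F) (applyField J X)) x
  have h2 : phi n J F (phi n J F X) x + omega n J F (phi n J F X) x = J x (phi n J F X x) :=
    congrFun (vert_add_hor (n := n) (F := F) (applyField J (phi n J F X))) x
  have h3 := congrArg (J x) h1
  rw [map_add, hJ.sq, ← h2, hF.phi_phi hJ hX] at h3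
  rw [eq_sub_of_add_eq' h3, Real.sin_sq]
  module

end IsSlantSubmersion

/-! ### The two equations of (2) as conditions on the connection. -/

section Equations

variable [IsContMDiffRiemannianBundle (𝓡 m) ∞ (EuclideanSpace ℝ (Fin m))
    (fun x : M ↦ TangentSpace (𝓡 m) x)]
  [IsManifold (𝓡 n) ∞ N] [IsContMDiffRiemannianBundle (𝓡 n) ∞ (EuclideanSpace ℝ (Fin n))
    (fun y : N ↦ TangentSpace (𝓡 n) y)]

namespace IsSlantSubmersion

theorem isSection_omega (hF : IsSlantSubmersion (m := m) (n := n) J F θ)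
    (hJ : IsKaehler (m := m) J) {X : VField m M} (hX : ∀ p, IsSmoothAt X p) :
    IsSection (horizontal n F) (hor n F (applyField J X)) :=
  ⟨fun p ↦ hF.isSmoothAt_hor (hJ.isSmoothAt (hX p)), hor_apply_mem _⟩

theorem isSection_phi (hF : IsSlantSubmersion (m := m) (n := n) J F θ)
    (hJ : IsKaehler (m := m) J) {X : VField m M} (hX : ∀ p, IsSmoothAt X p) :
    IsSection (vertical n F) (vert n F (applyField J X)) :=
  ⟨fun p ↦ hF.isSmoothAt_vert (hJ.isSmoothAt (hX p)), vert_apply_mem _⟩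

/-- Against the horizontal `ωX`, the two terms on the left recombine to `∇_{Z₁} (J Z₂) = J ∇_{Z₁}
Z₂`. Moving `J` across the inner product leaves `J ω X`. -/
theorem horizontal_equation (hF : IsSlantSubmersion (m := m) (n := n) J F θ)
    (hJ : IsKaehler (m := m) J) {X Z₁ Z₂ : VField m M} (hX : IsSection (vertical n F) X)
    (hZ₁ : IsSection (horizontal n F) Z₁) (hZ₂ : IsSection (horizontal n F) Z₂) (p : M) :
    ⟪tensorA n F Z₁ (tensorB n J F Z₂) p + hor n F (nabla Z₁ (tensorC n J F Z₂)) p,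
        omega n J F X p⟫_ℝ
      = Real.sin θ ^ 2 * ⟪nabla Z₁ Z₂ p, X p⟫_ℝ
        + ⟪hor n F (nabla Z₁ Z₂) p, omega n J F (phi n J F X) p⟫_ℝ := by
  have hB : IsSection (vertical n F) (tensorB n J F Z₂) := hF.isSection_phi hJ hZ₂.1
  have hC : IsSection (horizontal n F) (tensorC n J F Z₂) := hF.isSection_omega hJ hZ₂.1
  have hω : omega n J F X p ∈ horizontal n F p := hor_apply_mem _ _
  have hω' : omega n J F (phi n J F X) p ∈ horizontal n F p := hor_apply_mem _ _
  have hBC : tensorB n J F Z₂ + tensorC n J F Z₂ = applyField J Z₂ := vert_add_hor _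
  rw [tensorA_of_horizontal_vertical hZ₁ hB, inner_add_left, inner_hor_left _ hω,
    inner_hor_left _ hω, inner_hor_left _ hω', ← inner_add_left,
    ← nabla_add_right (IsSmoothAt.isDiffAt (hZ₁.1 p)) (IsSmoothAt.isDiffAt (hB.1 p))
      (IsSmoothAt.isDiffAt (hC.1 p)), hBC, hJ.nabla_applyField hZ₁.1 hZ₂.1,
    hJ.inner_left, hF.applyField_omega hJ.toIsAlmostHermitian (hX.2 p), inner_sub_right,
    real_inner_smul_right]
  ring

/-- The two terms on the left are the horizontal and the vertical part of `⟪∇_X ωY, J Z⟫ = -⟪∇_X (J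
ω Y), Z⟫`. As `θ` is constant, `sin² θ` comes out of the covariant derivative of `J ω Y`. -/
theorem vertical_equation (hF : IsSlantSubmersion (m := m) (n := n) J F θ)
    (hJ : IsKaehler (m := m) J) {X Y Z : VField m M} (hX : IsSection (vertical n F) X)
    (hY : IsSection (vertical n F) Y) (hZ : IsSection (horizontal n F) Z) (p : M) :
    ⟪hor n F (nabla X (omega n J F Y)) p, tensorC n J F Z p⟫_ℝ
        + ⟪tensorT n F X (omega n J F Y) p, tensorB n J F Z p⟫_ℝ
      = Real.sin θ ^ 2 * ⟪nabla X Y p, Z p⟫_ℝ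
        + ⟪hor n F (nabla X (omega n J F (phi n J F Y))) p, Z p⟫_ℝ := by
  have hφ : IsSection (vertical n F) (phi n J F Y) := hF.isSection_phi hJ hY.1
  have hω : IsSection (horizontal n F) (omega n J F Y) := hF.isSection_omega hJ hY.1
  have hω' : IsSection (horizontal n F) (omega n J F (phi n J F Y)) := hF.isSection_omega hJ hφ.1
  have hBC : tensorB n J F Z p + tensorC n J F Z p = J p (Z p) := congrFun (vert_add_hor _) p
  have hJω : applyField J (omega n J F Y)
      = (-(Real.sin θ ^ 2)) • Y + (-1 : ℝ) • omega n J F (phi n J F Y) :=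
    funext fun x ↦ (hF.applyField_omega hJ.toIsAlmostHermitian (hY.2 x)).trans (by
      simp only [Pi.add_apply, Pi.smul_apply]
      module)
  have hXd := IsSmoothAt.isDiffAt (hX.1 p)
  have hC : tensorC n J F Z p ∈ horizontal n F p := hor_apply_mem _ _
  have hB : tensorB n J F Z p ∈ vertical n F p := vert_apply_mem _ _
  rw [tensorT_of_vertical_horizontal hX hω, inner_hor_left _ hC, inner_vert_left _ hB,
    ← inner_add_right, add_comm (tensorC n J F Z p), hBC,
    inner_hor_left _ (hZ.2 p), ← neg_neg ⟪_, J p (Z p)⟫_ℝ, ← hJ.inner_left,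
    ← hJ.nabla_applyField hX.1 hω.1, hJω,
    nabla_add_right hXd (IsSmoothAt.isDiffAt (IsSmoothAt.const_smul (hY.1 p)))
      (IsSmoothAt.isDiffAt (IsSmoothAt.const_smul (hω'.1 p))),
    nabla_const_smul_right _ hXd (IsSmoothAt.isDiffAt (hY.1 p)),
    nabla_const_smul_right _ hXd (IsSmoothAt.isDiffAt (hω'.1 p)), inner_add_left,
    real_inner_smul_left, real_inner_smul_left]
  ring

variable [T2Space M]

/-- By `horizontal_equation` the identity amounts to `sin² θ ⟪∇_{Z₁} Z₂, X⟫ = 0`. Every vertical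
vector is the value of a global section, so this tests orthogonality to the whole fibre of `ker
F_*`. -/
theorem isTotallyGeodesic_horizontal_iff (hF : IsSlantSubmersion (m := m) (n := n) J F θ)
    (hJ : IsKaehler (m := m) J) (hθ : θ ≠ 0) :
    IsTotallyGeodesic (m := m) (horizontal n F) ↔
      ∀ X Z₁ Z₂ : VField m M, IsSection (vertical n F) X → IsSection (horizontal n F) Z₁ →
        IsSection (horizontal n F) Z₂ → ∀ p,
        ⟪hor n F (nabla Z₁ Z₂) p, omega n J F (phi n J F X) p⟫_ℝ
          = ⟪tensorA n F Z₁ (tensorB n J F Z₂) p + hor n F (nabla Z₁ (tensorC n J F Z₂)) p,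
              omega n J F X p⟫_ℝ := by
  refine ⟨fun h X Z₁ Z₂ hX hZ₁ hZ₂ p ↦ ?_, fun h Z₁ Z₂ hZ₁ hZ₂ p ↦
    mem_horizontal_of_inner fun v hv ↦ ?_⟩
  · rw [hF.horizontal_equation hJ hX hZ₁ hZ₂,
      inner_horizontal_vertical (h Z₁ Z₂ hZ₁ hZ₂ p) (hX.2 p), mul_zero, zero_add]
  · obtain ⟨X, hX, rfl⟩ := hF.exists_isSection_vertical hv
    have h1 := h X Z₁ Z₂ hX hZ₁ hZ₂ p
    rw [hF.horizontal_equation hJ hX hZ₁ hZ₂, right_eq_add, mul_eq_zero] at h1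
    exact h1.resolve_left (hF.sin_sq_ne_zero hJ.toIsAlmostHermitian hθ p)

theorem isTotallyGeodesic_vertical_iff (hF : IsSlantSubmersion (m := m) (n := n) J F θ)
    (hJ : IsKaehler (m := m) J) (hθ : θ ≠ 0) :
    IsTotallyGeodesic (m := m) (vertical n F) ↔
      ∀ X Y Z₁ : VField m M, IsSection (vertical n F) X → IsSection (vertical n F) Y →
        IsSection (horizontal n F) Z₁ → ∀ p,
        ⟪hor n F (nabla X (omega n J F (phi n J F Y))) p, Z₁ p⟫_ℝ
          = ⟪hor n F (nabla X (omega n J F Y)) p, tensorC n J F Z₁ p⟫_ℝ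
            + ⟪tensorT n F X (omega n J F Y) p, tensorB n J F Z₁ p⟫_ℝ := by
  refine ⟨fun h X Y Z hX hY hZ p ↦ ?_, fun h X Y hX hY p ↦ mem_vertical_of_inner fun v hv ↦ ?_⟩
  · rw [hF.vertical_equation hJ hX hY hZ,
      inner_vertical_horizontal (h X Y hX hY p) (hZ.2 p), mul_zero, zero_add]
  · obtain ⟨Z, hZ, rfl⟩ := hF.exists_isSection_horizontal hv
    have h1 := h X Y Z hX hY hZ p
    rw [hF.vertical_equation hJ hX hY hZ, right_eq_add, mul_eq_zero] at h1
    exact h1.resolve_left (hF.sin_sq_ne_zero hJ.toIsAlmostHermitian hθ p)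

end IsSlantSubmersion

end Equations

end Slant

/-! ### Coordinate fields and Koszul's formula without brackets. -/

section CoordinateFields

variable {m : ℕ} {M : Type*} [TopologicalSpace M] [ChartedSpace (EuclideanSpace ℝ (Fin m)) M]
  {E : Type*} [NormedAddCommGroup E] [NormedSpace ℝ E] {Φ : OpenPartialHomeomorph M E}

/-- The coordinate field `∂_v` of the chart `Φ`. -/
abbrev constField (m : ℕ) [ChartedSpace (EuclideanSpace ℝ (Fin m)) M]
    (Φ : OpenPartialHomeomorph M E) (v : E) : VField m M := coordField m Φ fun _ ↦ v

theorem mvfderiv_eventually_zero {f : M → ℝ} {p : M} (hf : ∀ᶠ x in 𝓝 p, f x = 0)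
    (v : TangentSpace (𝓡 m) p) : mvfderiv (𝓡 m) f p v = 0 := by
  have : f =ᶠ[𝓝 p] fun _ ↦ 0 := hf
  rw [mvfderiv_congr this, mvfderiv_const]
  rfl

namespace IsSmoothChart

theorem mvfderiv_constField (hΦ : IsSmoothChart (m := m) Φ) {f : M → ℝ} {k : E → ℝ} {p : M}
    (hp : p ∈ Φ.source) (hk : DifferentiableAt ℝ k (Φ p)) (hf : f =ᶠ[𝓝 p] fun x ↦ k (Φ x)) (c : E) :
    mvfderiv (𝓡 m) f p (constField m Φ c p) = fderiv ℝ k (Φ p) c := by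
  rw [mvfderiv_congr hf]
  have h1 := mfderiv_comp_apply (I := 𝓡 m) (I' := 𝓘(ℝ, E)) (I'' := 𝓘(ℝ)) p
    hk.mdifferentiableAt ((hΦ.contMDiffAt hp).mdifferentiableAt (by simp)) (constField m Φ c p)
  refine h1.trans ?_
  rw [hΦ.mfderiv_coordField hp, mfderiv_eq_fderiv]
  rfl

theorem constField_mfderiv (hΦ : IsSmoothChart (m := m) Φ) {p : M} (hp : p ∈ Φ.source)
    (v : TangentSpace (𝓡 m) p) :
    constField m Φ (mfderiv (𝓡 m) 𝓘(ℝ, E) Φ p v) p = v :=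
  (hΦ.isInvertible hp).inverse_apply_self v

theorem constField_add (v w : E) (p : M) :
    constField m Φ (v + w) p = constField m Φ v p + constField m Φ w p :=
  map_add (mfderiv (𝓡 m) 𝓘(ℝ, E) Φ p).inverse v w

theorem constField_smul (c : ℝ) (v : E) (p : M) :
    constField m Φ (c • v) p = c • constField m Φ v p :=
  map_smul (mfderiv (𝓡 m) 𝓘(ℝ, E) Φ p).inverse c v

variable [IsManifold (𝓡 m) ∞ M]

theorem isSmoothAt_constField (hΦ : IsSmoothChart (m := m) Φ) {p : M} (hp : p ∈ Φ.source) (v : E) :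
    IsSmoothAt (constField m Φ v) p :=
  hΦ.isSmoothAt_coordField hp contDiffAt_const

theorem mlieBracket_constField (hΦ : IsSmoothChart (m := m) Φ) {p : M} (hp : p ∈ Φ.source)
    (v w : E) : mlieBracket (𝓡 m) (constField m Φ v) (constField m Φ w) p = 0 := by
  rw [hΦ.mlieBracket_coordField hp contDiffAt_const contDiffAt_const]
  have : lieBracket ℝ (fun _ : E ↦ v) (fun _ ↦ w) = 0 := by
    funext q; simp [lieBracket]
  rw [this]
  exact map_zero (mfderiv (𝓡 m) 𝓘(ℝ, E) Φ p).inverse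

variable [RiemannianBundle (fun x : M ↦ TangentSpace (𝓡 m) x)]

theorem koszul_constField (hΦ : IsSmoothChart (m := m) Φ) {p : M} (hp : p ∈ Φ.source)
    (a b c : E) : koszul (constField m Φ a) (constField m Φ b) (constField m Φ c) p
      = mvfderiv (𝓡 m) (fun x ↦ ⟪constField m Φ b x, constField m Φ c x⟫_ℝ) p (constField m Φ a p)
        + mvfderiv (𝓡 m) (fun x ↦ ⟪constField m Φ c x, constField m Φ a x⟫_ℝ) p
          (constField m Φ b p)
        - mvfderiv (𝓡 m) (fun x ↦ ⟪constField m Φ a x, constField m Φ b x⟫_ℝ) p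
          (constField m Φ c p) := by
  simp only [koszul, hΦ.mlieBracket_constField hp, inner_zero_left, add_zero, sub_zero]

end IsSmoothChart

end CoordinateFields

/-! ### Local products have totally geodesic factors. -/

section LocallyProduct

variable {m : ℕ} {M : Type*} [TopologicalSpace M] [ChartedSpace (EuclideanSpace ℝ (Fin m)) M]
  [IsManifold (𝓡 m) ∞ M] [RiemannianBundle (fun x : M ↦ TangentSpace (𝓡 m) x)]
  [IsContMDiffRiemannianBundle (𝓡 m) ∞ (EuclideanSpace ℝ (Fin m))
    (fun x : M ↦ TangentSpace (𝓡 m) x)]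

/-- For `c ∈ L`, differentiating `⟪Y, ∂_c⟫ = 0` gives `⟪∇_X Y, ∂_c⟫ = -⟪Y, ∇_X ∂_c⟫`. The last term
sees only the values at `p`, so `X` and `Y` may be replaced by coordinate fields `∂_a`, `∂_b`;
Koszul's formula then leaves only `∂_c ⟪∂_b, ∂_a⟫`, which is zero by `hder`. -/
theorem nabla_mem_of_chart {E : Type*} [NormedAddCommGroup E] [NormedSpace ℝ E] [CompleteSpace E]
    {Φ : OpenPartialHomeomorph M E} (hΦ : IsSmoothChart (m := m) Φ) {D : Distr m M}
    {K L : Submodule ℝ E} (hKL : ∀ z : E, ∃ a ∈ K, ∃ c ∈ L, z = a + c)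
    (hD : ∀ x ∈ Φ.source, ∀ v : TangentSpace (𝓡 m) x,
      v ∈ D x ↔ (mfderiv (𝓡 m) 𝓘(ℝ, E) Φ x v : E) ∈ K)
    (horth : ∀ x ∈ Φ.source, ∀ a ∈ K, ∀ c ∈ L,
      ⟪constField m Φ a x, constField m Φ c x⟫_ℝ = 0) {p : M} (hp : p ∈ Φ.source)
    (hder : ∀ a ∈ K, ∀ b ∈ K, ∀ c ∈ L, mvfderiv (𝓡 m)
      (fun x ↦ ⟪constField m Φ a x, constField m Φ b x⟫_ℝ) p (constField m Φ c p) = 0)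
    {X Y : VField m M} (hX : IsSection D X) (hY : IsSection D Y) : nabla X Y p ∈ D p := by
  have hs := Φ.open_source.mem_nhds hp
  have key : ∀ c ∈ L, ⟪nabla X Y p, constField m Φ c p⟫_ℝ = 0 := by
    intro c hc
    have hXd := IsSmoothAt.isDiffAt (hX.1 p)
    have hYd := IsSmoothAt.isDiffAt (hY.1 p)
    have hd (v : E) := (hΦ.isSmoothAt_constField hp v).isDiffAt
    have h1 := inner_nabla_add_inner_nabla hXd hYd (hd c)
    rw [mvfderiv_eventually_zero (by
      filter_upwards [hs] with x hx
      rw [← hΦ.constField_mfderiv hx (Y x)]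
      exact horth x hx _ ((hD x hx _).1 (hY.2 x)) c hc)] at h1
    obtain ⟨a, ha, ha'⟩ : ∃ a ∈ K, constField m Φ a p = X p :=
      ⟨_, (hD p hp _).1 (hX.2 p), hΦ.constField_mfderiv hp _⟩
    obtain ⟨b, hb, hb'⟩ : ∃ b ∈ K, constField m Φ b p = Y p :=
      ⟨_, (hD p hp _).1 (hY.2 p), hΦ.constField_mfderiv hp _⟩
    have h2 : nabla X (constField m Φ c) p = nabla (constField m Φ a) (constField m Φ c) p :=
      (nabla_tensorial_left (hd c)).pointwise hXd (hd a) ha'.symm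
    have h3 := two_mul_inner_nabla (hd a) (hd c) (hd b)
    rw [hΦ.koszul_constField hp, hder b hb a ha c hc,
      mvfderiv_eventually_zero (f := fun x ↦ ⟪constField m Φ c x, constField m Φ b x⟫_ℝ) (by
        filter_upwards [hs] with x hx
        rw [real_inner_comm]
        exact horth x hx b hb c hc),
      mvfderiv_eventually_zero (f := fun x ↦ ⟪constField m Φ a x, constField m Φ c x⟫_ℝ) (by
        filter_upwards [hs] with x hx
        exact horth x hx a ha c hc)] at h3
    rw [h2, ← hb', real_inner_comm (nabla (constField m Φ a) (constField m Φ c) p)] at h1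
    linarith
  -- The `L`-component of `∇_X Y` is orthogonal both to the `K`-component and to `∇_X Y`, hence to
  -- itself.
  obtain ⟨a, ha, c, hc, hac⟩ := hKL (mfderiv (𝓡 m) 𝓘(ℝ, E) Φ p (nabla X Y p))
  have h1 : nabla X Y p = constField m Φ a p + constField m Φ c p := by
    rw [← hΦ.constField_mfderiv hp (nabla X Y p), hac, IsSmoothChart.constField_add]
  have h2 := key c hc
  rw [h1, inner_add_left, horth p hp a ha c hc, zero_add, inner_self_eq_zero] at h2
  rw [hD p hp, h1, h2, add_zero, hΦ.mfderiv_coordField hp]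
  exact ha

/-- In a product chart the block `g₁` depends on the first coordinate only, so it has zero
derivative along the second factor, and symmetrically for `g₂`. -/
theorem IsLocallyProduct.isTotallyGeodesic {D₁ D₂ : Distr m M}
    (h : IsLocallyProduct (m := m) D₁ D₂) :
    IsTotallyGeodesic (m := m) D₁ ∧ IsTotallyGeodesic (m := m) D₂ := by
  let K₁ (k l : ℕ) : Submodule ℝ (EuclideanSpace ℝ (Fin k) × EuclideanSpace ℝ (Fin l)) :=
    LinearMap.ker (LinearMap.snd ℝ _ _)
  let K₂ (k l : ℕ) : Submodule ℝ (EuclideanSpace ℝ (Fin k) × EuclideanSpace ℝ (Fin l)) :=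
    LinearMap.ker (LinearMap.fst ℝ _ _)
  have mem₁ {k l z} : z ∈ K₁ k l ↔ z.2 = 0 := LinearMap.mem_ker
  have mem₂ {k l z} : z ∈ K₂ k l ↔ z.1 = 0 := LinearMap.mem_ker
  constructor
  · intro X Y hX hY p
    obtain ⟨k, l, Φ, U, V, g₁, g₂, hp, htgt, h1, h2, hU, hV, hmet, hD⟩ := h p
    have hΦ : IsSmoothChart (m := m) Φ := ⟨h1, h2⟩
    have hg (x) (hx : x ∈ Φ.source) (v w) : ⟪constField m Φ v x, constField m Φ w x⟫_ℝ
        = g₁ (Φ x).1 v.1 w.1 + g₂ (Φ x).2 v.2 w.2 := by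
      rw [hmet x hx]
      have hv (v) : mvfderiv (𝓡 m) Φ x (constField m Φ v x) = v := hΦ.mfderiv_coordField hx _
      rw [hv, hv]
    have hpt : Φ p ∈ U ×ˢ V := htgt ▸ Φ.map_source hp
    refine nabla_mem_of_chart hΦ (K := K₁ k l) (L := K₂ k l)
      (fun z ↦ ⟨(z.1, 0), mem₁.2 rfl, (0, z.2), mem₂.2 rfl, by simp⟩)
      (fun x hx v ↦ (hD x hx v).1.trans mem₁.symm) (fun x hx a ha c hc ↦ ?_) hp
      (fun a ha b hb c hc ↦ ?_) hX hY
    · rw [hg x hx, mem₁.1 ha, mem₂.1 hc]; simp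
    · have hk : DifferentiableAt ℝ (fun y ↦ g₁ y a.1 b.1) (Φ p).1 :=
        (((hU.smooth.contDiffAt (hU.isOpen.mem_nhds hpt.1)).clm_apply contDiffAt_const).clm_apply
          contDiffAt_const).differentiableAt (by simp)
      have hk' : HasFDerivAt (fun z : EuclideanSpace ℝ (Fin k) × EuclideanSpace ℝ (Fin l) ↦
          g₁ z.1 a.1 b.1) _ (Φ p) :=
        HasFDerivAt.comp (g := fun y ↦ g₁ y a.1 b.1) (Φ p) hk.hasFDerivAt hasFDerivAt_fst
      rw [hΦ.mvfderiv_constField hp hk'.differentiableAt (by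
        filter_upwards [Φ.open_source.mem_nhds hp] with x hx
        rw [hg x hx, mem₁.1 ha]; simp), hk'.fderiv]
      simp [mem₂.1 hc]
  · intro X Y hX hY p
    obtain ⟨k, l, Φ, U, V, g₁, g₂, hp, htgt, h1, h2, hU, hV, hmet, hD⟩ := h p
    have hΦ : IsSmoothChart (m := m) Φ := ⟨h1, h2⟩
    have hg (x) (hx : x ∈ Φ.source) (v w) : ⟪constField m Φ v x, constField m Φ w x⟫_ℝ
        = g₁ (Φ x).1 v.1 w.1 + g₂ (Φ x).2 v.2 w.2 := by
      rw [hmet x hx]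
      have hv (v) : mvfderiv (𝓡 m) Φ x (constField m Φ v x) = v := hΦ.mfderiv_coordField hx _
      rw [hv, hv]
    have hpt : Φ p ∈ U ×ˢ V := htgt ▸ Φ.map_source hp
    refine nabla_mem_of_chart hΦ (K := K₂ k l) (L := K₁ k l)
      (fun z ↦ ⟨(0, z.2), mem₂.2 rfl, (z.1, 0), mem₁.2 rfl, by simp⟩)
      (fun x hx v ↦ (hD x hx v).2.trans mem₂.symm) (fun x hx a ha c hc ↦ ?_) hp
      (fun a ha b hb c hc ↦ ?_) hX hY
    · rw [hg x hx, mem₂.1 ha, mem₁.1 hc]; simp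
    · have hk : DifferentiableAt ℝ (fun y ↦ g₂ y a.2 b.2) (Φ p).2 :=
        (((hV.smooth.contDiffAt (hV.isOpen.mem_nhds hpt.2)).clm_apply contDiffAt_const).clm_apply
          contDiffAt_const).differentiableAt (by simp)
      have hk' : HasFDerivAt (fun z : EuclideanSpace ℝ (Fin k) × EuclideanSpace ℝ (Fin l) ↦
          g₂ z.2 a.2 b.2) _ (Φ p) :=
        HasFDerivAt.comp (g := fun y ↦ g₂ y a.2 b.2) (Φ p) hk.hasFDerivAt hasFDerivAt_snd
      rw [hΦ.mvfderiv_constField hp hk'.differentiableAt (by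
        filter_upwards [Φ.open_source.mem_nhds hp] with x hx
        rw [hg x hx, mem₂.1 ha]; simp), hk'.fderiv]
      simp [mem₁.1 hc]

end LocallyProduct

/-! ### Splitting the metric in an adapted chart. -/

section ProductMetric

variable {m : ℕ} {M : Type*} [TopologicalSpace M] [T2Space M]
  [ChartedSpace (EuclideanSpace ℝ (Fin m)) M]
  [IsManifold (𝓡 m) ∞ M] [RiemannianBundle (fun x : M ↦ TangentSpace (𝓡 m) x)]

/-- The definition quantifies over global sections. Cutting off local ones does not change their
germs at `p`, and `nabla` depends only on germs. -/
theorem IsTotallyGeodesic.nabla_mem {D : Distr m M} (h : IsTotallyGeodesic (m := m) D)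
    {X Y : VField m M} {O : Set M} (hO : IsOpen O) {p : M} (hp : p ∈ O)
    (hX : ∀ x ∈ O, IsSmoothAt X x ∧ X x ∈ D x) (hY : ∀ x ∈ O, IsSmoothAt Y x ∧ Y x ∈ D x) :
    nabla X Y p ∈ D p := by
  obtain ⟨X', hX', hXX'⟩ := exists_isSection_eventuallyEq hO hp (fun x hx ↦ (hX x hx).1)
    fun x hx ↦ (hX x hx).2
  obtain ⟨Y', hY', hYY'⟩ := exists_isSection_eventuallyEq hO hp (fun x hx ↦ (hY x hx).1)
    fun x hx ↦ (hY x hx).2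
  rw [← nabla_congr hXX' hYY']
  exact h X' Y' hX' hY' p

variable [IsContMDiffRiemannianBundle (𝓡 m) ∞ (EuclideanSpace ℝ (Fin m))
    (fun x : M ↦ TangentSpace (𝓡 m) x)]

theorem IsTotallyGeodesic.mlieBracket_mem {D : Distr m M} (h : IsTotallyGeodesic (m := m) D)
    {X Y : VField m M} {O : Set M} (hO : IsOpen O) {p : M} (hp : p ∈ O)
    (hX : ∀ x ∈ O, IsSmoothAt X x ∧ X x ∈ D x) (hY : ∀ x ∈ O, IsSmoothAt Y x ∧ Y x ∈ D x) :
    mlieBracket (𝓡 m) X Y p ∈ D p := by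
  rw [← nabla_sub_nabla (hX p hp).1.isDiffAt (hY p hp).1.isDiffAt]
  exact (D p).sub_mem (h.nabla_mem hO hp hX hY) (h.nabla_mem hO hp hY hX)

/-- In coordinates adapted to a totally geodesic distribution `D` and to a distribution orthogonal
to it, the metric of `D` is constant in the direction of the latter. -/
theorem IsTotallyGeodesic.fderiv_gram {E : Type*} [NormedAddCommGroup E] [NormedSpace ℝ E]
    [FiniteDimensional ℝ E] {Φ : OpenPartialHomeomorph M E} (hΦ : IsSmoothChart (m := m) Φ)
    {D D' : Distr m M} (h : IsTotallyGeodesic (m := m) D)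
    (horth : ∀ x, ∀ v ∈ D x, ∀ w ∈ D' x, ⟪v, w⟫_ℝ = 0) {a b c : E}
    (ha : ∀ x ∈ Φ.source, constField m Φ a x ∈ D x)
    (hb : ∀ x ∈ Φ.source, constField m Φ b x ∈ D x)
    (hc : ∀ x ∈ Φ.source, constField m Φ c x ∈ D' x) {q : E} (hq : q ∈ Φ.target) :
    fderiv ℝ (fun q ↦ gram m Φ q a b) q c = 0 := by
  have : CompleteSpace E := FiniteDimensional.complete ℝ E
  have hp := Φ.map_target hq
  set p := Φ.symm q with hpq
  have hs := Φ.open_source.mem_nhds hp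
  have hd (v : E) := (hΦ.isSmoothAt_constField hp v).isDiffAt
  have h1 := two_mul_inner_nabla (hd a) (hd b) (hd c)
  -- The left side `2 ⟪∇_a b, c⟫` is zero since `D` is totally geodesic; orthogonality near `p`
  -- removes the other two derivatives from Koszul's formula.
  rw [hΦ.koszul_constField hp, horth p _ (h.nabla_mem Φ.open_source hp
      (fun x hx ↦ ⟨hΦ.isSmoothAt_constField hx a, ha x hx⟩)
      fun x hx ↦ ⟨hΦ.isSmoothAt_constField hx b, hb x hx⟩) _ (hc p hp),
    mvfderiv_eventually_zero (f := fun x ↦ ⟪constField m Φ b x, constField m Φ c x⟫_ℝ) (by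
      filter_upwards [hs] with x hx
      exact horth x _ (hb x hx) _ (hc x hx)),
    mvfderiv_eventually_zero (f := fun x ↦ ⟪constField m Φ c x, constField m Φ a x⟫_ℝ) (by
      filter_upwards [hs] with x hx
      rw [real_inner_comm]
      exact horth x _ (ha x hx) _ (hc x hx))] at h1
  have hk : DifferentiableAt ℝ (fun q ↦ gram m Φ q a b) (Φ p) := by
    rw [Φ.right_inv hq]
    exact (((contDiffAt_gram hΦ hq).clm_apply contDiffAt_const).clm_apply
      contDiffAt_const).differentiableAt (by simp)
  rw [hΦ.mvfderiv_constField hp hk (by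
    filter_upwards [hs] with x hx
    rw [gram_apply, Φ.left_inv hx]) c, Φ.right_inv hq] at h1
  linarith

/-- Two orthogonal totally geodesic distributions that are tangent to the factors of a product
chart split the metric. -/
theorem exists_productMetric {k l : ℕ}
    {Φ : OpenPartialHomeomorph M (EuclideanSpace ℝ (Fin k) × EuclideanSpace ℝ (Fin l))}
    (hΦ : IsSmoothChart (m := m) Φ) {U : Set (EuclideanSpace ℝ (Fin k))}
    {V : Set (EuclideanSpace ℝ (Fin l))} (hU : IsOpen U) (hV : IsOpen V) (hU' : IsPreconnected U)
    (hV' : IsPreconnected V) (htgt : Φ.target = U ×ˢ V) {p : M} (hp : p ∈ Φ.source)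
    {D₁ D₂ : Distr m M} (h₁ : IsTotallyGeodesic (m := m) D₁) (h₂ : IsTotallyGeodesic (m := m) D₂)
    (horth : ∀ x, ∀ v ∈ D₁ x, ∀ w ∈ D₂ x, ⟪v, w⟫_ℝ = 0)
    (hD : ∀ x ∈ Φ.source, ∀ v : TangentSpace (𝓡 m) x,
      (v ∈ D₁ x ↔ (mvfderiv (𝓡 m) Φ x v).2 = 0) ∧ (v ∈ D₂ x ↔ (mvfderiv (𝓡 m) Φ x v).1 = 0)) :
    ∃ g₁ g₂, IsMetricOn U g₁ ∧ IsMetricOn V g₂ ∧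
      ∀ x ∈ Φ.source, ∀ v w : TangentSpace (𝓡 m) x,
        ⟪v, w⟫_ℝ = g₁ (Φ x).1 (mvfderiv (𝓡 m) Φ x v).1 (mvfderiv (𝓡 m) Φ x w).1
          + g₂ (Φ x).2 (mvfderiv (𝓡 m) Φ x v).2 (mvfderiv (𝓡 m) Φ x w).2 := by
  have hv (x) (hx : x ∈ Φ.source) (z) : mvfderiv (𝓡 m) Φ x (constField m Φ z x) = z :=
    hΦ.mfderiv_coordField hx _
  have mem₁ (a) (x) (hx : x ∈ Φ.source) : constField m Φ (a, 0) x ∈ D₁ x := by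
    rw [(hD x hx _).1, hv x hx]
  have mem₂ (c) (x) (hx : x ∈ Φ.source) : constField m Φ (0, c) x ∈ D₂ x := by
    rw [(hD x hx _).2, hv x hx]
  obtain ⟨hu₀, hv₀⟩ : Φ p ∈ U ×ˢ V := htgt ▸ Φ.map_source hp
  have hmem {u v} (hu : u ∈ U) (hv : v ∈ V) : (u, v) ∈ Φ.target := htgt ▸ ⟨hu, hv⟩
  have hdiff (z z') (q) (hq : q ∈ Φ.target) : DifferentiableAt ℝ (fun q ↦ gram m Φ q z z') q :=
    (((contDiffAt_gram hΦ hq).clm_apply contDiffAt_const).clm_apply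
      contDiffAt_const).differentiableAt (by simp)
  -- The derivative along `V` vanishes by `fderiv_gram`, so preconnectedness of `V` makes the first
  -- block independent of the second coordinate.
  have const₁ {u v v'} (hu : u ∈ U) (hv : v ∈ V) (hv' : v' ∈ V) (a a') :
      gram m Φ (u, v) (a, 0) (a', 0) = gram m Φ (u, v') (a, 0) (a', 0) := by
    have hd (y) (hy : y ∈ V) : HasFDerivAt (fun y ↦ gram m Φ (u, y) (a, 0) (a', 0)) _ y :=
      (hdiff (a, 0) (a', 0) (u, y) (hmem hu hy)).hasFDerivAt.comp y (hasFDerivAt_prodMk_right u y)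
    refine hV.is_const_of_fderiv_eq_zero (f := fun y ↦ gram m Φ (u, y) (a, 0) (a', 0)) hV'
      (fun y hy ↦ (hd y hy).differentiableAt.differentiableWithinAt) (fun y hy ↦ ?_) hv hv'
    ext c
    rw [(hd y hy).fderiv]
    exact h₁.fderiv_gram hΦ horth (mem₁ a) (mem₁ a') (mem₂ c) (hmem hu hy)
  have const₂ {u u' v} (hu : u ∈ U) (hu' : u' ∈ U) (hv : v ∈ V) (c c') :
      gram m Φ (u, v) (0, c) (0, c') = gram m Φ (u', v) (0, c) (0, c') := by
    have hd (y) (hy : y ∈ U) : HasFDerivAt (fun y ↦ gram m Φ (y, v) (0, c) (0, c')) _ y :=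
      HasFDerivAt.comp (f := fun y ↦ (y, v)) y
        (hdiff (0, c) (0, c') (y, v) (hmem hy hv)).hasFDerivAt (hasFDerivAt_prodMk_left y v)
    refine hU.is_const_of_fderiv_eq_zero (f := fun y ↦ gram m Φ (y, v) (0, c) (0, c')) hU'
      (fun y hy ↦ (hd y hy).differentiableAt.differentiableWithinAt) (fun y hy ↦ ?_) hu hu'
    ext a
    rw [(hd y hy).fderiv]
    exact h₂.fderiv_gram hΦ (fun x v hv w hw ↦ by rw [real_inner_comm]; exact horth x w hw v hv)
      (mem₂ c) (mem₂ c') (mem₁ a) (hmem hy hv)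
  let ι₁ := ContinuousLinearMap.inl ℝ (EuclideanSpace ℝ (Fin k)) (EuclideanSpace ℝ (Fin l))
  let ι₂ := ContinuousLinearMap.inr ℝ (EuclideanSpace ℝ (Fin k)) (EuclideanSpace ℝ (Fin l))
  -- Each factor metric is a diagonal block with the other coordinate frozen at that of `p`.
  refine ⟨fun u ↦ (gram m Φ (u, (Φ p).2)).bilinearComp ι₁ ι₁,
    fun v ↦ (gram m Φ ((Φ p).1, v)).bilinearComp ι₂ ι₂, ⟨hU, fun u hu ↦ ?_, fun u _ a a' ↦ ?_,
    fun u hu a ha ↦ ?_⟩, ⟨hV, fun v hv ↦ ?_, fun v _ c c' ↦ ?_, fun v hv c hc ↦ ?_⟩,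
    fun x hx v w ↦ ?_⟩
  · refine (contDiffAt_clm_apply_iff.2 fun a ↦ contDiffAt_clm_apply_iff.2 fun a' ↦
      ?_).contDiffWithinAt
    exact ((((contDiffAt_gram hΦ (hmem hu hv₀)).comp u (contDiffAt_id.prodMk
      contDiffAt_const)).clm_apply contDiffAt_const).clm_apply contDiffAt_const)
  · simp only [ContinuousLinearMap.bilinearComp_apply]
    rw [gram_comm]
  · simp only [ContinuousLinearMap.bilinearComp_apply]
    exact gram_self_pos hΦ (hmem hu hv₀) (by simpa [ι₁] using ha)
  · refine (contDiffAt_clm_apply_iff.2 fun a ↦ contDiffAt_clm_apply_iff.2 fun a' ↦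
      ?_).contDiffWithinAt
    exact ((((contDiffAt_gram hΦ (hmem hu₀ hv)).comp v (contDiffAt_const.prodMk
      contDiffAt_id)).clm_apply contDiffAt_const).clm_apply contDiffAt_const)
  · simp only [ContinuousLinearMap.bilinearComp_apply]
    rw [gram_comm]
  · simp only [ContinuousLinearMap.bilinearComp_apply]
    exact gram_self_pos hΦ (hmem hu₀ hv) (by simpa [ι₂] using hc)
  · obtain ⟨a, ha⟩ : ∃ a, mvfderiv (𝓡 m) Φ x v = a := ⟨_, rfl⟩
    obtain ⟨b, hb⟩ : ∃ b, mvfderiv (𝓡 m) Φ x w = b := ⟨_, rfl⟩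
    have hdec (v : TangentSpace (𝓡 m) x) (a) (ha : mvfderiv (𝓡 m) Φ x v = a) :
        v = constField m Φ (a.1, 0) x + constField m Φ (0, a.2) x := by
      rw [← IsSmoothChart.constField_add, ← hΦ.constField_mfderiv hx v]
      congr 1
      exact ha.trans (by simp)
    obtain ⟨hxU, hxV⟩ : Φ x ∈ U ×ˢ V := htgt ▸ Φ.map_source hx
    have e₁ : ⟪constField m Φ (a.1, 0) x, constField m Φ (b.1, 0) x⟫_ℝ
        = gram m Φ ((Φ x).1, (Φ p).2) (a.1, 0) (b.1, 0) := by
      rw [← const₁ hxU hxV hv₀, Prod.mk.eta, gram_apply, Φ.left_inv hx]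
    have e₂ : ⟪constField m Φ (0, a.2) x, constField m Φ (0, b.2) x⟫_ℝ
        = gram m Φ ((Φ p).1, (Φ x).2) (0, a.2) (0, b.2) := by
      rw [← const₂ hxU hu₀ hxV, Prod.mk.eta, gram_apply, Φ.left_inv hx]
    have e₃ : ⟪constField m Φ (a.1, 0) x, constField m Φ (0, b.2) x⟫_ℝ = 0 :=
      horth x _ (mem₁ a.1 x hx) _ (mem₂ b.2 x hx)
    have e₄ : ⟪constField m Φ (0, a.2) x, constField m Φ (b.1, 0) x⟫_ℝ = 0 :=
      (real_inner_comm _ _).trans (horth x _ (mem₁ b.1 x hx) _ (mem₂ a.2 x hx))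
    calc ⟪v, w⟫_ℝ = ⟪constField m Φ (a.1, 0) x + constField m Φ (0, a.2) x,
          constField m Φ (b.1, 0) x + constField m Φ (0, b.2) x⟫_ℝ :=
          congrArg₂ (fun v w : TangentSpace (𝓡 m) x ↦ ⟪v, w⟫_ℝ) (hdec v a ha) (hdec w b hb)
      _ = gram m Φ ((Φ x).1, (Φ p).2) (a.1, 0) (b.1, 0)
          + gram m Φ ((Φ p).1, (Φ x).2) (0, a.2) (0, b.2) := by
          rw [inner_add_left, inner_add_right, inner_add_right, e₁, e₂, e₃, e₄, add_zero, zero_add]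
      _ = _ := by rw [ha, hb]; rfl

end ProductMetric

/-! ### Horizontal lifts of coordinate frames. -/

section HorizontalLift

variable {m : ℕ} {M : Type*} [TopologicalSpace M] [ChartedSpace (EuclideanSpace ℝ (Fin m)) M]
  [RiemannianBundle (fun x : M ↦ TangentSpace (𝓡 m) x)]
  {n : ℕ} {N : Type*} [TopologicalSpace N] [ChartedSpace (EuclideanSpace ℝ (Fin n)) N]
  {F : M → N}

theorem eq_of_mem_horizontal {x : M} {v w : TangentSpace (𝓡 m) x} (hv : v ∈ horizontal n F x)
    (hw : w ∈ horizontal n F x) (h : mfderiv (𝓡 m) (𝓡 n) F x v = mfderiv (𝓡 m) (𝓡 n) F x w) :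
    v = w := by
  have h1 : v - w ∈ vertical (m := m) n F x := by rw [mem_vertical, map_sub, h, sub_self]
  have h2 := inner_vertical_horizontal h1 (Submodule.sub_mem _ hv hw)
  exact sub_eq_zero.1 (inner_self_eq_zero.1 h2)

variable [RiemannianBundle (fun y : N ↦ TangentSpace (𝓡 n) y)]

namespace IsRiemannianSubmersion

theorem exists_horizontal_lift (hF : IsRiemannianSubmersion (m := m) (n := n) F) (Y : VField n N) :
    ∃ X : VField m M, (∀ x, X x ∈ horizontal n F x) ∧
      ∀ x, mfderiv (𝓡 m) (𝓡 n) F x (X x) = Y (F x) := by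
  choose X hX using fun x ↦ hF.surjective_mfderiv x (Y (F x))
  exact ⟨hor n F X, hor_apply_mem X, fun x ↦ (mfderiv_hor X x).trans (hX x)⟩

/-- The horizontal lift of the vector field `Y`. -/
def horLift (hF : IsRiemannianSubmersion (m := m) (n := n) F) (Y : VField n N) : VField m M :=
  (hF.exists_horizontal_lift Y).choose

theorem horLift_mem (hF : IsRiemannianSubmersion (m := m) (n := n) F) (Y : VField n N) (x : M) :
    hF.horLift Y x ∈ horizontal n F x :=
  (hF.exists_horizontal_lift Y).choose_spec.1 x

theorem mfderiv_horLift (hF : IsRiemannianSubmersion (m := m) (n := n) F) (Y : VField n N)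
    (x : M) : mfderiv (𝓡 m) (𝓡 n) F x (hF.horLift Y x) = Y (F x) :=
  (hF.exists_horizontal_lift Y).choose_spec.2 x

/-- The lift comes from a pointwise choice, but its inner product with a smooth `Z` is `⟪Y ∘ F, F_*
Z⟫`, which is smooth. -/
theorem isSmoothAt_horLift [IsManifold (𝓡 m) ∞ M] [IsManifold (𝓡 n) ∞ N]
    [IsContMDiffRiemannianBundle (𝓡 m) ∞ (EuclideanSpace ℝ (Fin m))
      (fun x : M ↦ TangentSpace (𝓡 m) x)]
    [IsContMDiffRiemannianBundle (𝓡 n) ∞ (EuclideanSpace ℝ (Fin n))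
      (fun y : N ↦ TangentSpace (𝓡 n) y)]
    (hF : IsRiemannianSubmersion (m := m) (n := n) F) {Y : VField n N} {p : M}
    (hY : IsSmoothAt Y (F p)) : IsSmoothAt (hF.horLift Y) p := by
  refine isSmoothAt_of_inner (isSmoothChart_chartAt p) (mem_chart_source _ p) fun w ↦ ?_
  have h (x : M) := hF.inner_hor (hF.horLift Y)
    (coordField m (chartAt (EuclideanSpace ℝ (Fin m)) p) fun _ ↦ w) x
  simp only [hor_eq_self (hF.horLift_mem Y _), hF.mfderiv_horLift] at h
  simp only [h]
  exact ContMDiffAt.inner_bundle (b := F) (E := fun y : N ↦ TangentSpace (𝓡 n) y)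
    (ContMDiffAt.comp p hY hF.smooth.contMDiffAt) (hF.contMDiffAt_mfderiv
      ((isSmoothChart_chartAt p).isSmoothAt_coordField (mem_chart_source _ p) contDiffAt_const))

variable {E₂ : Type*} [NormedAddCommGroup E₂] [NormedSpace ℝ E₂]
  {ψ : OpenPartialHomeomorph N E₂}

/-- The horizontal lift of the coordinate frame of `ψ`. -/
def liftFrame (hF : IsRiemannianSubmersion (m := m) (n := n) F) (ψ : OpenPartialHomeomorph N E₂)
    (x : M) : E₂ →ₗ[ℝ] TangentSpace (𝓡 m) x where
  toFun w := hF.horLift (constField n ψ w) x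
  map_add' v w := eq_of_mem_horizontal (hF.horLift_mem _ x)
    (Submodule.add_mem _ (hF.horLift_mem _ x) (hF.horLift_mem _ x)) (by
      rw [map_add, hF.mfderiv_horLift, hF.mfderiv_horLift, hF.mfderiv_horLift,
        IsSmoothChart.constField_add])
  map_smul' c w := eq_of_mem_horizontal (hF.horLift_mem _ x)
    (Submodule.smul_mem _ _ (hF.horLift_mem _ x)) (by
      rw [map_smul, hF.mfderiv_horLift, hF.mfderiv_horLift, RingHom.id_apply,
        IsSmoothChart.constField_smul])

theorem liftFrame_mem (hF : IsRiemannianSubmersion (m := m) (n := n) F) (x : M) (w : E₂) :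
    hF.liftFrame ψ x w ∈ horizontal n F x := hF.horLift_mem _ x

theorem mfderiv_comp_liftFrame (hF : IsRiemannianSubmersion (m := m) (n := n) F)
    (hψ : IsSmoothChart (m := n) ψ) {x : M} (hx : F x ∈ ψ.source) (w : E₂) :
    mfderiv (𝓡 m) 𝓘(ℝ, E₂) (ψ ∘ F) x (hF.liftFrame ψ x w) = w := by
  have h := mfderiv_comp_apply (I := 𝓡 m) (I' := 𝓡 n) (I'' := 𝓘(ℝ, E₂)) x
    ((hψ.contMDiffAt hx).mdifferentiableAt (by simp)) (hF.smooth.contMDiffAt.mdifferentiableAt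
      (by simp)) (hF.liftFrame ψ x w)
  refine h.trans ?_
  have h2 : mfderiv (𝓡 m) (𝓡 n) F x (hF.liftFrame ψ x w) = constField n ψ w (F x) :=
    hF.mfderiv_horLift _ x
  rw [h2, hψ.mfderiv_coordField hx]

theorem mfderiv_comp_eq_zero_iff (hF : IsRiemannianSubmersion (m := m) (n := n) F)
    (hψ : IsSmoothChart (m := n) ψ) {x : M} (hx : F x ∈ ψ.source) (v : TangentSpace (𝓡 m) x) :
    mfderiv (𝓡 m) 𝓘(ℝ, E₂) (ψ ∘ F) x v = 0 ↔ v ∈ vertical n F x := by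
  have h := mfderiv_comp_apply (I := 𝓡 m) (I' := 𝓡 n) (I'' := 𝓘(ℝ, E₂)) x
    ((hψ.contMDiffAt hx).mdifferentiableAt (by simp)) (hF.smooth.contMDiffAt.mdifferentiableAt
      (by simp)) v
  rw [h, mem_vertical]
  exact map_eq_zero_iff (mfderiv (𝓡 n) 𝓘(ℝ, E₂) ψ (F x)) (hψ.mfderiv_injective hx)

theorem contMDiffAt_comp (hF : IsRiemannianSubmersion (m := m) (n := n) F)
    (hψ : IsSmoothChart (m := n) ψ) {x : M} (hx : F x ∈ ψ.source) :
    ContMDiffAt (𝓡 m) 𝓘(ℝ, E₂) ∞ (ψ ∘ F) x :=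
  (hψ.contMDiffAt hx).comp x hF.smooth.contMDiffAt

theorem exists_liftFrame_eq (hF : IsRiemannianSubmersion (m := m) (n := n) F)
    (hψ : IsSmoothChart (m := n) ψ) {x : M} (hx : F x ∈ ψ.source) {v : TangentSpace (𝓡 m) x}
    (hv : v ∈ horizontal n F x) : ∃ w, hF.liftFrame ψ x w = v :=
  ⟨mfderiv (𝓡 n) 𝓘(ℝ, E₂) ψ (F x) (mfderiv (𝓡 m) (𝓡 n) F x v),
    eq_of_mem_horizontal (hF.liftFrame_mem x _) hv
      ((hF.mfderiv_horLift _ x).trans (hψ.constField_mfderiv hx _))⟩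

theorem isSmoothAt_liftFrame [IsManifold (𝓡 m) ∞ M] [IsManifold (𝓡 n) ∞ N]
    [IsContMDiffRiemannianBundle (𝓡 m) ∞ (EuclideanSpace ℝ (Fin m))
      (fun x : M ↦ TangentSpace (𝓡 m) x)]
    [IsContMDiffRiemannianBundle (𝓡 n) ∞ (EuclideanSpace ℝ (Fin n))
      (fun y : N ↦ TangentSpace (𝓡 n) y)]
    (hF : IsRiemannianSubmersion (m := m) (n := n) F)
    (hψ : IsSmoothChart (m := n) ψ) {x : M} (hx : F x ∈ ψ.source) (w : E₂) :
    IsSmoothAt (fun x ↦ hF.liftFrame ψ x w) x :=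
  hF.isSmoothAt_horLift (hψ.isSmoothAt_constField hx w)

end IsRiemannianSubmersion

end HorizontalLift

/-! ### Brackets of related fields. -/

section ChartDerivative

variable {m : ℕ} {M : Type*} [TopologicalSpace M] [ChartedSpace (EuclideanSpace ℝ (Fin m)) M]
  {E E' : Type*} [NormedAddCommGroup E] [NormedSpace ℝ E] [NormedAddCommGroup E']
  [NormedSpace ℝ E'] {Φ : OpenPartialHomeomorph M E}

namespace IsSmoothChart

theorem contDiffAt_comp_symm (hΦ : IsSmoothChart (m := m) Φ) {x : M} (hx : x ∈ Φ.source)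
    {h : M → E'} (hh : ContMDiffAt (𝓡 m) 𝓘(ℝ, E') ∞ h x) :
    ContDiffAt ℝ ∞ (h ∘ Φ.symm) (Φ x) := by
  rw [← Φ.left_inv hx] at hh
  exact contMDiffAt_iff_contDiffAt.1 (hh.comp (Φ x) (hΦ.contMDiffAt_symm (Φ.map_source hx)))

theorem fderiv_comp_symm (hΦ : IsSmoothChart (m := m) Φ) {x : M} (hx : x ∈ Φ.source) {h : M → E'}
    (hh : ContMDiffAt (𝓡 m) 𝓘(ℝ, E') ∞ h x) (v : TangentSpace (𝓡 m) x) :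
    fderiv ℝ (h ∘ Φ.symm) (Φ x) (mfderiv (𝓡 m) 𝓘(ℝ, E) Φ x v) = mfderiv (𝓡 m) 𝓘(ℝ, E') h x v := by
  have h1 := mfderiv_comp_apply (I := 𝓡 m) (I' := 𝓘(ℝ, E)) (I'' := 𝓘(ℝ, E')) x
    ((hΦ.contDiffAt_comp_symm hx hh).differentiableAt (by simp)).mdifferentiableAt
    ((hΦ.contMDiffAt hx).mdifferentiableAt (by simp)) v
  rw [mfderiv_eq_fderiv] at h1
  refine h1.symm.trans ?_
  have h2 : (h ∘ Φ.symm) ∘ Φ =ᶠ[𝓝 x] h := by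
    filter_upwards [Φ.open_source.mem_nhds hx] with y hy
    simp [Φ.left_inv hy]
  exact DFunLike.congr_fun (h2.mfderiv_eq (I := 𝓡 m) (I' := 𝓘(ℝ, E'))) v

variable [IsManifold (𝓡 m) ∞ M] [CompleteSpace E]

theorem mlieBracket_eq_coordField (hΦ : IsSmoothChart (m := m) Φ) {x : M} (hx : x ∈ Φ.source)
    {X Y : VField m M} (hX : IsSmoothAt X x) (hY : IsSmoothAt Y x) :
    mlieBracket (𝓡 m) X Y x
      = coordField m Φ (lieBracket ℝ (coordRep Φ X) (coordRep Φ Y)) x := by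
  have h (X : VField m M) : X =ᶠ[𝓝 x] coordField m Φ (coordRep Φ X) := by
    filter_upwards [Φ.open_source.mem_nhds hx] with y hy
    exact (hΦ.coordField_coordRep hy X).symm
  have hs {X : VField m M} (hX : IsSmoothAt X x) : ContDiffAt ℝ ∞ (coordRep Φ X) (Φ x) :=
    hΦ.contDiffAt_coordRep (Φ.map_source hx) (by rwa [Φ.left_inv hx])
  rw [(h X).mlieBracket_vectorField_eq (h Y), hΦ.mlieBracket_coordField hx (hs hX) (hs hY)]

/-- By symmetry of the second derivative, `dh [X, Y]` is the derivative of `dh Y` along `X` minus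
that of `dh X` along `Y`, and both functions are constant near `x`. -/
theorem mfderiv_mlieBracket (hΦ : IsSmoothChart (m := m) Φ) {x : M} (hx : x ∈ Φ.source)
    {X Y : VField m M} (hX : IsSmoothAt X x) (hY : IsSmoothAt Y x) {h : M → E'}
    (hh : ContMDiffAt (𝓡 m) 𝓘(ℝ, E') ∞ h x) {v w : E'}
    (hv : ∀ᶠ y in 𝓝 x, ContMDiffAt (𝓡 m) 𝓘(ℝ, E') ∞ h y ∧ mfderiv (𝓡 m) 𝓘(ℝ, E') h y (X y) = v)
    (hw : ∀ᶠ y in 𝓝 x, mfderiv (𝓡 m) 𝓘(ℝ, E') h y (Y y) = w) :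
    mfderiv (𝓡 m) 𝓘(ℝ, E') h x (mlieBracket (𝓡 m) X Y x) = 0 := by
  have hs {X : VField m M} (hX : IsSmoothAt X x) : DifferentiableAt ℝ (coordRep Φ X) (Φ x) :=
    (hΦ.contDiffAt_coordRep (Φ.map_source hx) (by rwa [Φ.left_inv hx])).differentiableAt (by simp)
  have hcont : Tendsto Φ.symm (𝓝 (Φ x)) (𝓝 x) := Φ.tendsto_symm hx
  have hc {X : VField m M} {v : E'} (hv : ∀ᶠ y in 𝓝 x, ContMDiffAt (𝓡 m) 𝓘(ℝ, E') ∞ h y ∧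
      mfderiv (𝓡 m) 𝓘(ℝ, E') h y (X y) = v) :
      (fun q ↦ fderiv ℝ (h ∘ Φ.symm) q (coordRep Φ X q)) =ᶠ[𝓝 (Φ x)] fun _ ↦ v := by
    filter_upwards [hcont.eventually hv, Φ.open_target.mem_nhds (Φ.map_source hx)] with q hq hqt
    have := hΦ.fderiv_comp_symm (Φ.map_target hqt) hq.1 (X (Φ.symm q))
    rw [Φ.right_inv hqt] at this
    exact this.trans hq.2
  rw [← hΦ.fderiv_comp_symm hx hh, hΦ.mlieBracket_eq_coordField hx hX hY,
    hΦ.mfderiv_coordField hx, fderiv_apply_lieBracket (hΦ.contDiffAt_comp_symm hx hh)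
    (by simpa using by norm_cast)
    (hs hY) (hs hX), (hc hv).fderiv_eq,
    (hc ((hv.and hw).mono fun y hy ↦ ⟨hy.1.1, hy.2⟩)).fderiv_eq]
  simp
  rfl

end IsSmoothChart

end ChartDerivative

/-! ### Integrability of the horizontal distribution. -/

section HorizontalFoliation

variable {m : ℕ} {M : Type*} [TopologicalSpace M] [T2Space M]
  [ChartedSpace (EuclideanSpace ℝ (Fin m)) M] [IsManifold (𝓡 m) ∞ M]
  [RiemannianBundle (fun x : M ↦ TangentSpace (𝓡 m) x)]
  [IsContMDiffRiemannianBundle (𝓡 m) ∞ (EuclideanSpace ℝ (Fin m))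
    (fun x : M ↦ TangentSpace (𝓡 m) x)]
  {n : ℕ} {N : Type*} [TopologicalSpace N] [ChartedSpace (EuclideanSpace ℝ (Fin n)) N]
  [IsManifold (𝓡 n) ∞ N] [RiemannianBundle (fun y : N ↦ TangentSpace (𝓡 n) y)]
  [IsContMDiffRiemannianBundle (𝓡 n) ∞ (EuclideanSpace ℝ (Fin n))
    (fun y : N ↦ TangentSpace (𝓡 n) y)]
  {F : M → N} {E₂ : Type*} [NormedAddCommGroup E₂] [NormedSpace ℝ E₂]
  {ψ : OpenPartialHomeomorph N E₂}

namespace IsRiemannianSubmersion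

/-- The bracket is horizontal by involutivity. It is also vertical, since `ψ ∘ F` maps both fields
to constants. -/
theorem mlieBracket_liftFrame (hF : IsRiemannianSubmersion (m := m) (n := n) F)
    (hψ : IsSmoothChart (m := n) ψ) (h : IsTotallyGeodesic (m := m) (horizontal n F)) {x : M}
    (hx : F x ∈ ψ.source) (v w : E₂) :
    mlieBracket (𝓡 m) (fun x ↦ hF.liftFrame ψ x v) (fun x ↦ hF.liftFrame ψ x w) x = 0 := by
  have hO : IsOpen (F ⁻¹' ψ.source) := ψ.open_source.preimage hF.smooth.continuous
  refine eq_of_mem_horizontal (n := n) (F := F) (h.mlieBracket_mem hO hx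
    (fun y hy ↦ ⟨hF.isSmoothAt_liftFrame hψ hy v, hF.liftFrame_mem y v⟩)
    fun y hy ↦ ⟨hF.isSmoothAt_liftFrame hψ hy w, hF.liftFrame_mem y w⟩) (Submodule.zero_mem _) ?_
  rw [map_zero, ← mem_vertical, ← hF.mfderiv_comp_eq_zero_iff hψ hx]
  refine (isSmoothChart_chartAt x).mfderiv_mlieBracket (v := v) (w := w) (mem_chart_source _ x)
    (hF.isSmoothAt_liftFrame hψ hx v) (hF.isSmoothAt_liftFrame hψ hx w)
    (hF.contMDiffAt_comp hψ hx) ?_ ?_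
  · filter_upwards [hO.mem_nhds hx] with y hy
    exact ⟨hF.contMDiffAt_comp hψ hy, hF.mfderiv_comp_liftFrame hψ hy v⟩
  · filter_upwards [hO.mem_nhds hx] with y hy
    exact hF.mfderiv_comp_liftFrame hψ hy w

/-- A totally geodesic horizontal distribution is, locally, the kernel of the differential of a
submersion. -/
theorem exists_horizontal_eq_ker (hF : IsRiemannianSubmersion (m := m) (n := n) F)
    (h : IsTotallyGeodesic (m := m) (horizontal n F)) (p : M) :
    ∃ (u : M → EuclideanSpace ℝ (Fin (m - n))) (O : Set M), IsOpen O ∧ p ∈ O ∧ ∀ x ∈ O,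
      ContMDiffAt (𝓡 m) 𝓘(ℝ, EuclideanSpace ℝ (Fin (m - n))) ∞ u x ∧
        ∀ v, mfderiv (𝓡 m) 𝓘(ℝ, EuclideanSpace ℝ (Fin (m - n))) u x v = 0 ↔
          v ∈ horizontal n F x := by
  let φ := chartAt (EuclideanSpace ℝ (Fin m)) p
  let ψ := chartAt (EuclideanSpace ℝ (Fin n)) (F p)
  have hφ : IsSmoothChart (m := m) φ := isSmoothChart_chartAt p
  have hψ : IsSmoothChart (m := n) ψ := isSmoothChart_chartAt (F p)
  have hp : p ∈ φ.source := mem_chart_source _ p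
  have hFp : F p ∈ ψ.source := mem_chart_source _ (F p)
  let O₁ : Set (EuclideanSpace ℝ (Fin m)) := φ.target ∩ φ.symm ⁻¹' (F ⁻¹' ψ.source)
  have hO₁ : IsOpen O₁ :=
    φ.isOpen_inter_preimage_symm (ψ.open_source.preimage hF.smooth.continuous)
  have hpO₁ : φ p ∈ O₁ := ⟨φ.map_source hp, by simpa [φ.left_inv hp] using hFp⟩
  let A (q : EuclideanSpace ℝ (Fin m)) : EuclideanSpace ℝ (Fin n) →L[ℝ] EuclideanSpace ℝ (Fin m) :=
    LinearMap.toContinuousLinearMap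
      ((mfderiv (𝓡 m) 𝓘(ℝ, EuclideanSpace ℝ (Fin m)) φ (φ.symm q)).toLinearMap ∘ₗ
        hF.liftFrame ψ (φ.symm q))
  have hA (w) : (fun q ↦ A q w) = coordRep φ fun x ↦ hF.liftFrame ψ x w := rfl
  have hAc (w) (q) (hq : q ∈ O₁) : ContDiffAt ℝ ∞ (fun q ↦ A q w) q :=
    hφ.contDiffAt_coordRep hq.1 (hF.isSmoothAt_liftFrame hψ hq.2 w)
  have hAs (q) (hq : q ∈ O₁) : ContDiffAt ℝ ∞ A q := contDiffAt_clm_apply_iff.2 fun w ↦ hAc w q hq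
  have hinj (q) (hq : q ∈ O₁) : Function.Injective (A q) := by
    refine (hφ.mfderiv_injective (φ.map_target hq.1)).comp fun v w hvw ↦ ?_
    rw [← hF.mfderiv_comp_liftFrame hψ hq.2 v, ← hF.mfderiv_comp_liftFrame hψ hq.2 w, hvw]
  -- In coordinates the bracket of the lifts of `w` and `h'` is the difference of these two terms.
  have hcomm (q) (hq : q ∈ O₁) (w h') : fderiv ℝ A q (A q w) h' = fderiv ℝ A q (A q h') w := by
    have h1 := hF.mlieBracket_liftFrame hψ h hq.2 w h'
    rw [hφ.mlieBracket_eq_coordField (φ.map_target hq.1) (hF.isSmoothAt_liftFrame hψ hq.2 w)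
      (hF.isSmoothAt_liftFrame hψ hq.2 h')] at h1
    have h2 := hφ.mfderiv_coordField (φ.map_target hq.1)
      (lieBracket ℝ (fun q ↦ A q w) (fun q ↦ A q h'))
    have h3 : coordField m φ (lieBracket ℝ (fun q ↦ A q w) (fun q ↦ A q h')) (φ.symm q) = 0 := h1
    rw [h3, map_zero, φ.right_inv hq.1] at h2
    have hd (w : EuclideanSpace ℝ (Fin n)) :=
      ((hAs q hq).differentiableAt (by simp)).hasFDerivAt.clm_apply (hasFDerivAt_const w q)
    have h4 : fderiv ℝ (fun q ↦ A q h') q (A q w) - fderiv ℝ (fun q ↦ A q w) q (A q h') = 0 :=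
      h2.symm
    rw [(hd h').fderiv, (hd w).fderiv] at h4
    simpa [sub_eq_zero] using h4
  have hk : m - n + Module.finrank ℝ (EuclideanSpace ℝ (Fin n))
      = Module.finrank ℝ (EuclideanSpace ℝ (Fin m)) := by
    simpa using Nat.sub_add_cancel hF.dim_lt.le
  obtain ⟨f, O₂, hO₂, hpO₂, hsub, hfs, hf⟩ := exists_firstIntegrals hO₁
    (fun q hq ↦ (hAs q hq).contDiffWithinAt) hpO₁ (hinj _ hpO₁) hcomm hk
  refine ⟨f ∘ φ, φ.source ∩ φ ⁻¹' O₂, φ.isOpen_inter_preimage hO₂, ⟨hp, hpO₂⟩, fun x hx ↦ ?_⟩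
  have hfc : ContDiffAt ℝ ∞ f (φ x) := hfs.contDiffAt (hO₂.mem_nhds hx.2)
  have hfm : ContMDiffAt (𝓡 m) 𝓘(ℝ, EuclideanSpace ℝ (Fin (m - n))) ∞ (f ∘ φ) x :=
    hfc.contMDiffAt.comp x (hφ.contMDiffAt hx.1)
  refine ⟨hfm, fun v ↦ ?_⟩
  have hxO₁ := hsub hx.2
  have hFx : F x ∈ ψ.source := by simpa [φ.left_inv hx.1] using hxO₁.2
  have hAx (w) : A (φ x) w = mfderiv (𝓡 m) 𝓘(ℝ, EuclideanSpace ℝ (Fin m)) φ x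
      (hF.liftFrame ψ x w) := by
    change mfderiv (𝓡 m) 𝓘(ℝ, EuclideanSpace ℝ (Fin m)) φ (φ.symm (φ x))
      (hF.liftFrame ψ (φ.symm (φ x)) w) = _
    rw [φ.left_inv hx.1]
  -- The first integrals only give an inclusion; equality follows by dimension, as the range has
  -- dimension `n` and the kernel `m - (m - n)`.
  have hker : LinearMap.range (A (φ x)).toLinearMap
      = LinearMap.ker (fderiv ℝ f (φ x)).toLinearMap := by
    refine Submodule.eq_of_le_of_finrank_eq ?_ ?_
    · rintro _ ⟨w, rfl⟩
      exact (hf _ hx.2).2 w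
    · have h1 := LinearMap.finrank_range_of_inj (f := (A (φ x)).toLinearMap) (hinj _ hxO₁)
      have h2 := LinearMap.finrank_range_add_finrank_ker (fderiv ℝ f (φ x)).toLinearMap
      rw [LinearMap.range_eq_top.2 (hf _ hx.2).1, finrank_top] at h2
      simp only [finrank_euclideanSpace, Fintype.card_fin] at h1 h2 hk
      omega
  have h1 := mfderiv_comp_apply (I := 𝓡 m) (I' := 𝓘(ℝ, EuclideanSpace ℝ (Fin m)))
    (I'' := 𝓘(ℝ, EuclideanSpace ℝ (Fin (m - n)))) x
    ((hfc.differentiableAt (by simp)).mdifferentiableAt)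
    ((hφ.contMDiffAt hx.1).mdifferentiableAt (by simp)) v
  rw [mfderiv_eq_fderiv] at h1
  rw [h1]
  refine (SetLike.ext_iff.1 hker (mfderiv (𝓡 m) 𝓘(ℝ, EuclideanSpace ℝ (Fin m)) φ x v)).symm.trans ?_
  constructor
  · rintro ⟨w, hw⟩
    rw [← hφ.mfderiv_injective hx.1 ((hAx w).symm.trans hw)]
    exact hF.liftFrame_mem x w
  · intro hv
    obtain ⟨w, rfl⟩ := hF.exists_liftFrame_eq hψ hFx hv
    exact ⟨w, hAx w⟩

end IsRiemannianSubmersion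

end HorizontalFoliation

/-! ### The adapted product chart and the equivalence of (1) and (3). -/

section ProductChart

variable {m : ℕ} {M : Type*} [TopologicalSpace M] [ChartedSpace (EuclideanSpace ℝ (Fin m)) M]

/-- The inverse function theorem on a manifold. -/
theorem exists_isSmoothChart_of_injective [IsManifold (𝓡 m) ∞ M] {E : Type*}
    [NormedAddCommGroup E] [NormedSpace ℝ E] [FiniteDimensional ℝ E]
    (hE : Module.finrank ℝ E = m) {G : M → E} {O : Set M} (hO : IsOpen O)
    (hG : ∀ x ∈ O, ContMDiffAt (𝓡 m) 𝓘(ℝ, E) ∞ G x) {p : M} (hp : p ∈ O)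
    (hinj : Function.Injective (mfderiv (𝓡 m) 𝓘(ℝ, E) G p)) :
    ∃ Φ : OpenPartialHomeomorph M E, IsSmoothChart (m := m) Φ ∧ p ∈ Φ.source ∧ Φ.source ⊆ O ∧
      Set.EqOn Φ G Φ.source := by
  let φ := chartAt (EuclideanSpace ℝ (Fin m)) p
  have hφ : IsSmoothChart (m := m) φ := isSmoothChart_chartAt p
  have hpφ : p ∈ φ.source := mem_chart_source _ p
  have hO₁ : IsOpen (φ.target ∩ φ.symm ⁻¹' O) := φ.isOpen_inter_preimage_symm hO
  have hg (q) (hq : q ∈ φ.target ∩ φ.symm ⁻¹' O) : ContDiffAt ℝ ∞ (G ∘ φ.symm) q := by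
    have := hφ.contDiffAt_comp_symm (φ.map_target hq.1) (hG _ hq.2)
    rwa [φ.right_inv hq.1] at this
  have hpO₁ : φ p ∈ φ.target ∩ φ.symm ⁻¹' O :=
    ⟨φ.map_source hpφ, by simpa [φ.left_inv hpφ] using hp⟩
  have hinj' : Function.Injective (fderiv ℝ (G ∘ φ.symm) (φ p)) := by
    intro v w hvw
    have h1 (v) := hφ.fderiv_comp_symm hpφ (hG p hp) (constField m φ v p)
    simp only [hφ.mfderiv_coordField hpφ] at h1
    have h2 : constField m φ v p = constField m φ w p :=
      hinj ((h1 v).symm.trans (hvw.trans (h1 w)))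
    have h3 (v) : mfderiv (𝓡 m) 𝓘(ℝ, EuclideanSpace ℝ (Fin m)) φ p (constField m φ v p) = v :=
      hφ.mfderiv_coordField hpφ _
    exact (h3 v).symm.trans ((congrArg _ h2).trans (h3 w))
  let e := (LinearEquiv.ofInjectiveOfFinrankEq (fderiv ℝ (G ∘ φ.symm) (φ p)).toLinearMap hinj'
    (by simpa using hE.symm)).toContinuousLinearEquiv
  obtain ⟨χ, hχp, hχO, hχ, hχs, hχs'⟩ := exists_openPartialHomeomorph_of_contDiffOn hO₁
    (fun q hq ↦ (hg q hq).contDiffWithinAt) hpO₁ e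
    ((hg _ hpO₁).differentiableAt (by simp)).hasFDerivAt
  refine ⟨φ.trans χ, ⟨fun x hx ↦ ?_, fun q hq ↦ ?_⟩, by simpa using ⟨hpφ, hχp⟩, fun x hx ↦ ?_,
    fun x hx ↦ ?_⟩
  · rw [φ.trans_source] at hx
    exact ((hχs.contDiffAt (χ.open_source.mem_nhds hx.2)).contMDiffAt.comp x
      (hφ.contMDiffAt hx.1)).contMDiffWithinAt
  · rw [φ.trans_target] at hq
    exact ((hφ.contMDiffAt_symm hq.2).comp q
      (hχs'.contDiffAt (χ.open_target.mem_nhds hq.1)).contMDiffAt).contMDiffWithinAt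
  · rw [φ.trans_source] at hx
    simpa [φ.left_inv hx.1] using (hχO hx.2).2
  · rw [φ.trans_source] at hx
    simp [hχ, φ.left_inv hx.1]

/-- On a product space with the sup norm such a ball is a product of balls, which supplies the
preconnected factors that `exists_productMetric` needs. -/
theorem IsSmoothChart.exists_target_eq_ball {E : Type*} [NormedAddCommGroup E] [NormedSpace ℝ E]
    {Φ : OpenPartialHomeomorph M E} (hΦ : IsSmoothChart (m := m) Φ) {p : M} (hp : p ∈ Φ.source) :
    ∃ (Φ' : OpenPartialHomeomorph M E) (ε : ℝ), IsSmoothChart (m := m) Φ' ∧ p ∈ Φ'.source ∧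
      Φ'.target = Metric.ball (Φ p) ε ∧ Φ'.source ⊆ Φ.source ∧ (Φ' : M → E) = Φ := by
  obtain ⟨ε, hε, hball⟩ := Metric.isOpen_iff.1 Φ.open_target _ (Φ.map_source hp)
  let Φ' := (Φ.symm.restrOpen (Metric.ball (Φ p) ε) Metric.isOpen_ball).symm
  have ht : Φ'.target = Metric.ball (Φ p) ε := Set.inter_eq_right.2 hball
  have hs : Φ'.source ⊆ Φ.source := Set.inter_subset_left
  refine ⟨Φ', ε, ⟨hΦ.contMDiffOn.mono hs, hΦ.contMDiffOn_symm.mono (ht ▸ hball)⟩, ?_, ht, hs, rfl⟩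
  exact ⟨hp, Metric.mem_ball_self hε⟩

theorem mfderiv_clm_comp {E E' : Type*} [NormedAddCommGroup E] [NormedSpace ℝ E]
    [NormedAddCommGroup E'] [NormedSpace ℝ E'] (L : E →L[ℝ] E') {G : M → E} {x : M}
    (hG : MDifferentiableAt (𝓡 m) 𝓘(ℝ, E) G x) (v : TangentSpace (𝓡 m) x) :
    mfderiv (𝓡 m) 𝓘(ℝ, E') (L ∘ G) x v = L (mfderiv (𝓡 m) 𝓘(ℝ, E) G x v) := by
  rw [mfderiv_comp_apply x L.mdifferentiableAt hG, L.mfderiv_eq]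
  rfl

variable [T2Space M] [IsManifold (𝓡 m) ∞ M]
  [RiemannianBundle (fun x : M ↦ TangentSpace (𝓡 m) x)]
  [IsContMDiffRiemannianBundle (𝓡 m) ∞ (EuclideanSpace ℝ (Fin m))
    (fun x : M ↦ TangentSpace (𝓡 m) x)]
  {n : ℕ} {N : Type*} [TopologicalSpace N] [ChartedSpace (EuclideanSpace ℝ (Fin n)) N]
  [IsManifold (𝓡 n) ∞ N] [RiemannianBundle (fun y : N ↦ TangentSpace (𝓡 n) y)]
  [IsContMDiffRiemannianBundle (𝓡 n) ∞ (EuclideanSpace ℝ (Fin n))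
    (fun y : N ↦ TangentSpace (𝓡 n) y)]
  {F : M → N}

/-- The kernels of the differentials of `u` and `ψ ∘ F` are the horizontal and the vertical space,
which meet in `0`, so `(u, ψ ∘ F)` is a local diffeomorphism. Vertical geodesy enters only in
splitting the metric, the fibres being integral manifolds already. -/
theorem IsRiemannianSubmersion.isLocallyProduct (hF : IsRiemannianSubmersion (m := m) (n := n) F)
    (hV : IsTotallyGeodesic (m := m) (vertical n F))
    (hH : IsTotallyGeodesic (m := m) (horizontal n F)) :
    IsLocallyProduct (m := m) (vertical n F) (horizontal n F) := by
  intro p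
  obtain ⟨u, O, hO, hpO, hu⟩ := hF.exists_horizontal_eq_ker hH p
  let ψ := chartAt (EuclideanSpace ℝ (Fin n)) (F p)
  have hψ : IsSmoothChart (m := n) ψ := isSmoothChart_chartAt (F p)
  have hO' : IsOpen (O ∩ F ⁻¹' ψ.source) :=
    hO.inter (ψ.open_source.preimage hF.smooth.continuous)
  have hp : p ∈ O ∩ F ⁻¹' ψ.source := ⟨hpO, mem_chart_source _ (F p)⟩
  let G (x : M) : EuclideanSpace ℝ (Fin (m - n)) × EuclideanSpace ℝ (Fin n) := (u x, (ψ ∘ F) x)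
  have hG (x) (hx : x ∈ O ∩ F ⁻¹' ψ.source) : ContMDiffAt (𝓡 m) 𝓘(ℝ, _) ∞ G x :=
    (hu x hx.1).1.prodMk_space (hF.contMDiffAt_comp hψ hx.2)
  have hG' (x) (hx : x ∈ O ∩ F ⁻¹' ψ.source) (v : TangentSpace (𝓡 m) x) :
      (v ∈ vertical n F x ↔ (mvfderiv (𝓡 m) G x v).2 = 0) ∧
        (v ∈ horizontal n F x ↔ (mvfderiv (𝓡 m) G x v).1 = 0) := by
    have hd := (hG x hx).mdifferentiableAt (by simp)
    have h1 : mfderiv (𝓡 m) 𝓘(ℝ, EuclideanSpace ℝ (Fin (m - n))) u x v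
        = (mvfderiv (𝓡 m) G x v).1 := mfderiv_clm_comp (ContinuousLinearMap.fst ℝ _ _) hd v
    have h2 : mfderiv (𝓡 m) 𝓘(ℝ, EuclideanSpace ℝ (Fin n)) (ψ ∘ F) x v
        = (mvfderiv (𝓡 m) G x v).2 := mfderiv_clm_comp (ContinuousLinearMap.snd ℝ _ _) hd v
    exact ⟨(hF.mfderiv_comp_eq_zero_iff hψ hx.2 v).symm.trans (Eq.congr_left h2),
      ((hu x hx.1).2 v).symm.trans (Eq.congr_left h1)⟩
  have hinj : Function.Injective (mfderiv (𝓡 m)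
      𝓘(ℝ, EuclideanSpace ℝ (Fin (m - n)) × EuclideanSpace ℝ (Fin n)) G p) := by
    refine (injective_iff_map_eq_zero _).2 fun v hv ↦ ?_
    have hv' : mvfderiv (𝓡 m) G p v = 0 := hv
    obtain ⟨h1, h2⟩ := hG' p hp v
    rw [hv'] at h1 h2
    exact inner_self_eq_zero.1 (inner_vertical_horizontal (h1.2 rfl) (h2.2 rfl))
  have hdim : Module.finrank ℝ (EuclideanSpace ℝ (Fin (m - n)) × EuclideanSpace ℝ (Fin n)) = m := by
    simpa using Nat.sub_add_cancel hF.dim_lt.le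
  obtain ⟨Φ₀, hΦ₀, hpΦ₀, hΦ₀O, hΦ₀G⟩ := exists_isSmoothChart_of_injective hdim hO' hG hp hinj
  obtain ⟨Φ, ε, hΦ, hpΦ, htgt, hΦs, hΦΦ₀⟩ := hΦ₀.exists_target_eq_ball hpΦ₀
  have hD (x) (hx : x ∈ Φ.source) (v : TangentSpace (𝓡 m) x) :
      (v ∈ vertical n F x ↔ (mvfderiv (𝓡 m) Φ x v).2 = 0) ∧
        (v ∈ horizontal n F x ↔ (mvfderiv (𝓡 m) Φ x v).1 = 0) := by
    have h1 : (Φ : M → _) =ᶠ[𝓝 x] G := by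
      filter_upwards [Φ.open_source.mem_nhds hx] with y hy
      rw [hΦΦ₀, hΦ₀G (hΦs hy)]
    have h2 : mvfderiv (𝓡 m) Φ x v = mvfderiv (𝓡 m) G x v :=
      DFunLike.congr_fun (h1.mfderiv_eq (I := 𝓡 m) (I' := 𝓘(ℝ, _))) v
    rw [h2]
    exact hG' x (hΦ₀O (hΦs hx)) v
  have htgt' : Φ.target = Metric.ball (Φ₀ p).1 ε ×ˢ Metric.ball (Φ₀ p).2 ε :=
    htgt.trans (ball_prod_same _ _ _).symm
  obtain ⟨g₁, g₂, hg₁, hg₂, hg⟩ := exists_productMetric hΦ Metric.isOpen_ball Metric.isOpen_ball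
    (convex_ball _ _).isPreconnected (convex_ball _ _).isPreconnected htgt' hpΦ hV hH
    (fun x v hv w hw ↦ inner_vertical_horizontal hv hw) hD
  exact ⟨_, _, Φ, _, _, g₁, g₂, hpΦ, htgt', hΦ.contMDiffOn, hΦ.contMDiffOn_symm, hg₁, hg₂, hg, hD⟩

/-- The total space of a Riemannian submersion is locally a product if and only if the vertical and
the horizontal distribution are totally geodesic. -/
theorem IsRiemannianSubmersion.isLocallyProduct_iff
    (hF : IsRiemannianSubmersion (m := m) (n := n) F) :
    IsLocallyProduct (m := m) (vertical n F) (horizontal n F) ↔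
      IsTotallyGeodesic (m := m) (vertical n F) ∧ IsTotallyGeodesic (m := m) (horizontal n F) :=
  ⟨fun h ↦ h.isTotallyGeodesic, fun h ↦ hF.isLocallyProduct h.1 h.2⟩

end ProductChart

end SlantSubmersion

end

open SlantSubmersion in
theorem corollary3p1
    {m n : ℕ}
    -- the Riemannian manifold `(M₁, g₁)`, of dimension `m`
    {M₁ : Type*} [TopologicalSpace M₁] [T2Space M₁] [SecondCountableTopology M₁]
    [ChartedSpace (EuclideanSpace ℝ (Fin m)) M₁] [IsManifold (𝓡 m) ∞ M₁]
    [RiemannianBundle (fun x : M₁ ↦ TangentSpace (𝓡 m) x)]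
    [IsContMDiffRiemannianBundle (𝓡 m) ∞ (EuclideanSpace ℝ (Fin m))
      (fun x : M₁ ↦ TangentSpace (𝓡 m) x)]
    -- the Riemannian manifold `(M₂, g₂)`, of dimension `n`
    {M₂ : Type*} [TopologicalSpace M₂] [T2Space M₂] [SecondCountableTopology M₂]
    [ChartedSpace (EuclideanSpace ℝ (Fin n)) M₂] [IsManifold (𝓡 n) ∞ M₂]
    [RiemannianBundle (fun y : M₂ ↦ TangentSpace (𝓡 n) y)]
    [IsContMDiffRiemannianBundle (𝓡 n) ∞ (EuclideanSpace ℝ (Fin n))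
      (fun y : M₂ ↦ TangentSpace (𝓡 n) y)]
    (J : ∀ x : M₁, TangentSpace (𝓡 m) x →L[ℝ] TangentSpace (𝓡 m) x) (hJ : IsKaehler (m := m) J)
    (F : M₁ → M₂) (θ : ℝ) (hF : IsSlantSubmersion (m := m) (n := n) J F θ) (hθ : θ ≠ 0) :
    (IsLocallyProduct (m := m) (vertical n F) (horizontal n F) ↔
      (∀ X Z₁ Z₂ : VField m M₁, IsSection (vertical n F) X → IsSection (horizontal n F) Z₁ →
        IsSection (horizontal n F) Z₂ → ∀ p,
        ⟪hor n F (nabla Z₁ Z₂) p, omega n J F (phi n J F X) p⟫_ℝ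
          = ⟪tensorA n F Z₁ (tensorB n J F Z₂) p + hor n F (nabla Z₁ (tensorC n J F Z₂)) p,
              omega n J F X p⟫_ℝ) ∧
      (∀ X Y Z₁ : VField m M₁, IsSection (vertical n F) X → IsSection (vertical n F) Y →
        IsSection (horizontal n F) Z₁ → ∀ p,
        ⟪hor n F (nabla X (omega n J F (phi n J F Y))) p, Z₁ p⟫_ℝ
          = ⟪hor n F (nabla X (omega n J F Y)) p, tensorC n J F Z₁ p⟫_ℝ
            + ⟪tensorT n F X (omega n J F Y) p, tensorB n J F Z₁ p⟫_ℝ)) ∧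
    (IsLocallyProduct (m := m) (vertical n F) (horizontal n F) ↔
      IsTotallyGeodesic (m := m) (vertical n F) ∧ IsTotallyGeodesic (m := m) (horizontal n F)) := by
  have h := hF.toIsRiemannianSubmersion.isLocallyProduct_iff
  -- The swap is needed because (2) lists the equation of the horizontal distribution first.
  exact ⟨h.trans (and_comm.trans (and_congr (hF.isTotallyGeodesic_horizontal_iff hJ hθ)
    (hF.isTotallyGeodesic_vertical_iff hJ hθ))), h⟩
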